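/- **Setting.** Let $d\ge 1$. For a finite geometric simplicial complex $K$ in some $\mathbb R^m$ let $F_i(K)$ be its set of $i$-dimensional faces, and for $i\ge 1$ let the $i$-dual graph $\Gamma^{(i)}(K)$ be the simple graph on $F_i(K)$ in which $\tau\ne\tau'$ are adjacent iff $\tau\cap\tau'\in F_{i-1}(K)$. Let $\Delta_i=\mathrm{conv}(e_0,\dots,e_i)\subset\mathbb R^{i+1}$ be the standard $i$-simplex. A *subdivision procedure* $\mathrm{div}$ assigns to every geometric complex $K$ of dimension at most $d$ a geometric complex $\mathrm{div}K$ such that every simplex of $\mathrm{div}K$ is contained in a simplex of $K$ and every simplex of $K$ is the union of finitely many simplices of $\mathrm{div}K$. For a face $\tau$ of $K$ let $\mathrm{div}_K\tau$ be the subcomplex of all faces of $\mathrm{div}K$ contained in $\mathrm{conv}\,\tau$. The procedure is *inclusion-uniform* if for every $d$-dimensional $K$, every $\tau\in F_i(K)$ and every bijection $f$ from the vertices of $\tau$ to $\{e_0,\dots,e_i\}$ there is a unique geometric simplicial isomorphism $\tilde f:\mathrm{div}_K\tau\to\mathrm{div}\Delta_i$ extending $f$; geometric means that for every face $\rho$ of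 $\tau$ it carries the part of $\mathrm{div}_K\tau$ in $\mathrm{conv}\,\rho$ onto the part of $\mathrm{div}\Delta_i$ in $\mathrm{conv} f(\rho)$. Put $f_i(\mathrm{div}):=\#F_i(\mathrm{div}\Delta_i)$, and say that $\mathrm{div}$ acts non-trivially on $d$-faces if $f_d(\mathrm{div})>1$. Let $\mathrm{div}$ be inclusion-uniform. Put $\Gamma_0=\Gamma^{(d)}(\mathrm{div}\Delta_d)$, with vertex set $V=F_d(\mathrm{div}\Delta_d)$, and let $\sigma\in S_{d+1}=\mathrm{Sym}\{0,\dots,d\}$ act on $V$ through the automorphism $\tilde\sigma$ of $\mathrm{div}\Delta_d$ extending $e_j\mapsto e_{\sigma(j)}$. Let $\sigma_j$ be the facet of $\Delta_d$ opposite to $e_j$, let $\Sigma_j=F_{d-1}(\mathrm{div}_{\Delta_d}\sigma_j)$, and let $\partial_j\Gamma_0$ be the set of $\tau\in V$ that have a face in $\Sigma_j$. Add to $\Gamma_0$ one loop $\ell_\tau(j)$ for every $j$ and every $\tau\in\partial_j\Gamma_0$; $S_{d+1}$ acts on edges and loops by $\sigma_*\{\tau,\tau'\}=\{\sigma\tau,\sigma\tau'\}$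 and $\sigma_*\ell_\tau(j)=\ell_{\sigma\tau}(\sigma(j))$. A *labelling* $\kappa$ assigns to every $\tau\in V$ and every edge or loop $e$ at $\tau$ a label $\kappa_\tau(e)\in\{0,\dots,d\}$ such that $\kappa_\tau(\ell_\tau(j))=j$ and $\kappa_\tau$ is, for each $\tau$, a bijection from the edges and loops at $\tau$ onto $\{0,\dots,d\}$. Given $\kappa$, let $\nu_{\sigma,\tau}\in S_{d+1}$ be the permutation $\kappa_\tau(e)\mapsto\kappa_{\sigma\tau}(\sigma_*e)$. For a $(d-1)$-face $\nu$ of $\tau$ put $\kappa_\tau(\nu)=\kappa_\tau(\{\tau,\tau'\})$ if $\nu=\tau\cap\tau'$ for a neighbour $\tau'$ of $\tau$, and $\kappa_\tau(\nu)=j$ if $\nu\in\Sigma_j$. For every edge $e=\{\tau,\tau'\}$ let $\rho_{\tau\tau'}\in S_{d+1}$ be the bijection with $\rho_{\tau\tau'}(\kappa_\tau(e))=\kappa_{\tau'}(e)$ and $\rho_{\tau\tau'}(\kappa_\tau(\nu))=\kappa_{\tau'}(\nu')$ whenever $\nu,\nu'\neq\tau\cap\tau'$ are $(d-1)$-faces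 of $\tau$, $\tau'$ such that $\nu\cap\nu'$ is a $(d-2)$-face of $\tau\cap\tau'$ (the empty face if $d=1$). Define $\Gamma_k$ with boundary sets $\partial_j\Gamma_k$ and an $S_{d+1}$-action recursively for $k\ge1$: $V(\Gamma_k)=V\times V(\Gamma_{k-1})$; distinct vertices $(i,v)$ and $(j,w)$ are joined by an edge iff either $i=j$ and $v,w$ are joined by an edge in $\Gamma_{k-1}$, or $e=\{i,j\}$ is an edge of $\Gamma_0$ with $i\ne j$, $v\in\partial_{\kappa_i(e)}\Gamma_{k-1}$, $w\in\partial_{\kappa_j(e)}\Gamma_{k-1}$ and $\rho_{ij}v=w$; further $\partial_l\Gamma_k=\partial_l\Gamma_0\times\partial_l\Gamma_{k-1}$, $\sigma(i,v)=(\sigma i,\nu_{\sigma,i}v)$, and $\Gamma_k$ has exactly one loop $\ell_x(l)$ for every $l$ and every $x\in\partial_l\Gamma_k$. Let $\tilde\Gamma_k$ be $\Gamma_k$ with its loops removed. **Theorem.** Labellings $\kappa$ exist, and for each of them bijections $\rho$ as above exist; the resulting data satisfy: $S_{d+1}$ acts on $\Gamma_0$ by graph automorphisms, each $\partial_j\Gamma_0$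 has $f_{d-1}(\mathrm{div})$ elements, $\deg\tau+\#\{j\mid\tau\in\partial_j\Gamma_0\}=d+1$ for all $\tau\in V$ (with $\deg$ not counting loops), $(i\;j)\,\partial_j\Gamma_0=\partial_i\Gamma_0$, $\sigma\,\partial_i\Gamma_0=\partial_i\Gamma_0$ if $\sigma(i)=i$, $\rho_{ji}=\rho_{ij}^{-1}$ and $\rho_{\sigma i\,\sigma j}=\nu_{\sigma,j}\,\rho_{ij}\,\nu_{\sigma,i}^{-1}$. For every such choice and every $k\ge 0$, $$\tilde\Gamma_k\;\cong\;\Gamma^{(d)}(\mathrm{div}^{k+1}\Delta_d).$$ If $\mathrm{div}$ acts non-trivially on $d$-faces, then $\Gamma_k$ has exactly $(d+1)\,f_{d-1}(\mathrm{div})^{k+1}$ loops for every $k\ge0$. In particular $(\Gamma_k)_k$ then approximates $(\Gamma^{(d)}(\mathrm{div}^{k+1}\Delta_d))_k$, i.e. $\tilde\Gamma_k\cong\Gamma^{(d)}(\mathrm{div}^{k+1}\Delta_d)$ for all $k$ and the number of loops of $\Gamma_k$ divided by its number of vertices tends to $0$ as $k\to\infty$. -/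

import Mathlib

open Filter Topology

/-! ### Geometric simplicial complexes -/

/-- Finite-dimensional real coordinate space; only its affine structure is used. -/
abbrev Pt (m : ℕ) : Type := Fin m → ℝ

/-- Geometric simplicial complexes in `ℝ^m` (the empty face is not listed among the faces). -/
abbrev Cpx (m : ℕ) : Type := Geometry.SimplicialComplex ℝ (Pt m)

/-- `F_i(K)`, the set of `i`-dimensional faces of `K`. -/
def Faces {m : ℕ} (K : Cpx m) (i : ℕ) : Set (Finset (Pt m)) :=
  {s | s ∈ K.faces ∧ s.card = i + 1}

/-- `K` is a finite complex of dimension at most `d`. -/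
def DimLE {m : ℕ} (K : Cpx m) (d : ℕ) : Prop :=
  K.faces.Finite ∧ ∀ s ∈ K.faces, s.card ≤ d + 1

/-- `K` is a finite complex of dimension `d`. -/
def DimEq {m : ℕ} (K : Cpx m) (d : ℕ) : Prop :=
  DimLE K d ∧ (Faces K d).Nonempty

/-- The `j`-th vertex `e_j` of the standard `i`-simplex, for `j = 0, …, i`. -/
noncomputable def corner (i : ℕ) (j : Fin (i + 1)) : Pt (i + 1) := Pi.single j 1

theorem corner_affineIndependent (i : ℕ) : AffineIndependent ℝ (corner i) := by
  have h : LinearIndependent ℝ (corner i) := by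
    have := (Pi.basisFun ℝ (Fin (i + 1))).linearIndependent
    have e : (corner i) = (Pi.basisFun ℝ (Fin (i + 1)) : Fin (i + 1) → Pt (i + 1)) := by
      funext j; simp [corner, Pi.basisFun_apply]
    rw [e]; exact this
  exact h.affineIndependent

/-- The standard simplex `Δ_i = conv(e_0, …, e_i)` in `ℝ^{i+1}` with all its faces. -/
noncomputable def stdCpx (i : ℕ) : Cpx (i + 1) :=
  Geometry.SimplicialComplex.ofAffineIndependent
    { faces := {s | s.Nonempty ∧ s ⊆ Finset.univ.image (corner i)}
      isRelLowerSet_faces := fun _ hs =>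
        ⟨hs.1, fun _ hts ht => ⟨ht, hts.trans hs.2⟩⟩ }
    (by
      refine (corner_affineIndependent i).range.mono ?_
      intro x hx
      simp only [Set.mem_iUnion, Finset.mem_coe] at hx
      obtain ⟨s, hs, hx⟩ := hx
      obtain ⟨j, -, rfl⟩ := Finset.mem_image.1 (hs.2 hx)
      exact ⟨j, rfl⟩)

/-- The face of `Δ_d` opposite to the vertex `e_j`. -/
noncomputable def oppFace (d : ℕ) (j : Fin (d + 1)) : Finset (Pt (d + 1)) :=
  (Finset.univ.erase j).image (corner d)

/-- For a subdivision `L` of a complex `K` and a face `τ` of `K`: the restriction of `L` to `τ`,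
i.e. the subcomplex of all faces of `L` that are contained in `conv τ`. (A face of `L` lies in
`conv τ` iff the smallest face of `K` that contains it is a face of `τ`.) -/
def restrictTo {m : ℕ} (L : Cpx m) (τ : Finset (Pt m)) : Cpx m where
  faces := {s | s ∈ L.faces ∧ (s : Set (Pt m)) ⊆ convexHull ℝ (τ : Set (Pt m))}
  isRelLowerSet_faces := fun _ hs =>
    ⟨L.nonempty_of_mem_faces hs.1, fun _ hts ht =>
      ⟨L.down_closed hs.1 hts ht, (Finset.coe_subset.2 hts).trans hs.2⟩⟩
  indep := fun hs => L.indep hs.1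
  inter_subset_convexHull := fun hs ht => L.inter_subset_convexHull hs.1 ht.1

/-- The `i`-dual graph `Γ^{(i)}(K)`: its vertices are the `i`-faces of `K`, two of them being
adjacent iff they meet in an `(i-1)`-face (used for `i ≥ 1`). -/
def dualGraph {m : ℕ} (K : Cpx m) (i : ℕ) : SimpleGraph (Faces K i) where
  Adj s t := s ≠ t ∧ (s : Finset (Pt m)) ∩ (t : Finset (Pt m)) ∈ Faces K (i - 1)
  symm := ⟨fun s t h => ⟨h.1.symm, by rw [Finset.inter_comm]; exact h.2⟩⟩
  loopless := ⟨fun _ h => h.1 rfl⟩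

/-! ### Inclusion-uniform subdivisions -/

/-- An operation sending geometric complexes to geometric complexes in the same ambient space. -/
abbrev CpxOp : Type := (m : ℕ) → Cpx m → Cpx m

/-- `div` is a subdivision procedure on complexes of dimension at most `d`: every simplex of
`div K` lies in a simplex of `K`, and every simplex of `K` is a finite union of simplices of
`div K`. -/
def IsSubdivisionProcedure (d : ℕ) (div : CpxOp) : Prop :=
  ∀ (m : ℕ) (K : Cpx m), DimLE K d →
    (∀ s ∈ (div m K).faces, ∃ t ∈ K.faces,
      convexHull ℝ (s : Set (Pt m)) ⊆ convexHull ℝ (t : Set (Pt m))) ∧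
    (∀ t ∈ K.faces, ∃ S : Set (Finset (Pt m)), S.Finite ∧ S ⊆ (div m K).faces ∧
      convexHull ℝ (t : Set (Pt m)) = ⋃ s ∈ S, convexHull ℝ (s : Set (Pt m)))

/-- Let `A` and `B` be subdivisions of the simplices with vertices `p i` and `q i` (`i : ι`).
`IsCornerIso A p B q g` says that `g` is (on the vertices of `A`) a simplicial isomorphism
`A ≅ B` that extends the identification `p i ↦ q i` of the corners and is geometric: it carries
the part of `A` in the face `conv {p i | i ∈ ρ}` onto the part of `B` in the corresponding face
`conv {q i | i ∈ ρ}`. -/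
structure IsCornerIso {ι : Type} {m n : ℕ} (A : Cpx m) (p : ι → Pt m) (B : Cpx n) (q : ι → Pt n)
    (g : Pt m → Pt n) : Prop where
  bijOn : Set.BijOn g A.vertices B.vertices
  faces_iff : ∀ s : Finset (Pt m), (s : Set (Pt m)) ⊆ A.vertices →
    (s ∈ A.faces ↔ s.image g ∈ B.faces)
  corners : ∀ i, g (p i) = q i
  geometric : ∀ ρ : Set ι, ∀ v ∈ A.vertices,
    (v ∈ convexHull ℝ (p '' ρ) ↔ g v ∈ convexHull ℝ (q '' ρ))

/-- `div` is an inclusion-uniform subdivision procedure in dimension `d`: for every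
`d`-dimensional complex `K` and every face `τ` of `K` of dimension `i`, every identification `f`
of the vertices of `τ` with the vertices `e_0, …, e_i` of `Δ_i` extends to a unique isomorphism
from the restriction of `div K` to `τ` onto `div Δ_i`. -/
def IsInclusionUniform (d : ℕ) (div : CpxOp) : Prop :=
  IsSubdivisionProcedure d div ∧
  ∀ (m : ℕ) (K : Cpx m), DimEq K d → ∀ (i : ℕ), ∀ τ ∈ Faces K i, ∀ f : τ ≃ Fin (i + 1),
    ∃ g : Pt m → Pt (i + 1),
      IsCornerIso (restrictTo (div m K) τ) (fun v : τ => (v : Pt m))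
        (div (i + 1) (stdCpx i)) (fun v : τ => corner i (f v)) g ∧
      ∀ g' : Pt m → Pt (i + 1),
        IsCornerIso (restrictTo (div m K) τ) (fun v : τ => (v : Pt m))
          (div (i + 1) (stdCpx i)) (fun v : τ => corner i (f v)) g' →
        Set.EqOn g g' (restrictTo (div m K) τ).vertices

/-- `f_i(div)`, the number of `i`-faces of `div Δ_i`. -/
noncomputable def fNum (div : CpxOp) (i : ℕ) : ℕ :=
  (Faces (div (i + 1) (stdCpx i)) i).ncard

/-- The iterated subdivision `div^k Δ_d`. -/
noncomputable def iterDiv (div : CpxOp) (d k : ℕ) : Cpx (d + 1) :=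
  (div (d + 1))^[k] (stdCpx d)

/-! ### Data for self-similar graph sequences

`V` is the vertex set of `Γ_0`; the symmetric group `S_{d+1}` acts on `{0, …, d}` and on `V`. The
graph `Γ_0` has, besides the edges of the simple graph `graph`, one loop `ℓ_v(i)` for every `i`
and every `v ∈ bdry i`. Every such loop carries the label `κ_v(ℓ_v(i)) = i`, and the edge `{v, w}`
carries the labels `κ_v({v, w}) = kappa v w` at `v` and `kappa w v` at `w`. -/

/-- The labels of the edges and loops at every vertex exhaust `{0, …, d}` without repetition:
`kappa v` maps the neighbours of `v` bijectively onto the labels that are not used by loops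
at `v`. Values of `kappa` on non-adjacent pairs are irrelevant. -/
def IsLabelling {d : ℕ} {V : Type*} (G : SimpleGraph V) (bdry : Fin (d + 1) → Set V)
    (kappa : V → V → Fin (d + 1)) : Prop :=
  ∀ v, Set.BijOn (kappa v) (G.neighborSet v) {i | v ∉ bdry i}

/-- The initial graph `Γ_0` with its `S_{d+1}`-action, its boundary sets of size `n`, and
labels. -/
structure LabelledGraph (d n : ℕ) (V : Type*) where
  graph : SimpleGraph V
  act : Equiv.Perm (Fin (d + 1)) →* Equiv.Perm V
  act_adj : ∀ σ v w, graph.Adj v w → graph.Adj (act σ v) (act σ w)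
  bdry : Fin (d + 1) → Set V
  bdry_card : ∀ i, (bdry i).ncard = n
  degree_add : ∀ v, (graph.neighborSet v).ncard + {i | v ∈ bdry i}.ncard = d + 1
  bdry_swap : ∀ i j, act (Equiv.swap i j) '' bdry j = bdry i
  bdry_stab : ∀ i σ, σ i = i → act σ '' bdry i = bdry i
  kappa : V → V → Fin (d + 1)
  isLabelling : IsLabelling graph bdry kappa

namespace LabelledGraph

variable {d n : ℕ} {V : Type*} (D : LabelledGraph d n V)

theorem act_mem_bdry (σ : Equiv.Perm (Fin (d + 1))) {v : V} {i : Fin (d + 1)}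
    (h : v ∈ D.bdry i) : D.act σ v ∈ D.bdry (σ i) := by
  have h1 : D.act (Equiv.swap (σ i) i * σ) v ∈ D.bdry i := by
    rw [← D.bdry_stab i (Equiv.swap (σ i) i * σ) (by simp)]
    exact ⟨v, h, rfl⟩
  have h2 : D.act (Equiv.swap (σ i) i) (D.act (Equiv.swap (σ i) i * σ) v) ∈ D.bdry (σ i) := by
    rw [← D.bdry_swap (σ i) i]
    exact ⟨_, h1, rfl⟩
  rw [← Equiv.Perm.mul_apply, ← map_mul, ← mul_assoc, Equiv.swap_mul_self, one_mul] at h2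
  exact h2

theorem act_mem_bdry_iff (σ : Equiv.Perm (Fin (d + 1))) (v : V) (i : Fin (d + 1)) :
    D.act σ v ∈ D.bdry (σ i) ↔ v ∈ D.bdry i := by
  refine ⟨fun h => ?_, D.act_mem_bdry σ⟩
  have := D.act_mem_bdry σ⁻¹ h
  simpa using this

theorem exists_nbr (v : V) (x : Fin (d + 1)) (h : v ∉ D.bdry x) :
    ∃ w, D.graph.Adj v w ∧ D.kappa v w = x :=
  (D.isLabelling v).surjOn h

open Classical in
/-- The map `κ_v(e) ↦ κ_{σ v}(σ_* e)` on labels, for edges and loops `e` at `v`. -/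
noncomputable def nuFun (σ : Equiv.Perm (Fin (d + 1))) (v : V) (x : Fin (d + 1)) : Fin (d + 1) :=
  if h : v ∈ D.bdry x then σ x
  else D.kappa (D.act σ v) (D.act σ (D.exists_nbr v x h).choose)

theorem nuFun_loop (σ : Equiv.Perm (Fin (d + 1))) {v : V} {x : Fin (d + 1)}
    (h : v ∈ D.bdry x) : D.nuFun σ v x = σ x := by
  simp [nuFun, h]

theorem nuFun_kappa (σ : Equiv.Perm (Fin (d + 1))) {v w : V} (h : D.graph.Adj v w) :
    D.nuFun σ v (D.kappa v w) = D.kappa (D.act σ v) (D.act σ w) := by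
  have hb : v ∉ D.bdry (D.kappa v w) := (D.isLabelling v).mapsTo h
  have hs := (D.exists_nbr v _ hb).choose_spec
  have : (D.exists_nbr v _ hb).choose = w := (D.isLabelling v).injOn hs.1 h hs.2
  simp only [nuFun, hb, dif_neg, not_false_eq_true, this]

theorem nuFun_mul (σ τ : Equiv.Perm (Fin (d + 1))) (v : V) (x : Fin (d + 1)) :
    D.nuFun (σ * τ) v x = D.nuFun σ (D.act τ v) (D.nuFun τ v x) := by
  by_cases h : v ∈ D.bdry x
  · rw [D.nuFun_loop _ h, D.nuFun_loop _ h, D.nuFun_loop _ (D.act_mem_bdry τ h),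
      Equiv.Perm.mul_apply]
  · obtain ⟨w, hw, rfl⟩ := D.exists_nbr v x h
    rw [D.nuFun_kappa _ hw, D.nuFun_kappa _ hw, D.nuFun_kappa _ (D.act_adj τ _ _ hw),
      map_mul, Equiv.Perm.mul_apply, Equiv.Perm.mul_apply]

theorem nuFun_one (v : V) (x : Fin (d + 1)) : D.nuFun 1 v x = x := by
  by_cases h : v ∈ D.bdry x
  · rw [D.nuFun_loop _ h, Equiv.Perm.one_apply]
  · obtain ⟨w, hw, rfl⟩ := D.exists_nbr v x h
    rw [D.nuFun_kappa _ hw, map_one, Equiv.Perm.one_apply, Equiv.Perm.one_apply]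

/-- The permutation `ν_{σ,v}` of `{0, …, d}` with `ν_{σ,v}(κ_v(e)) = κ_{σ v}(σ_* e)`. -/
noncomputable def nu (σ : Equiv.Perm (Fin (d + 1))) (v : V) : Equiv.Perm (Fin (d + 1)) where
  toFun := D.nuFun σ v
  invFun := D.nuFun σ⁻¹ (D.act σ v)
  left_inv x := by rw [← D.nuFun_mul, inv_mul_cancel, D.nuFun_one]
  right_inv x := by
    have hv : D.act σ⁻¹ (D.act σ v) = v := by
      rw [← Equiv.Perm.mul_apply, ← map_mul, inv_mul_cancel, map_one, Equiv.Perm.one_apply]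
    have := D.nuFun_mul σ σ⁻¹ (D.act σ v) x
    rw [hv, mul_inv_cancel, D.nuFun_one] at this
    exact this.symm

theorem nu_mul (σ τ : Equiv.Perm (Fin (d + 1))) (v : V) :
    D.nu (σ * τ) v = D.nu σ (D.act τ v) * D.nu τ v :=
  Equiv.ext fun x => D.nuFun_mul σ τ v x

theorem nu_one (v : V) : D.nu 1 v = 1 := Equiv.ext fun x => D.nuFun_one v x

end LabelledGraph

/-- The full data: a labelled graph with bijections `ρ_{ij}` of `{0, …, d}` for its edges
`{i, j}`. Values of `rho` on non-adjacent pairs are irrelevant. -/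
structure FractalData (d n : ℕ) (V : Type*) extends LabelledGraph d n V where
  rho : V → V → Equiv.Perm (Fin (d + 1))
  rho_kappa : ∀ i j, graph.Adj i j → rho i j (kappa i j) = kappa j i
  rho_symm : ∀ i j, graph.Adj i j → rho j i = (rho i j)⁻¹
  rho_act : ∀ σ i j, graph.Adj i j →
    rho (act σ i) (act σ j) =
      toLabelledGraph.nu σ j * rho i j * (toLabelledGraph.nu σ i)⁻¹

/-! ### The self-similar graph sequence -/

/-- `V(Γ_k)`: `V(Γ_0) = V` and `V(Γ_{k+1}) = V(Γ_0) × V(Γ_k)`. -/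
def Word (V : Type*) : ℕ → Type _
  | 0 => V
  | k + 1 => V × Word V k

/-- One member of the sequence: the loop-free part of the graph, the boundary sets, and the action
of `S_{d+1}`. A vertex `v` carries one loop `ℓ_v(i)` for every `i` with `v ∈ bdry i`. -/
structure Level (d : ℕ) (W : Type*) where
  graph : SimpleGraph W
  bdry : Fin (d + 1) → Set W
  act : Equiv.Perm (Fin (d + 1)) →* Equiv.Perm W

namespace FractalData

variable {d n : ℕ} {V W : Type*} (D : FractalData d n V)

/-- The action `σ (i, v) = (σ i, ν_{σ,i} v)` on the vertices of the next graph. -/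
noncomputable def stepAct (L : Level d W) :
    Equiv.Perm (Fin (d + 1)) →* Equiv.Perm (V × W) :=
  MonoidHom.toHomPerm
    { toFun := fun σ x => (D.act σ x.1, L.act (D.nu σ x.1) x.2)
      map_one' := by
        funext x
        change (D.act 1 x.1, L.act (D.nu 1 x.1) x.2) = x
        simp [D.nu_one]
      map_mul' := by
        intro σ τ
        funext x
        change _ = (D.act σ (D.act τ x.1), L.act (D.nu σ (D.act τ x.1)) (L.act (D.nu τ x.1) x.2))
        rw [D.nu_mul, map_mul, map_mul, Equiv.Perm.mul_apply, Equiv.Perm.mul_apply] }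

/-- The passage from `Γ_{k-1}` to `Γ_k`. Vertices `(i, v)` and `(j, w)` are joined if `i = j` and
`v`, `w` are joined in `Γ_{k-1}`, or if `e = {i, j}` is an edge of `Γ_0`,
`v ∈ ∂_{κ_i(e)} Γ_{k-1}`, `w ∈ ∂_{κ_j(e)} Γ_{k-1}` and `ρ_{ij} v = w`. The boundary sets are
`∂_l Γ_k = ∂_l Γ_0 × ∂_l Γ_{k-1}`. -/
noncomputable def step (L : Level d W) : Level d (V × W) where
  graph :=
    { Adj := fun x y =>
        (x.1 = y.1 ∧ L.graph.Adj x.2 y.2) ∨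
        (D.graph.Adj x.1 y.1 ∧ x.2 ∈ L.bdry (D.kappa x.1 y.1) ∧
          y.2 ∈ L.bdry (D.kappa y.1 x.1) ∧ L.act (D.rho x.1 y.1) x.2 = y.2)
      symm := ⟨by
        rintro x y (⟨h1, h2⟩ | ⟨h1, h2, h3, h4⟩)
        · exact Or.inl ⟨h1.symm, h2.symm⟩
        · refine Or.inr ⟨h1.symm, h3, h2, ?_⟩
          rw [D.rho_symm _ _ h1, ← h4]
          simp⟩
      loopless := ⟨by
        rintro x (⟨-, h⟩ | ⟨h, -⟩)
        · exact L.graph.loopless.irrefl _ h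
        · exact D.graph.loopless.irrefl _ h⟩ }
  bdry := fun l => D.bdry l ×ˢ L.bdry l
  act := D.stepAct L

/-- `Γ_k` with its boundary sets and its action. -/
noncomputable def level : (k : ℕ) → Level d (Word V k)
  | 0 => { graph := D.graph, bdry := D.bdry, act := D.act }
  | k + 1 => D.step (level k)

end FractalData

/-- The multigraph belonging to a level: the edges of the simple graph together with a loop
`ℓ_v(i)`, encoded by `(v, i)`, for every `i` and every `v ∈ bdry i`. -/
def Level.toGraph {d : ℕ} {W : Type*} (L : Level d W) :
    Graph W (Sym2 W ⊕ W × Fin (d + 1)) where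
  vertexSet := Set.univ
  IsLink e x y :=
    (e = Sum.inl s(x, y) ∧ L.graph.Adj x y) ∨
      (x = y ∧ ∃ i, x ∈ L.bdry i ∧ e = Sum.inr (x, i))
  isLink_symm := fun e _ => ⟨by
    rintro x y (⟨h1, h2⟩ | ⟨rfl, h⟩)
    · exact Or.inl ⟨by rw [h1, Sym2.eq_swap], h2.symm⟩
    · exact Or.inr ⟨rfl, h⟩⟩
  eq_or_eq_of_isLink_of_isLink := by
    rintro e x y v w (⟨h1, -⟩ | ⟨rfl, i, -, h1⟩) (⟨h2, -⟩ | ⟨rfl, j, -, h2⟩)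
    · rw [h1] at h2
      have := Sym2.eq_iff.1 (Sum.inl_injective h2)
      tauto
    · simp [h1] at h2
    · simp [h1] at h2
    · rw [h1] at h2
      exact Or.inl (Prod.mk.inj (Sum.inr_injective h2)).1
  left_mem_of_isLink := fun _ _ _ _ => Set.mem_univ _

/-- The graph `Γ_k` of the self-similar sequence, a multigraph with loops. -/
noncomputable def FractalData.gamma {d n : ℕ} {V : Type*} (D : FractalData d n V) (k : ℕ) :
    Graph (Word V k) (Sym2 (Word V k) ⊕ Word V k × Fin (d + 1)) :=
  (D.level k).toGraph

/-- The simple graph obtained from a multigraph by removing loops (and identifying parallel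
edges). -/
def removeLoops {α β : Type*} (G : Graph α β) : SimpleGraph G.vertexSet where
  Adj x y := x ≠ y ∧ G.Adj x y
  symm := ⟨fun _ _ h => ⟨h.1.symm, h.2.symm⟩⟩
  loopless := ⟨fun _ h => h.1 rfl⟩

/-- The number of loops of a multigraph. -/
noncomputable def numLoops {α β : Type*} (G : Graph α β) : ℕ := {e | ∃ x, G.IsLoopAt e x}.ncard

/-- A sequence of graphs with loops approximates a sequence of simple graphs if it becomes
isomorphic to it after removing loops and the number of loops is asymptotically negligible with
respect to the number of vertices. -/
def Approximates {α β γ : ℕ → Type*} (G : (k : ℕ) → Graph (α k) (β k))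
    (H : (k : ℕ) → SimpleGraph (γ k)) : Prop :=
  (∀ k, Nonempty (removeLoops (G k) ≃g H k)) ∧
  Tendsto (fun k => (numLoops (G k) : ℝ) / ((G k).vertexSet.ncard : ℝ)) atTop (𝓝 0)

/-! ### The data coming from an inclusion-uniform subdivision -/

/-- `V(Γ_0) = F_d(div Δ_d)`. -/
abbrev Facet (d : ℕ) (div : CpxOp) : Type := Faces (div (d + 1) (stdCpx d)) d

/-- `Γ_0 = Γ^{(d)}(div Δ_d)`. -/
noncomputable def divGraph (d : ℕ) (div : CpxOp) : SimpleGraph (Facet d div) :=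
  dualGraph (div (d + 1) (stdCpx d)) d

/-- `Σ_j`: the `(d-1)`-faces of the restriction of `div Δ_d` to the face opposite to `e_j`. -/
noncomputable def sideFaces (d : ℕ) (div : CpxOp) (j : Fin (d + 1)) :
    Set (Finset (Pt (d + 1))) :=
  Faces (restrictTo (div (d + 1) (stdCpx d)) (oppFace d j)) (d - 1)

/-- `∂_j Γ_0`: the facets of `div Δ_d` that have a face in `Σ_j`. -/
def divBdry (d : ℕ) (div : CpxOp) (j : Fin (d + 1)) : Set (Facet d div) :=
  {τ | ∃ ν ∈ sideFaces d div j, ν ⊆ (τ : Finset (Pt (d + 1)))}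

/-- The `(d-1)`-face `ν` of the facet `τ` has label `x`: either `ν = τ ∩ τ'` for a neighbour `τ'`
of `τ` and `κ_τ({τ, τ'}) = x`, or `ν` lies in `Σ_x` and thus belongs to the loop `ℓ_τ(x)`. -/
def HasLabel {d : ℕ} {div : CpxOp} (kappa : Facet d div → Facet d div → Fin (d + 1))
    (τ : Facet d div) (ν : Finset (Pt (d + 1))) (x : Fin (d + 1)) : Prop :=
  (∃ τ' : Facet d div, (divGraph d div).Adj τ τ' ∧
    ν = (τ : Finset (Pt (d + 1))) ∩ (τ' : Finset (Pt (d + 1))) ∧ kappa τ τ' = x) ∨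
  (ν ∈ sideFaces d div x ∧ ν ⊆ (τ : Finset (Pt (d + 1))))

/-- `D` is the data given by `div`: `Γ_0 = Γ^{(d)}(div Δ_d)` with the boundary sets `∂_j Γ_0`,
`σ ∈ S_{d+1}` acts by the automorphism of `div Δ_d` extending `e_j ↦ e_{σ j}`, and for an edge
`{τ, τ'}` the bijection `ρ` sends the label of a face `ν ≠ τ ∩ τ'` of `τ` to the label of the
unique face `ν' ≠ τ ∩ τ'` of `τ'` for which `ν ∩ ν'` is a `(d-2)`-face of `τ ∩ τ'` (the empty face
if `d = 1`). The labels `D.kappa` are not restricted. -/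
structure IsDivData {d : ℕ} {div : CpxOp} (D : FractalData d (fNum div (d - 1)) (Facet d div)) :
    Prop where
  graph_eq : D.graph = divGraph d div
  bdry_eq : D.bdry = divBdry d div
  act_eq : ∀ (σ : Equiv.Perm (Fin (d + 1))) (g : Pt (d + 1) → Pt (d + 1)),
    IsCornerIso (div (d + 1) (stdCpx d)) (corner d)
      (div (d + 1) (stdCpx d)) (fun j => corner d (σ j)) g →
    ∀ τ : Facet d div,
      (D.act σ τ : Finset (Pt (d + 1))) = (τ : Finset (Pt (d + 1))).image g
  rho_eq : ∀ τ τ' : Facet d div, (divGraph d div).Adj τ τ' →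
    ∀ (ν ν' : Finset (Pt (d + 1))) (x y : Fin (d + 1)),
      HasLabel D.kappa τ ν x → HasLabel D.kappa τ' ν' y →
      ν ≠ (τ : Finset (Pt (d + 1))) ∩ (τ' : Finset (Pt (d + 1))) →
      ν' ≠ (τ : Finset (Pt (d + 1))) ∩ (τ' : Finset (Pt (d + 1))) →
      (ν ∩ ν').card = d - 1 →
      ν ∩ ν' ⊆ (τ : Finset (Pt (d + 1))) ∩ (τ' : Finset (Pt (d + 1))) →
      D.rho τ τ' x = y

/-! Write `Δ` for the standard simplex and `K = div Δ`. A labelling names the ridges of each facet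
`τ` of `K` by `0, …, d`, hence also its vertices: a vertex takes the label of the opposite ridge
(`IsVertexLabelling`). Sending `e_i` to the vertex named `i` embeds `Δ` into `K`. Applying `div` a
further `k` times turns this into a parametrization of the part of `div^{k+1} Δ` inside `τ` by
`div^k Δ` (`cellMap`). Iterating, every facet of `div^{k+1} Δ` gets a unique address, a word of
length `k + 1` in the facets of `K`; these words are the vertices of `Γ_k`.

In this language the combinatorial data become geometric. The permutation `ν_{σ,τ}` records how the
automorphism given by `σ` renames vertices (`nu_apply`), and `ρ_{ττ'}` identifies the names of the
common vertices of two adjacent facets (`rho_vertex`). Two facets of `div^{k+1} Δ` in the same cell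
are adjacent exactly when their preimages are. Two facets in different cells can only share a ridge
inside `τ ∩ τ'`, which forces `τ` and `τ'` to be adjacent. On this wall the two parametrizations
differ by the automorphism belonging to `ρ_{ττ'}` (`cellMap_eq_of_adj`), and a boundary ridge
determines its facet, so the condition becomes `ρ v = w` (`level_adj_iff`).

Two ingredients carry the argument. The first is functoriality: the existence and uniqueness in
inclusion-uniformity allow local isomorphisms to be glued to a map `div K → div L` for every
injective simplicial map `K → L` (`faceIso_subdivMap`), compatibly with composition and depending on
each face only on the values there; this passes to iterates (`iterMap_comp`, `iterMap_congr`). The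
second is that a subdivided simplex is a pseudomanifold with boundary: it is pure, a ridge in a side
lies in one facet and any other ridge in exactly two (`exists_facet`, `facet_eq_of_onSide`,
`facet_eq_of_ne`, `exists_other_facet`). This gives the degree formula and the existence of
labellings and of `ρ`.

The boundary sets are products, so there are `(d+1) f_{d-1}^{k+1}` loops against `f_d^{k+1}`
vertices. If `f_d > 1` then `f_{d-1} < f_d`: otherwise, by symmetry, every facet would have a ridge
in every side and so be `Δ` itself (`fNum_lt`). -/

/-! ### Convex geometry of finite simplices -/

theorem affine_sum {m : ℕ} (l : Pt m →ᵃ[ℝ] ℝ) {ι : Type*} (s : Finset ι) (w : ι → ℝ)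
    (p : ι → Pt m) (hw : ∑ i ∈ s, w i = 1) :
    l (∑ i ∈ s, w i • p i) = ∑ i ∈ s, w i * l (p i) := by
  have h : ∀ x, l x = l.linear x + l 0 := fun x => by
    have := congrFun (AffineMap.decomp l) x
    simpa using this
  rw [h, map_sum]
  simp only [map_smul, smul_eq_mul]
  have : ∑ i ∈ s, w i * l (p i) = ∑ i ∈ s, (w i * l.linear (p i) + w i * l 0) :=
    Finset.sum_congr rfl fun i _ => by rw [h (p i), mul_add]
  rw [this, Finset.sum_add_distrib, ← Finset.sum_mul, hw, one_mul]

theorem affine_nonneg_of_mem_hull {m : ℕ} (l : Pt m →ᵃ[ℝ] ℝ) {s : Finset (Pt m)} {x : Pt m}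
    (hs : ∀ v ∈ s, 0 ≤ l v) (hx : x ∈ convexHull ℝ (s : Set (Pt m))) : 0 ≤ l x := by
  obtain ⟨w, h0, h1, rfl⟩ := Finset.mem_convexHull'.1 hx
  rw [affine_sum l s w (fun y => y) h1]
  exact Finset.sum_nonneg fun i hi => mul_nonneg (h0 i hi) (hs i hi)

theorem affine_zero_of_mem_hull {m : ℕ} (l : Pt m →ᵃ[ℝ] ℝ) {s : Finset (Pt m)} {x : Pt m}
    (hs : ∀ v ∈ s, l v = 0) (hx : x ∈ convexHull ℝ (s : Set (Pt m))) : l x = 0 := by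
  obtain ⟨w, h0, h1, rfl⟩ := Finset.mem_convexHull'.1 hx
  rw [affine_sum l s w (fun y => y) h1]
  exact Finset.sum_eq_zero fun i hi => by rw [hs i hi, mul_zero]

/-- Affine functionals that are barycentric coordinates on an affinely independent set. -/
theorem exists_coords {m : ℕ} {s : Finset (Pt m)} (hs : AffineIndependent ℝ ((↑) : s → Pt m)) :
    ∃ l : Pt m → (Pt m →ᵃ[ℝ] ℝ), ∀ v ∈ s, ∀ w ∈ s, l v w = if w = v then 1 else 0 := by
  obtain ⟨t, hst, ht, hspan⟩ :=
    exists_subset_affineIndependent_affineSpan_eq_top (k := ℝ) (s := (s : Set (Pt m))) hs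
  let b : AffineBasis t ℝ (Pt m) := ⟨(↑), ht, by simpa using hspan⟩
  classical
  refine ⟨fun v => if h : v ∈ t then b.coord ⟨v, h⟩ else 0, fun v hv w hw => ?_⟩
  have hv' : v ∈ t := hst hv
  have hw' : w ∈ t := hst hw
  have : b ⟨w, hw'⟩ = w := rfl
  beta_reduce
  rw [dif_pos hv']
  conv_lhs => rw [← this]
  rw [AffineBasis.coord_apply]
  simp [eq_comm]

theorem hull_coords {m : ℕ} {s : Finset (Pt m)} {l : Pt m → (Pt m →ᵃ[ℝ] ℝ)}
    (hl : ∀ v ∈ s, ∀ w ∈ s, l v w = if w = v then 1 else 0) {x : Pt m}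
    (hx : x ∈ convexHull ℝ (s : Set (Pt m))) :
    (∀ v ∈ s, 0 ≤ l v x) ∧ ∑ v ∈ s, l v x = 1 ∧ ∑ v ∈ s, l v x • v = x := by
  obtain ⟨w, h0, h1, rfl⟩ := Finset.mem_convexHull'.1 hx
  have h : ∀ v ∈ s, l v (∑ y ∈ s, w y • y) = w v := fun v hv => by
    rw [affine_sum (l v) s w (fun y => y) h1,
      Finset.sum_congr rfl fun y hy => by rw [hl v hv y hy]]
    simp [hv]
  refine ⟨fun v hv => by rw [h v hv]; exact h0 v hv, ?_, ?_⟩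
  · rw [Finset.sum_congr rfl h, h1]
  · exact Finset.sum_congr rfl fun v hv => by rw [h v hv]

theorem mem_hull_of_coords_eq_zero {m : ℕ} {s u : Finset (Pt m)} {l : Pt m → (Pt m →ᵃ[ℝ] ℝ)}
    (hl : ∀ v ∈ s, ∀ w ∈ s, l v w = if w = v then 1 else 0) {x : Pt m}
    (hx : x ∈ convexHull ℝ (s : Set (Pt m))) (hu : u ⊆ s) (h : ∀ v ∈ s, v ∉ u → l v x = 0) :
    x ∈ convexHull ℝ (u : Set (Pt m)) := by
  obtain ⟨h0, h1, h2⟩ := hull_coords hl hx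
  refine Finset.mem_convexHull'.2 ⟨fun v => l v x, fun v hv => h0 v (hu hv), ?_, ?_⟩
  · rw [Finset.sum_subset hu h, h1]
  · rw [Finset.sum_subset hu fun v hv hvu => by
      simp only [h v hv hvu, zero_smul], h2]

/-- The barycentre of a finite set of points. -/
noncomputable def bary {m : ℕ} (s : Finset (Pt m)) : Pt m := ∑ v ∈ s, (s.card : ℝ)⁻¹ • v

theorem sum_card_inv {m : ℕ} {s : Finset (Pt m)} (hs : s.Nonempty) :
    ∑ _v ∈ s, (s.card : ℝ)⁻¹ = 1 := by
  have : (s.card : ℝ) ≠ 0 := by exact_mod_cast hs.card_ne_zero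
  simp [this]

theorem bary_mem_hull {m : ℕ} {s : Finset (Pt m)} (hs : s.Nonempty) :
    bary s ∈ convexHull ℝ (s : Set (Pt m)) :=
  Finset.mem_convexHull'.2 ⟨fun _ => (s.card : ℝ)⁻¹, fun _ _ => by positivity,
    sum_card_inv hs, rfl⟩

theorem affine_bary {m : ℕ} (l : Pt m →ᵃ[ℝ] ℝ) {s : Finset (Pt m)} (hs : s.Nonempty) :
    l (bary s) = ∑ v ∈ s, (s.card : ℝ)⁻¹ * l v :=
  affine_sum l s _ (fun y => y) (sum_card_inv hs)

/-- All weights of the barycentre are strictly positive. This lets the barycentre stand for the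
relative interior of a simplex in what follows. -/
theorem eq_zero_of_affine_bary {m : ℕ} (l : Pt m →ᵃ[ℝ] ℝ) {s : Finset (Pt m)}
    (h : ∀ v ∈ s, 0 ≤ l v) (h0 : l (bary s) = 0) : ∀ v ∈ s, l v = 0 := by
  intro v hv
  rw [affine_bary l ⟨v, hv⟩] at h0
  have hc : (0 : ℝ) < (s.card : ℝ)⁻¹ := by
    have := Finset.card_pos.2 ⟨v, hv⟩
    positivity
  have := (Finset.sum_eq_zero_iff_of_nonneg fun v hv => mul_nonneg hc.le (h v hv)).1 h0 v hv
  exact (mul_eq_zero.1 this).resolve_left hc.ne'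

/-- A face of a simplex that contains the barycentre of a set in the simplex contains the set. -/
theorem subset_hull_of_bary {m : ℕ} {s t u : Finset (Pt m)}
    (ht : AffineIndependent ℝ ((↑) : t → Pt m)) (hu : u ⊆ t)
    (hs : (s : Set (Pt m)) ⊆ convexHull ℝ (t : Set (Pt m)))
    (h : bary s ∈ convexHull ℝ (u : Set (Pt m))) :
    (s : Set (Pt m)) ⊆ convexHull ℝ (u : Set (Pt m)) := by
  obtain ⟨l, hl⟩ := exists_coords ht
  intro x hx
  refine mem_hull_of_coords_eq_zero hl (hs hx) hu fun v hv hvu => ?_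
  refine eq_zero_of_affine_bary (l v) (fun y hy => (hull_coords hl (hs hy)).1 v hv) ?_ x hx
  refine affine_zero_of_mem_hull (l v) (fun w hw => ?_) h
  rw [hl v hv w (hu hw), if_neg]
  rintro rfl
  exact hvu hw

theorem hull_subset_hull {m : ℕ} {s : Finset (Pt m)} {A : Set (Pt m)} :
    convexHull ℝ (s : Set (Pt m)) ⊆ convexHull ℝ A ↔ (s : Set (Pt m)) ⊆ convexHull ℝ A :=
  ⟨fun h => (subset_convexHull ℝ _).trans h, fun h => convexHull_min h (convex_convexHull ℝ _)⟩

/-! ### Faces of geometric complexes and finite subdivisions. -/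

section Complex

variable {m : ℕ} {K L M : Cpx m} {s t u ρ : Finset (Pt m)}

theorem mem_vertices_of_mem_face {x : Pt m} (hs : s ∈ K.faces) (hx : x ∈ s) : x ∈ K.vertices :=
  K.down_closed hs (Finset.singleton_subset_iff.2 hx) (Finset.singleton_nonempty x)

theorem mem_hull_inter {x : Pt m} (hs : s ∈ K.faces) (ht : t ∈ K.faces)
    (h1 : x ∈ convexHull ℝ (s : Set (Pt m))) (h2 : x ∈ convexHull ℝ (t : Set (Pt m))) :
    x ∈ convexHull ℝ ((s ∩ t : Finset (Pt m)) : Set (Pt m)) ∧ s ∩ t ∈ K.faces := by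
  have h := K.inter_subset_convexHull hs ht ⟨h1, h2⟩
  rw [← Finset.coe_inter] at h
  refine ⟨h, K.down_closed hs Finset.inter_subset_left ?_⟩
  have := convexHull_nonempty_iff.1 ⟨x, h⟩
  exact_mod_cast this

theorem subset_of_subset_hull (hs : s ∈ K.faces) (ht : t ∈ K.faces)
    (h : (s : Set (Pt m)) ⊆ convexHull ℝ (t : Set (Pt m))) : s ⊆ t := fun _ hx =>
  (Geometry.SimplicialComplex.vertex_mem_convexHull_iff (mem_vertices_of_mem_face hs hx) ht).1
    (h hx)

/-- The barycentre lies in the face `s ∩ t` of `s`, but no proper face of `s` contains it. -/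
theorem subset_of_bary_mem (hs : s ∈ K.faces) (ht : t ∈ K.faces)
    (h : bary s ∈ convexHull ℝ (t : Set (Pt m))) : s ⊆ t := by
  have h1 := mem_hull_inter hs ht (bary_mem_hull (K.nonempty_of_mem_faces hs)) h
  have h2 := subset_hull_of_bary (K.indep hs) Finset.inter_subset_left
    (subset_convexHull ℝ _) h1.1
  exact subset_of_subset_hull hs ht
    (h2.trans (convexHull_mono (Finset.coe_subset.2 Finset.inter_subset_right)))

theorem card_le_of_subset_hull (hs : s ∈ L.faces)
    (hsρ : (s : Set (Pt m)) ⊆ convexHull ℝ (ρ : Set (Pt m))) : s.card ≤ ρ.card :=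
  (L.indep hs).card_le_card_of_subset_affineSpan
    (hsρ.trans (convexHull_subset_affineSpan _))

/-- `L` is a finite subdivision of `K`. -/
structure Subdivides (L K : Cpx m) : Prop where
  finite : L.faces.Finite
  sub : ∀ s ∈ L.faces, ∃ t ∈ K.faces, (s : Set (Pt m)) ⊆ convexHull ℝ (t : Set (Pt m))
  cover : ∀ t ∈ K.faces, ∀ x ∈ convexHull ℝ (t : Set (Pt m)), ∃ s ∈ L.faces,
    x ∈ convexHull ℝ (s : Set (Pt m)) ∧ (s : Set (Pt m)) ⊆ convexHull ℝ (t : Set (Pt m))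

namespace Subdivides

theorem refl (h : K.faces.Finite) : Subdivides K K :=
  ⟨h, fun s hs => ⟨s, hs, subset_convexHull ℝ _⟩,
    fun t ht _ hx => ⟨t, ht, hx, subset_convexHull ℝ _⟩⟩

theorem trans (h1 : Subdivides M L) (h2 : Subdivides L K) : Subdivides M K where
  finite := h1.finite
  sub s hs := by
    obtain ⟨t, ht, hst⟩ := h1.sub s hs
    obtain ⟨u, hu, htu⟩ := h2.sub t ht
    exact ⟨u, hu, hst.trans (hull_subset_hull.2 htu)⟩
  cover t ht x hx := by
    obtain ⟨u, hu, hxu, hut⟩ := h2.cover t ht x hx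
    obtain ⟨s, hs, hxs, hsu⟩ := h1.cover u hu x hxu
    exact ⟨s, hs, hxs, hsu.trans (hull_subset_hull.2 hut)⟩

/-- A simplex covering `x` inside `conv {x}` can only be `{x}`. -/
theorem mem_vertices (h : Subdivides L K) {x : Pt m} (hx : x ∈ K.vertices) : x ∈ L.vertices := by
  obtain ⟨s, hs, hxs, hst⟩ := h.cover {x} hx x (by simp)
  have : s = {x} := by
    refine Finset.eq_singleton_iff_nonempty_unique_mem.2 ⟨L.nonempty_of_mem_faces hs, fun y hy => ?_⟩
    simpa using hst hy
  rw [this] at hs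
  exact hs

/-- In an iterated subdivision, a simplex inside a face `ρ` of the coarsest complex lies in a
simplex of the intermediate one inside `ρ`. -/
theorem carrier (h1 : Subdivides M L) (h2 : Subdivides L K) (hs : s ∈ M.faces) (hρ : ρ ∈ K.faces)
    (hsρ : (s : Set (Pt m)) ⊆ convexHull ℝ (ρ : Set (Pt m))) :
    ∃ u ∈ L.faces, (s : Set (Pt m)) ⊆ convexHull ℝ (u : Set (Pt m)) ∧
      (u : Set (Pt m)) ⊆ convexHull ℝ (ρ : Set (Pt m)) := by
  obtain ⟨t, ht, hst⟩ := h1.sub s hs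
  -- `t` need not lie in `ρ`. The barycentre of `s` also lies in a simplex `v` of `L` inside `ρ`,
  -- and the common face `t ∩ v` contains all of `s`.
  have hb := bary_mem_hull (M.nonempty_of_mem_faces hs)
  obtain ⟨v, hv, hbv, hvρ⟩ := h2.cover ρ hρ (bary s) (hull_subset_hull.2 hsρ hb)
  obtain ⟨h3, h4⟩ := mem_hull_inter ht hv (hull_subset_hull.2 hst hb) hbv
  exact ⟨t ∩ v, h4, subset_hull_of_bary (L.indep ht) Finset.inter_subset_left hst h3,
    (Finset.coe_subset.2 Finset.inter_subset_right).trans hvρ⟩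

/-- Moving a little from the barycentre of a simplex `s` towards a point `y` one stays in a
simplex that contains `s`. -/
theorem push (h : Subdivides L K) (hs : s ∈ L.faces) (hρ : ρ ∈ K.faces)
    (hsρ : (s : Set (Pt m)) ⊆ convexHull ℝ (ρ : Set (Pt m))) {y : Pt m}
    (hy : y ∈ convexHull ℝ (ρ : Set (Pt m))) :
    ∃ t ∈ L.faces, (t : Set (Pt m)) ⊆ convexHull ℝ (ρ : Set (Pt m)) ∧ s ⊆ t ∧
      ∃ ε : ℝ, 0 < ε ∧ bary s + ε • (y - bary s) ∈ convexHull ℝ (t : Set (Pt m)) := by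
  have hb : bary s ∈ convexHull ℝ (ρ : Set (Pt m)) :=
    hull_subset_hull.2 hsρ (bary_mem_hull (L.nonempty_of_mem_faces hs))
  let x : ℕ → Pt m := fun n => bary s + (1 / ((n : ℝ) + 1)) • (y - bary s)
  have hx : ∀ n, x n ∈ convexHull ℝ (ρ : Set (Pt m)) := fun n => by
    refine (convex_convexHull ℝ _).add_smul_sub_mem hb hy ⟨by positivity, ?_⟩
    rw [div_le_one (by positivity)]
    linarith [Nat.cast_nonneg (α := ℝ) n]
  choose t ht hxt htρ using fun n => h.cover ρ hρ (x n) (hx n)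
  -- Pigeonhole: infinitely many of the points `x n` lie in one simplex `T`. Since `conv T` is
  -- closed it contains their limit `bary s`, so `s ⊆ T`.
  have : Finite L.faces := h.finite
  obtain ⟨T, hT⟩ := Finite.exists_infinite_fiber fun n => (⟨t n, ht n⟩ : L.faces)
  have hT' : {n | t n = T.1}.Infinite := by
    have := Set.infinite_coe_iff.1 hT
    convert this using 1
    ext n
    simp [Subtype.ext_iff]
  have hlim : Tendsto x atTop (𝓝 (bary s)) := by
    have : Tendsto (fun n : ℕ => bary s + (1 / ((n : ℝ) + 1)) • (y - bary s)) atTop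
        (𝓝 (bary s + (0 : ℝ) • (y - bary s))) :=
      (tendsto_one_div_add_atTop_nhds_zero_nat.smul_const _).const_add _
    rwa [zero_smul, add_zero] at this
  have hcl : IsClosed (convexHull ℝ ((T.1 : Finset (Pt m)) : Set (Pt m))) :=
    T.1.finite_toSet.isClosed_convexHull ℝ
  have hbT : bary s ∈ convexHull ℝ ((T.1 : Finset (Pt m)) : Set (Pt m)) := by
    refine hcl.mem_of_frequently_of_tendsto ?_ hlim
    refine (Nat.frequently_atTop_iff_infinite.2 hT').mono fun n hn => ?_
    rw [← hn]
    exact hxt n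
  obtain ⟨n, hn⟩ := hT'.nonempty
  refine ⟨T.1, T.2, ?_, subset_of_bary_mem hs T.2 hbT, 1 / ((n : ℝ) + 1), by positivity, ?_⟩
  · rw [← hn]
    exact htρ n
  · have := hxt n
    rwa [hn] at this

/-- Subdivisions of simplices are pure. -/
theorem exists_facet (h : Subdivides L K) (hs : s ∈ L.faces) (hρ : ρ ∈ K.faces)
    (hsρ : (s : Set (Pt m)) ⊆ convexHull ℝ (ρ : Set (Pt m))) :
    ∃ t ∈ L.faces, s ⊆ t ∧ (t : Set (Pt m)) ⊆ convexHull ℝ (ρ : Set (Pt m)) ∧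
      t.card = ρ.card := by
  induction hn : ρ.card - s.card using Nat.strong_induction_on generalizing s with
  | _ n ih =>
  rcases (card_le_of_subset_hull hs hsρ).eq_or_lt with hc | hc
  · exact ⟨s, hs, Finset.Subset.refl _, hsρ, hc⟩
  -- Pushing towards a vertex of `ρ` outside the affine span of `s` must enlarge `s`: otherwise the
  -- line through `bary s` and the pushed point, which contains `y`, would lie in that span.
  · obtain ⟨y, hy, hys⟩ : ∃ y ∈ ρ, y ∉ affineSpan ℝ (s : Set (Pt m)) := by
      by_contra! hcon
      exact absurd ((K.indep hρ).card_le_card_of_subset_affineSpan hcon) (not_le.2 hc)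
    obtain ⟨t, ht, htρ, hst, ε, hε, hmem⟩ := h.push hs hρ hsρ (subset_convexHull ℝ _ hy)
    have hne : s ≠ t := by
      rintro rfl
      have h1 := convexHull_subset_affineSpan _ hmem
      have h2 := convexHull_subset_affineSpan _ (bary_mem_hull (L.nonempty_of_mem_faces hs))
      apply hys
      have h3 := AffineMap.lineMap_mem (ε⁻¹) h2 h1
      convert h3 using 1
      simp [AffineMap.lineMap_apply, smul_smul, hε.ne']
    have hlt := Finset.card_lt_card (hst.ssubset_of_ne hne)
    have hle := card_le_of_subset_hull ht htρ
    obtain ⟨t', ht', h1, h2, h3⟩ := ih (ρ.card - t.card) (by omega) ht htρ rfl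
    exact ⟨t', ht', hst.trans h1, h2, h3⟩

theorem dimEq (h : Subdivides L K) {d : ℕ} (hK : DimEq K d) : DimEq L d := by
  obtain ⟨⟨-, h1⟩, ρ, hρ, hc⟩ := hK
  refine ⟨⟨h.finite, fun s hs => ?_⟩, ?_⟩
  · obtain ⟨t, ht, hst⟩ := h.sub s hs
    exact (card_le_of_subset_hull hs hst).trans (h1 t ht)
  · obtain ⟨x, hx⟩ := K.nonempty_of_mem_faces hρ
    obtain ⟨s, hs, -, hsρ⟩ := h.cover ρ hρ x (subset_convexHull ℝ _ hx)
    obtain ⟨t, ht, -, -, htc⟩ := h.exists_facet hs hρ hsρ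
    exact ⟨t, ht, htc.trans hc⟩

end Subdivides

/-- Finiteness is the point to check: the barycentre of a face of `div K` lies in one of the
finitely many simplices covering the faces of `K`, so the face is a subset of that simplex. -/
theorem IsSubdivisionProcedure.subdivides {d : ℕ} {div : CpxOp} (h : IsSubdivisionProcedure d div)
    (hK : DimLE K d) : Subdivides (div m K) K := by
  obtain ⟨h1, h2⟩ := h m K hK
  have cover : ∀ t ∈ K.faces, ∀ x ∈ convexHull ℝ (t : Set (Pt m)), ∃ s ∈ (div m K).faces,
      x ∈ convexHull ℝ (s : Set (Pt m)) ∧ (s : Set (Pt m)) ⊆ convexHull ℝ (t : Set (Pt m)) := by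
    intro t ht x hx
    obtain ⟨S, -, hS, hU⟩ := h2 t ht
    rw [hU] at hx
    obtain ⟨s, hs, hxs⟩ := Set.mem_iUnion₂.1 hx
    refine ⟨s, hS hs, hxs, ?_⟩
    rw [hU]
    exact (subset_convexHull ℝ _).trans
      (Set.subset_biUnion_of_mem (u := fun s : Finset (Pt m) => convexHull ℝ (s : Set (Pt m))) hs)
  refine ⟨?_, fun s hs => ?_, cover⟩
  · choose! S hfin hsub hU using h2
    refine ((hK.1.biUnion fun t ht => (hfin t ht).biUnion fun s _ =>
      (s.powerset.finite_toSet))).subset fun s hs => ?_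
    obtain ⟨t, ht, hst⟩ := h1 s hs
    have hb := bary_mem_hull ((div m K).nonempty_of_mem_faces hs)
    have := hst hb
    rw [hU t ht] at this
    obtain ⟨u, hu, hbu⟩ := Set.mem_iUnion₂.1 this
    exact Set.mem_iUnion₂.2 ⟨t, ht, Set.mem_iUnion₂.2 ⟨u, hu,
      Finset.mem_coe.2 (Finset.mem_powerset.2 (subset_of_bary_mem hs (hsub t ht hu) hbu))⟩⟩
  · obtain ⟨t, ht, hst⟩ := h1 s hs
    exact ⟨t, ht, hull_subset_hull.1 hst⟩

end Complex

/-! ### Isomorphisms between restrictions of subdivisions -/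

section CornerIso

variable {ι ι' : Type} {m n r : ℕ} {A : Cpx m} {B : Cpx n} {C : Cpx r} {p : ι → Pt m}
  {q : ι → Pt n} {c : ι → Pt r} {g g' : Pt m → Pt n} {h : Pt n → Pt r}

namespace IsCornerIso

theorem reindex (hg : IsCornerIso A p B q g) (e : ι' → ι) :
    IsCornerIso A (p ∘ e) B (q ∘ e) g where
  bijOn := hg.bijOn
  faces_iff := hg.faces_iff
  corners i := hg.corners (e i)
  geometric ρ v hv := by
    rw [Set.image_comp, Set.image_comp]
    exact hg.geometric (e '' ρ) v hv

theorem comp (hg : IsCornerIso A p B q g) (hh : IsCornerIso B q C c h) :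
    IsCornerIso A p C c (h ∘ g) where
  bijOn := hh.bijOn.comp hg.bijOn
  faces_iff s hs := by
    rw [hg.faces_iff s hs, hh.faces_iff, Finset.image_image]
    rw [Finset.coe_image]
    exact (Set.image_mono hs).trans hg.bijOn.mapsTo.image_subset
  corners i := by rw [Function.comp_apply, hg.corners, hh.corners]
  geometric ρ v hv := by
    rw [hg.geometric ρ v hv, hh.geometric ρ _ (hg.bijOn.mapsTo hv), Function.comp_apply]

theorem congr (hg : IsCornerIso A p B q g) (hp : ∀ i, p i ∈ A.vertices)
    (he : Set.EqOn g g' A.vertices) : IsCornerIso A p B q g' where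
  bijOn := hg.bijOn.congr he
  faces_iff s hs := by
    rw [hg.faces_iff s hs, Finset.image_congr (he.mono hs)]
  corners i := by rw [← he (hp i), hg.corners]
  geometric ρ v hv := by rw [hg.geometric ρ v hv, he hv]

theorem exists_symm (hg : IsCornerIso A p B q g) (hp : ∀ i, p i ∈ A.vertices) :
    ∃ g', IsCornerIso B q A p g' ∧ (∀ x ∈ A.vertices, g' (g x) = x) := by
  have hinv : Set.InvOn (Function.invFunOn g A.vertices) g A.vertices B.vertices :=
    hg.bijOn.invOn_invFunOn
  set g' := Function.invFunOn g A.vertices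
  have hb : Set.BijOn g' B.vertices A.vertices := hg.bijOn.symm hinv.symm
  refine ⟨g', ⟨hb, fun s hs => ?_, fun i => ?_, fun ρ v hv => ?_⟩, hinv.1⟩
  · have h1 : ((s.image g' : Finset (Pt m)) : Set (Pt m)) ⊆ A.vertices := by
      rw [Finset.coe_image]
      exact (Set.image_mono hs).trans hb.mapsTo.image_subset
    rw [hg.faces_iff _ h1, Finset.image_image]
    have : s.image (g ∘ g') = s := by
      conv_rhs => rw [← Finset.image_id (s := s)]
      exact Finset.image_congr fun x hx => hinv.2 (hs hx)
    rw [this]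
  · rw [← hg.corners i]
    exact hinv.1 (hp i)
  · rw [hg.geometric ρ _ (hb.mapsTo hv), hinv.2 hv]

end IsCornerIso

theorem mem_vertices_restrictTo {L : Cpx m} {τ : Finset (Pt m)} {x : Pt m} :
    x ∈ (restrictTo L τ).vertices ↔ x ∈ L.vertices ∧ x ∈ convexHull ℝ (τ : Set (Pt m)) := by
  simp [Geometry.SimplicialComplex.mem_vertices, restrictTo]

theorem mem_faces_restrictTo {L : Cpx m} {τ s : Finset (Pt m)} :
    s ∈ (restrictTo L τ).faces ↔ s ∈ L.faces ∧ (s : Set (Pt m)) ⊆ convexHull ℝ (τ : Set (Pt m)) :=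
  Iff.rfl

/-- `h` maps the part of `K'` in `conv ρ` isomorphically to the part of `L'` in `conv (g ρ)`,
extending the bijection `g` of the corners. -/
def FaceIso (K' : Cpx m) (L' : Cpx n) (ρ : Finset (Pt m)) (g h : Pt m → Pt n) : Prop :=
  IsCornerIso (restrictTo K' ρ) (fun v : ρ => (v : Pt m)) (restrictTo L' (ρ.image g))
    (fun v : ρ => g v) h

namespace FaceIso

variable {K' : Cpx m} {L' : Cpx n} {M' : Cpx r} {ρ u : Finset (Pt m)} {h h' : Pt m → Pt n}
  {f k : Pt n → Pt r}

theorem mem_hull_iff (hh : FaceIso K' L' ρ g h) (hu : u ⊆ ρ) {x : Pt m} (hx : x ∈ K'.vertices)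
    (hxρ : x ∈ convexHull ℝ (ρ : Set (Pt m))) :
    x ∈ convexHull ℝ (u : Set (Pt m)) ↔
      h x ∈ convexHull ℝ ((u.image g : Finset (Pt n)) : Set (Pt n)) := by
  have := hh.geometric {v | (v : Pt m) ∈ u} x (mem_vertices_restrictTo.2 ⟨hx, hxρ⟩)
  convert this using 2
  · congr 1
    ext y
    simp only [Finset.mem_coe, Set.mem_image, Set.mem_ofPred_eq, Subtype.exists, exists_and_left,
      exists_prop, exists_eq_right_right]
    exact ⟨fun hy => ⟨hy, hu hy⟩, fun hy => hy.1⟩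
  · congr 1
    ext y
    simp only [Finset.coe_image, Set.mem_image, Finset.mem_coe, Set.mem_ofPred_eq, Subtype.exists,
      exists_and_left, exists_prop]
    exact ⟨fun ⟨x, hx, e⟩ => ⟨x, hx, hu hx, e⟩, fun ⟨x, hx, _, e⟩ => ⟨x, hx, e⟩⟩

theorem mapsTo (hh : FaceIso K' L' ρ g h) {x : Pt m} (hx : x ∈ K'.vertices)
    (hxρ : x ∈ convexHull ℝ (ρ : Set (Pt m))) :
    h x ∈ L'.vertices ∧ h x ∈ convexHull ℝ ((ρ.image g : Finset (Pt n)) : Set (Pt n)) :=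
  mem_vertices_restrictTo.1 (hh.bijOn.mapsTo (mem_vertices_restrictTo.2 ⟨hx, hxρ⟩))

/-- The geometric clause is what makes this work: `h` and its inverse respect the part in `conv u`.
Gluing over different faces `ρ` rests on this restriction. -/
theorem restrict (hh : FaceIso K' L' ρ g h) (hu : u ⊆ ρ) : FaceIso K' L' u g h := by
  have hsub : convexHull ℝ (u : Set (Pt m)) ⊆ convexHull ℝ (ρ : Set (Pt m)) :=
    convexHull_mono (Finset.coe_subset.2 hu)
  have hsub' : convexHull ℝ ((u.image g : Finset (Pt n)) : Set (Pt n)) ⊆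
      convexHull ℝ ((ρ.image g : Finset (Pt n)) : Set (Pt n)) :=
    convexHull_mono (Finset.coe_subset.2 (Finset.image_mono g hu))
  refine ⟨⟨fun x hx => ?_, fun x hx y hy e => ?_, fun y hy => ?_⟩, fun s hs => ?_, fun v => ?_,
    fun ρ' v hv => ?_⟩
  · obtain ⟨h1, h2⟩ := mem_vertices_restrictTo.1 hx
    exact mem_vertices_restrictTo.2
      ⟨(hh.mapsTo h1 (hsub h2)).1, (hh.mem_hull_iff hu h1 (hsub h2)).1 h2⟩
  · obtain ⟨h1, h2⟩ := mem_vertices_restrictTo.1 hx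
    obtain ⟨h3, h4⟩ := mem_vertices_restrictTo.1 hy
    exact hh.bijOn.injOn (mem_vertices_restrictTo.2 ⟨h1, hsub h2⟩)
      (mem_vertices_restrictTo.2 ⟨h3, hsub h4⟩) e
  · obtain ⟨h1, h2⟩ := mem_vertices_restrictTo.1 hy
    obtain ⟨x, hx, rfl⟩ := hh.bijOn.surjOn (mem_vertices_restrictTo.2 ⟨h1, hsub' h2⟩)
    obtain ⟨h3, h4⟩ := mem_vertices_restrictTo.1 hx
    exact ⟨x, mem_vertices_restrictTo.2 ⟨h3, (hh.mem_hull_iff hu h3 h4).2 h2⟩, rfl⟩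
  · have hs' : ∀ x ∈ s, x ∈ K'.vertices ∧ x ∈ convexHull ℝ (u : Set (Pt m)) := fun x hx =>
      mem_vertices_restrictTo.1 (hs hx)
    have := hh.faces_iff s fun x hx =>
      mem_vertices_restrictTo.2 ⟨(hs' x hx).1, hsub (hs' x hx).2⟩
    rw [mem_faces_restrictTo, mem_faces_restrictTo] at this ⊢
    have e1 : (s : Set (Pt m)) ⊆ convexHull ℝ (u : Set (Pt m)) := fun x hx => (hs' x hx).2
    have e2 : ((s.image h : Finset (Pt n)) : Set (Pt n)) ⊆
        convexHull ℝ ((u.image g : Finset (Pt n)) : Set (Pt n)) := by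
      rw [Finset.coe_image]
      rintro _ ⟨x, hx, rfl⟩
      exact (hh.mem_hull_iff hu (hs' x hx).1 (hsub (hs' x hx).2)).1 (hs' x hx).2
    simp only [e1, e2, e1.trans hsub, e2.trans hsub', and_true] at this ⊢
    exact this
  · exact hh.corners ⟨v, hu v.2⟩
  · obtain ⟨h1, h2⟩ := mem_vertices_restrictTo.1 hv
    have := hh.geometric ((fun v : u => (⟨v, hu v.2⟩ : ρ)) '' ρ') v
      (mem_vertices_restrictTo.2 ⟨h1, hsub h2⟩)
    rw [← Set.image_comp, ← Set.image_comp] at this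
    exact this

theorem comp (hh : FaceIso K' L' ρ g h) (hk : FaceIso L' M' (ρ.image g) f k) :
    FaceIso K' M' ρ (f ∘ g) (k ∘ h) := by
  have h2 := hk.reindex (fun v : ρ => (⟨g v, Finset.mem_image_of_mem g v.2⟩ : ρ.image g))
  have := IsCornerIso.comp hh h2
  rw [Finset.image_image] at this
  exact this

theorem congr_corners (hh : FaceIso K' L' ρ g h) (he : Set.EqOn g g' ρ) :
    FaceIso K' L' ρ g' h := by
  have e : (fun v : ρ => g v) = fun v : ρ => g' v := funext fun v => he v.2
  rw [FaceIso, e, Finset.image_congr he] at hh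
  exact hh

theorem congr (hh : FaceIso K' L' ρ g h) (hρ : ∀ v ∈ ρ, v ∈ K'.vertices)
    (he : ∀ x ∈ K'.vertices, x ∈ convexHull ℝ (ρ : Set (Pt m)) → h x = h' x) :
    FaceIso K' L' ρ g h' :=
  IsCornerIso.congr hh
    (fun v => mem_vertices_restrictTo.2 ⟨hρ v v.2, subset_convexHull ℝ _ v.2⟩)
    fun x hx => he x (mem_vertices_restrictTo.1 hx).1 (mem_vertices_restrictTo.1 hx).2

theorem id (K' : Cpx m) (ρ : Finset (Pt m)) : FaceIso K' K' ρ id id := by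
  refine ⟨?_, fun s _ => ?_, fun _ => rfl, fun _ _ _ => Iff.rfl⟩
  · rw [Finset.image_id]
    exact Set.bijOn_id _
  · rw [Finset.image_id, Finset.image_id]

end FaceIso

end CornerIso

/-! ### Functoriality of inclusion-uniform subdivisions -/

section Functor

variable {d : ℕ} {div : CpxOp} {m n r : ℕ} {K : Cpx m} {L : Cpx n} {M : Cpx r}
  {ρ : Finset (Pt m)} {g g' h h' : Pt m → Pt n}

theorem mem_faces_card (hρ : ρ ∈ K.faces) : ρ ∈ Faces K (ρ.card - 1) :=
  ⟨hρ, (Nat.sub_add_cancel (Finset.card_pos.2 (K.nonempty_of_mem_faces hρ))).symm⟩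

namespace IsInclusionUniform

theorem subdivides (hdiv : IsInclusionUniform d div) (hK : DimEq K d) :
    Subdivides (div m K) K :=
  hdiv.1.subdivides hK.1

theorem dimEq (hdiv : IsInclusionUniform d div) (hK : DimEq K d) : DimEq (div m K) d :=
  (hdiv.subdivides hK).dimEq hK

theorem corner_mem (hdiv : IsInclusionUniform d div) (hK : DimEq K d) (hρ : ρ ∈ K.faces)
    {v : Pt m} (hv : v ∈ ρ) : v ∈ (div m K).vertices :=
  (hdiv.subdivides hK).mem_vertices (mem_vertices_of_mem_face hρ hv)

/-- Indexing the corners of the target by `ρ` through `g` makes this isomorphism composable with a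
`FaceIso` starting at `ρ`. -/
theorem exists_model (hdiv : IsInclusionUniform d div) (hL : DimEq L d) (hg : Set.InjOn g ρ)
    (hρ : ρ ∈ K.faces) (hρL : ρ.image g ∈ L.faces) (e : ρ ≃ Fin (ρ.card - 1 + 1)) :
    ∃ k : Pt n → Pt (ρ.card - 1 + 1),
      IsCornerIso (restrictTo (div n L) (ρ.image g)) (fun v : ρ => g v)
        (div _ (stdCpx (ρ.card - 1))) (fun v : ρ => corner _ (e v)) k := by
  have hE : Function.Bijective
      (fun v : ρ => (⟨g v, Finset.mem_image_of_mem g v.2⟩ : ρ.image g)) := by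
    refine ⟨fun v w hvw => Subtype.ext (hg v.2 w.2 (congrArg Subtype.val hvw)), ?_⟩
    rintro ⟨y, hy⟩
    obtain ⟨x, hx, rfl⟩ := Finset.mem_image.1 hy
    exact ⟨⟨x, hx⟩, rfl⟩
  let E := Equiv.ofBijective _ hE
  have hc : (ρ.image g).card = ρ.card - 1 + 1 := by
    rw [Finset.card_image_of_injOn hg]
    exact (Nat.sub_add_cancel (Finset.card_pos.2 (K.nonempty_of_mem_faces hρ))).symm
  obtain ⟨k, hk, -⟩ := hdiv.2 n L hL (ρ.card - 1) (ρ.image g) ⟨hρL, hc⟩ (E.symm.trans e)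
  refine ⟨k, ?_⟩
  have h1 := hk.reindex E
  have e1 : (fun v : ρ.image g => corner (ρ.card - 1) ((E.symm.trans e) v)) ∘ E =
      fun v : ρ => corner _ (e v) := by
    funext v
    simp
  rw [e1] at h1
  exact h1

/-- Both restrictions are isomorphic to the same `div Δ_i` with compatible corners; compose one
isomorphism with the inverse of the other. -/
theorem exists_faceIso (hdiv : IsInclusionUniform d div) (hK : DimEq K d) (hL : DimEq L d)
    (hρ : ρ ∈ K.faces) (hg : Set.InjOn g ρ) (hρL : ρ.image g ∈ L.faces) :
    ∃ h, FaceIso (div m K) (div n L) ρ g h := by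
  have e : ρ ≃ Fin (ρ.card - 1 + 1) := ρ.equivFinOfCardEq (mem_faces_card hρ).2
  obtain ⟨k, hk, -⟩ := hdiv.2 m K hK _ ρ (mem_faces_card hρ) e
  obtain ⟨k', hk'⟩ := hdiv.exists_model hL hg hρ hρL e
  obtain ⟨l, hl, -⟩ := hk'.exists_symm fun v => mem_vertices_restrictTo.2
    ⟨hdiv.corner_mem hL hρL (Finset.mem_image_of_mem g v.2),
      subset_convexHull ℝ _ (Finset.mem_coe.2 (Finset.mem_image_of_mem g v.2))⟩
  exact ⟨l ∘ k, hk.comp hl⟩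

/-- After composition with an isomorphism to `div Δ_i`, both maps are extensions of the same
identification of corners, to which the uniqueness in inclusion-uniformity applies. -/
theorem faceIso_unique (hdiv : IsInclusionUniform d div) (hK : DimEq K d) (hL : DimEq L d)
    (hρ : ρ ∈ K.faces) (hg : Set.InjOn g ρ) (hρL : ρ.image g ∈ L.faces)
    (h1 : FaceIso (div m K) (div n L) ρ g h) (h2 : FaceIso (div m K) (div n L) ρ g h')
    {x : Pt m} (hx : x ∈ (div m K).vertices) (hxρ : x ∈ convexHull ℝ (ρ : Set (Pt m))) :
    h x = h' x := by
  have e : ρ ≃ Fin (ρ.card - 1 + 1) := ρ.equivFinOfCardEq (mem_faces_card hρ).2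
  obtain ⟨k, -, hk⟩ := hdiv.2 m K hK _ ρ (mem_faces_card hρ) e
  obtain ⟨k', hk'⟩ := hdiv.exists_model hL hg hρ hρL e
  have hx' : x ∈ (restrictTo (div m K) ρ).vertices := mem_vertices_restrictTo.2 ⟨hx, hxρ⟩
  refine hk'.bijOn.injOn (h1.bijOn.mapsTo hx') (h2.bijOn.mapsTo hx') ?_
  exact (hk _ (IsCornerIso.comp h1 hk') hx').symm.trans (hk _ (IsCornerIso.comp h2 hk') hx')

end IsInclusionUniform

/-- `g` is an injective simplicial map from `K` to `L`. -/
structure IsEmb (K : Cpx m) (L : Cpx n) (g : Pt m → Pt n) : Prop where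
  inj : Set.InjOn g K.vertices
  map : ∀ s ∈ K.faces, s.image g ∈ L.faces

theorem IsEmb.injOn (hg : IsEmb K L g) (hρ : ρ ∈ K.faces) : Set.InjOn g ρ :=
  hg.inj.mono fun _ hx => mem_vertices_of_mem_face hρ hx

theorem IsEmb.map_vertex (hg : IsEmb K L g) {x : Pt m} (hx : x ∈ K.vertices) :
    g x ∈ L.vertices := by
  have := hg.map {x} hx
  rwa [Finset.image_singleton] at this

theorem IsEmb.comp {f : Pt n → Pt r} (hg : IsEmb K L g) (hf : IsEmb L M f) :
    IsEmb K M (f ∘ g) where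
  inj x hx y hy e := hg.inj hx hy (hf.inj (hg.map_vertex hx) (hg.map_vertex hy) e)
  map s hs := by
    rw [← Finset.image_image]
    exact hf.map _ (hg.map s hs)

theorem IsEmb.id (K : Cpx m) : IsEmb K K id where
  inj := Set.injOn_id _
  map s hs := by rwa [Finset.image_id]

open Classical in
/-- The map `div K → div L` induced by an injective simplicial map `K → L`. -/
noncomputable def subdivMap (div : CpxOp) (K : Cpx m) (L : Cpx n) (g : Pt m → Pt n) :
    Pt m → Pt n :=
  -- The zero map is a default that `faceIso_subdivMap` excludes for embeddings of `d`-dimensional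
  -- complexes.
  if h : ∃ G, ∀ ρ ∈ K.faces, FaceIso (div m K) (div n L) ρ g G then h.choose else fun _ => 0

namespace IsInclusionUniform

/-- Isomorphisms over two faces both restrict to the intersection of the faces, where they agree by
uniqueness. They therefore glue. -/
theorem faceIso_subdivMap (hdiv : IsInclusionUniform d div) (hK : DimEq K d) (hL : DimEq L d)
    (hg : IsEmb K L g) (hρ : ρ ∈ K.faces) :
    FaceIso (div m K) (div n L) ρ g (subdivMap div K L g) := by
  classical
  have hex : ∃ G, ∀ ρ ∈ K.faces, FaceIso (div m K) (div n L) ρ g G := by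
    choose! H hH using fun ρ (hρ : ρ ∈ K.faces) =>
      hdiv.exists_faceIso hK hL hρ (hg.injOn hρ) (hg.map ρ hρ)
    -- The glued map evaluates at `x` the local isomorphism of an arbitrarily chosen face `c x`
    -- containing `x`; the choice does not matter.
    choose! c hc hc' using fun (x : Pt m)
      (hx : ∃ ρ ∈ K.faces, x ∈ convexHull ℝ (ρ : Set (Pt m))) => hx
    refine ⟨fun x => H (c x) x, fun ρ hρ => ?_⟩
    refine (hH ρ hρ).congr (fun v hv => hdiv.corner_mem hK hρ hv) fun x hx hxρ => ?_
    have h1 := hc x ⟨ρ, hρ, hxρ⟩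
    have h2 := hc' x ⟨ρ, hρ, hxρ⟩
    obtain ⟨h3, h4⟩ := mem_hull_inter hρ h1 hxρ h2
    exact hdiv.faceIso_unique hK hL h4 (hg.injOn h4) (hg.map _ h4)
      ((hH ρ hρ).restrict Finset.inter_subset_left)
      ((hH _ h1).restrict Finset.inter_subset_right) hx h3
  rw [subdivMap, dif_pos hex]
  exact hex.choose_spec ρ hρ

theorem subdivMap_eq (hdiv : IsInclusionUniform d div) (hK : DimEq K d) (hL : DimEq L d)
    (hg : IsEmb K L g) (hρ : ρ ∈ K.faces) (hh : FaceIso (div m K) (div n L) ρ g h)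
    {x : Pt m} (hx : x ∈ (div m K).vertices) (hxρ : x ∈ convexHull ℝ (ρ : Set (Pt m))) :
    subdivMap div K L g x = h x :=
  hdiv.faceIso_unique hK hL hρ (hg.injOn hρ) (hg.map ρ hρ)
    (hdiv.faceIso_subdivMap hK hL hg hρ) hh hx hxρ

theorem subdivMap_congr (hdiv : IsInclusionUniform d div) (hK : DimEq K d) (hL : DimEq L d)
    (hg : IsEmb K L g) (hg' : IsEmb K L g') (hρ : ρ ∈ K.faces) (he : Set.EqOn g g' ρ)
    {x : Pt m} (hx : x ∈ (div m K).vertices) (hxρ : x ∈ convexHull ℝ (ρ : Set (Pt m))) :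
    subdivMap div K L g x = subdivMap div K L g' x :=
  hdiv.subdivMap_eq hK hL hg hρ
    ((hdiv.faceIso_subdivMap hK hL hg' hρ).congr_corners he.symm) hx hxρ

theorem exists_mem_hull (hdiv : IsInclusionUniform d div) (hK : DimEq K d) {x : Pt m}
    (hx : x ∈ (div m K).vertices) : ∃ ρ ∈ K.faces, x ∈ convexHull ℝ (ρ : Set (Pt m)) := by
  obtain ⟨t, ht, h⟩ := (hdiv.subdivides hK).sub _ hx
  exact ⟨t, ht, h (by simp)⟩

theorem subdivMap_comp (hdiv : IsInclusionUniform d div) (hK : DimEq K d) (hL : DimEq L d)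
    (hM : DimEq M d) {f : Pt n → Pt r} (hg : IsEmb K L g) (hf : IsEmb L M f) {x : Pt m}
    (hx : x ∈ (div m K).vertices) :
    subdivMap div K M (f ∘ g) x = subdivMap div L M f (subdivMap div K L g x) := by
  obtain ⟨ρ, hρ, hxρ⟩ := hdiv.exists_mem_hull hK hx
  exact hdiv.subdivMap_eq hK hM (hg.comp hf) hρ
    ((hdiv.faceIso_subdivMap hK hL hg hρ).comp
      (hdiv.faceIso_subdivMap hL hM hf (hg.map ρ hρ))) hx hxρ

theorem subdivMap_id (hdiv : IsInclusionUniform d div) (hK : DimEq K d) {x : Pt m}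
    (hx : x ∈ (div m K).vertices) : subdivMap div K K id x = x := by
  obtain ⟨ρ, hρ, hxρ⟩ := hdiv.exists_mem_hull hK hx
  exact hdiv.subdivMap_eq hK hK (IsEmb.id K) hρ (FaceIso.id _ _) hx hxρ

/-- For injectivity, a common image of points over `ρ` and `σ` lies over `g ρ ∩ g σ = g (ρ ∩ σ)`. By
the geometric clause both points lie over `ρ ∩ σ`, where the map is bijective. -/
theorem isEmb_subdivMap (hdiv : IsInclusionUniform d div) (hK : DimEq K d) (hL : DimEq L d)
    (hg : IsEmb K L g) : IsEmb (div m K) (div n L) (subdivMap div K L g) := by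
  refine ⟨fun x hx y hy e => ?_, fun s hs => ?_⟩
  · obtain ⟨ρ, hρ, hxρ⟩ := hdiv.exists_mem_hull hK hx
    obtain ⟨σ, hσ, hyσ⟩ := hdiv.exists_mem_hull hK hy
    have h1 := hdiv.faceIso_subdivMap hK hL hg hρ
    have h2 := hdiv.faceIso_subdivMap hK hL hg hσ
    have h3 := (h1.mapsTo hx hxρ).2
    have h4 := (h2.mapsTo hy hyσ).2
    rw [← e] at h4
    obtain ⟨h5, h6⟩ := mem_hull_inter (hg.map ρ hρ) (hg.map σ hσ) h3 h4
    have h7 : ρ.image g ∩ σ.image g = (ρ ∩ σ).image g := by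
      refine (Finset.image_inter_of_injOn _ _ (hg.inj.mono ?_)).symm
      rintro x (hx | hx)
      exacts [mem_vertices_of_mem_face hρ hx, mem_vertices_of_mem_face hσ hx]
    rw [h7] at h5
    have h8 := (h1.mem_hull_iff Finset.inter_subset_left hx hxρ).2 h5
    rw [e] at h5
    have h9 := (h2.mem_hull_iff Finset.inter_subset_right hy hyσ).2 h5
    exact (h1.restrict Finset.inter_subset_left).bijOn.injOn
      (mem_vertices_restrictTo.2 ⟨hx, h8⟩) (mem_vertices_restrictTo.2 ⟨hy, h9⟩) e
  · obtain ⟨ρ, hρ, hsρ⟩ := (hdiv.subdivides hK).sub s hs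
    refine (((hdiv.faceIso_subdivMap hK hL hg hρ).faces_iff s fun x hx => ?_).1 ⟨hs, hsρ⟩).1
    exact mem_vertices_restrictTo.2 ⟨mem_vertices_of_mem_face hs hx, hsρ hx⟩

theorem subdivMap_surj (hdiv : IsInclusionUniform d div) (hK : DimEq K d) (hL : DimEq L d)
    (hg : IsEmb K L g) (hρ : ρ ∈ K.faces) {t : Finset (Pt n)} (ht : t ∈ (div n L).faces)
    (htρ : (t : Set (Pt n)) ⊆ convexHull ℝ ((ρ.image g : Finset (Pt n)) : Set (Pt n))) :
    ∃ s ∈ (div m K).faces, (s : Set (Pt m)) ⊆ convexHull ℝ (ρ : Set (Pt m)) ∧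
      s.image (subdivMap div K L g) = t := by
  have h1 := hdiv.faceIso_subdivMap hK hL hg hρ
  have h2 : (t : Set (Pt n)) ⊆ subdivMap div K L g '' (restrictTo (div m K) ρ).vertices := by
    intro y hy
    exact h1.bijOn.surjOn (mem_vertices_restrictTo.2 ⟨mem_vertices_of_mem_face ht hy, htρ hy⟩)
  obtain ⟨s, hs, rfl⟩ := Finset.subset_set_image_iff.1 h2
  have h3 := (h1.faces_iff s hs).2 ⟨ht, htρ⟩
  exact ⟨s, h3.1, h3.2, rfl⟩

end IsInclusionUniform

/-- The map between iterated subdivisions induced by an injective simplicial map `K → L`. -/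
noncomputable def iterMap (div : CpxOp) :
    (k : ℕ) → Cpx m → Cpx n → (Pt m → Pt n) → Pt m → Pt n
  | 0, _, _, g => g
  -- Subdividing first and iterating afterwards matches the definitional unfolding of `(div m)^[k +
  -- 1]`.
  | k + 1, K, L, g => iterMap div k (div m K) (div n L) (subdivMap div K L g)

/-! ### Functoriality of iterated subdivisions. -/

namespace IsInclusionUniform

theorem iter_dimEq (hdiv : IsInclusionUniform d div) (hK : DimEq K d) (k : ℕ) :
    DimEq ((div m)^[k] K) d := by
  induction k with
  | zero => exact hK
  | succ k ih =>
    rw [Function.iterate_succ_apply']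
    exact hdiv.dimEq ih

theorem iter_subdivides (hdiv : IsInclusionUniform d div) (hK : DimEq K d) (k : ℕ) :
    Subdivides ((div m)^[k] K) K := by
  induction k with
  | zero => exact Subdivides.refl hK.1.1
  | succ k ih =>
    rw [Function.iterate_succ_apply']
    exact (hdiv.subdivides (hdiv.iter_dimEq hK k)).trans ih

theorem isEmb_iterMap (hdiv : IsInclusionUniform d div) (hK : DimEq K d) (hL : DimEq L d)
    (hg : IsEmb K L g) (k : ℕ) :
    IsEmb ((div m)^[k] K) ((div n)^[k] L) (iterMap div k K L g) := by
  induction k generalizing K L g with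
  | zero => exact hg
  | succ k ih => exact ih (hdiv.dimEq hK) (hdiv.dimEq hL) (hdiv.isEmb_subdivMap hK hL hg)

/-- Locality is inherited by induction: `x` lies in a face `u` of `div K` inside `ρ`, and the
induced maps on `div K` agree on `u` by `subdivMap_congr`. The inductive hypothesis is used with `u`
in place of `ρ`. -/
theorem iterMap_congr (hdiv : IsInclusionUniform d div) (hK : DimEq K d) (hL : DimEq L d)
    (hg : IsEmb K L g) (hg' : IsEmb K L g') (hρ : ρ ∈ K.faces) (he : Set.EqOn g g' ρ)
    (k : ℕ) {x : Pt m} (hx : x ∈ ((div m)^[k] K).vertices)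
    (hxρ : x ∈ convexHull ℝ (ρ : Set (Pt m))) :
    iterMap div k K L g x = iterMap div k K L g' x := by
  induction k generalizing K L g g' ρ with
  | zero =>
    exact he ((Geometry.SimplicialComplex.vertex_mem_convexHull_iff hx hρ).1 hxρ)
  | succ k ih =>
    obtain ⟨u, hu, hxu, huρ⟩ := (hdiv.iter_subdivides (hdiv.dimEq hK) k).carrier
      (hdiv.subdivides hK) hx hρ (by simpa using hxρ)
    refine ih (hdiv.dimEq hK) (hdiv.dimEq hL) (hdiv.isEmb_subdivMap hK hL hg)
      (hdiv.isEmb_subdivMap hK hL hg') hu (fun y hy => ?_) hx (by simpa using hxu)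
    exact hdiv.subdivMap_congr hK hL hg hg' hρ he (mem_vertices_of_mem_face hu hy) (huρ hy)

theorem exists_mem_hull_iter (hdiv : IsInclusionUniform d div) (hK : DimEq K d) (k : ℕ) {x : Pt m}
    (hx : x ∈ ((div m)^[k] K).vertices) :
    ∃ ρ ∈ K.faces, x ∈ convexHull ℝ (ρ : Set (Pt m)) := by
  obtain ⟨t, ht, h⟩ := (hdiv.iter_subdivides hK k).sub _ hx
  exact ⟨t, ht, h (by simp)⟩

theorem iterMap_comp (hdiv : IsInclusionUniform d div) (hK : DimEq K d) (hL : DimEq L d)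
    (hM : DimEq M d) {f : Pt n → Pt r} (hg : IsEmb K L g) (hf : IsEmb L M f) (k : ℕ) {x : Pt m}
    (hx : x ∈ ((div m)^[k] K).vertices) :
    iterMap div k K M (f ∘ g) x = iterMap div k L M f (iterMap div k K L g x) := by
  induction k generalizing K L M g f with
  | zero => rfl
  | succ k ih =>
    have h1 := hdiv.isEmb_subdivMap hK hL hg
    have h2 := hdiv.isEmb_subdivMap hL hM hf
    refine Eq.trans ?_ (ih (hdiv.dimEq hK) (hdiv.dimEq hL) (hdiv.dimEq hM) h1 h2 hx)
    -- The map induced by `f ∘ g` and the composite of the induced maps agree only at vertices of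
    -- `div K`, not as functions, so `iterMap_congr` is needed on a face carrying `x`.
    obtain ⟨ρ, hρ, hxρ⟩ := hdiv.exists_mem_hull_iter (hdiv.dimEq hK) k hx
    refine hdiv.iterMap_congr (hdiv.dimEq hK) (hdiv.dimEq hM)
      (hdiv.isEmb_subdivMap hK hM (hg.comp hf)) (h1.comp h2) hρ (fun y hy => ?_) k hx hxρ
    exact hdiv.subdivMap_comp hK hL hM hg hf (mem_vertices_of_mem_face hρ hy)

theorem iterMap_mapsTo (hdiv : IsInclusionUniform d div) (hK : DimEq K d) (hL : DimEq L d)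
    (hg : IsEmb K L g) (hρ : ρ ∈ K.faces) (k : ℕ) {x : Pt m}
    (hx : x ∈ ((div m)^[k] K).vertices) (hxρ : x ∈ convexHull ℝ (ρ : Set (Pt m))) :
    iterMap div k K L g x ∈ convexHull ℝ ((ρ.image g : Finset (Pt n)) : Set (Pt n)) := by
  induction k generalizing K L g ρ with
  | zero =>
    exact subset_convexHull ℝ _ (Finset.mem_coe.2 (Finset.mem_image_of_mem g
      ((Geometry.SimplicialComplex.vertex_mem_convexHull_iff hx hρ).1 hxρ)))
  | succ k ih =>
    obtain ⟨u, hu, hxu, huρ⟩ := (hdiv.iter_subdivides (hdiv.dimEq hK) k).carrier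
      (hdiv.subdivides hK) hx hρ (by simpa using hxρ)
    have h1 := ih (hdiv.dimEq hK) (hdiv.dimEq hL) (hdiv.isEmb_subdivMap hK hL hg) hu hx
      (by simpa using hxu)
    refine hull_subset_hull.2 ?_ h1
    rw [Finset.coe_image]
    rintro _ ⟨y, hy, rfl⟩
    exact ((hdiv.faceIso_subdivMap hK hL hg hρ).mapsTo (mem_vertices_of_mem_face hu hy)
      (huρ hy)).2

theorem iterMap_surj (hdiv : IsInclusionUniform d div) (hK : DimEq K d) (hL : DimEq L d)
    (hg : IsEmb K L g) (hρ : ρ ∈ K.faces) (k : ℕ) {t : Finset (Pt n)}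
    (ht : t ∈ ((div n)^[k] L).faces)
    (htρ : (t : Set (Pt n)) ⊆ convexHull ℝ ((ρ.image g : Finset (Pt n)) : Set (Pt n))) :
    ∃ s ∈ ((div m)^[k] K).faces, (s : Set (Pt m)) ⊆ convexHull ℝ (ρ : Set (Pt m)) ∧
      s.image (iterMap div k K L g) = t := by
  induction k generalizing K L g ρ with
  | zero =>
    have h := subset_of_subset_hull ht (hg.map ρ hρ) htρ
    obtain ⟨s, hs, rfl⟩ := Finset.subset_image_iff.1 h
    refine ⟨s, K.down_closed hρ hs ?_, (Finset.coe_subset.2 hs).trans (subset_convexHull ℝ _), rfl⟩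
    exact Finset.image_nonempty.1 (L.nonempty_of_mem_faces ht)
  | succ k ih =>
    obtain ⟨u, hu, htu, huρ⟩ := (hdiv.iter_subdivides (hdiv.dimEq hL) k).carrier
      (hdiv.subdivides hL) ht (hg.map ρ hρ) htρ
    obtain ⟨u', hu', hu'ρ, rfl⟩ := hdiv.subdivMap_surj hK hL hg hρ hu huρ
    obtain ⟨s, hs, hsu, hst⟩ := ih (hdiv.dimEq hK) (hdiv.dimEq hL)
      (hdiv.isEmb_subdivMap hK hL hg) hu' ht htu
    exact ⟨s, hs, hsu.trans (hull_subset_hull.2 hu'ρ), hst⟩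

/-- For the converse direction, the image of `s` is also the image of a face inside `ρ`, and by
injectivity on vertices that face is `s`. -/
theorem subset_hull_iterMap_iff (hdiv : IsInclusionUniform d div) (hK : DimEq K d)
    (hL : DimEq L d) (hg : IsEmb K L g) (hρ : ρ ∈ K.faces) (k : ℕ) {s : Finset (Pt m)}
    (hs : s ∈ ((div m)^[k] K).faces) :
    (s : Set (Pt m)) ⊆ convexHull ℝ (ρ : Set (Pt m)) ↔
      ((s.image (iterMap div k K L g) : Finset (Pt n)) : Set (Pt n)) ⊆
        convexHull ℝ ((ρ.image g : Finset (Pt n)) : Set (Pt n)) := by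
  have hE := hdiv.isEmb_iterMap hK hL hg k
  constructor
  · intro h
    rw [Finset.coe_image]
    rintro _ ⟨x, hx, rfl⟩
    exact hdiv.iterMap_mapsTo hK hL hg hρ k (mem_vertices_of_mem_face hs hx) (h hx)
  · intro h
    obtain ⟨s', hs', hs'ρ, e⟩ := hdiv.iterMap_surj hK hL hg hρ k (hE.map s hs) h
    intro x hx
    have : iterMap div k K L g x ∈ s'.image (iterMap div k K L g) := by
      rw [e]
      exact Finset.mem_image_of_mem _ hx
    obtain ⟨y, hy, hyx⟩ := Finset.mem_image.1 this
    rw [← hE.inj (mem_vertices_of_mem_face hs' hy) (mem_vertices_of_mem_face hs hx) hyx]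
    exact hs'ρ hy

end IsInclusionUniform

end Functor

/-! ### Subdivisions of the standard simplex are pseudomanifolds -/

/-- The vertex set of the standard simplex. -/
noncomputable def topFace (d : ℕ) : Finset (Pt (d + 1)) := Finset.univ.image (corner d)

theorem mem_faces_stdCpx {d : ℕ} {s : Finset (Pt (d + 1))} :
    s ∈ (stdCpx d).faces ↔ s.Nonempty ∧ s ⊆ topFace d := Iff.rfl

theorem corner_injective (d : ℕ) : Function.Injective (corner d) :=
  (corner_affineIndependent d).injective

theorem card_topFace (d : ℕ) : (topFace d).card = d + 1 := by
  rw [topFace, Finset.card_image_of_injective _ (corner_injective d)]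
  simp

theorem corner_mem_topFace {d : ℕ} (i : Fin (d + 1)) : corner d i ∈ topFace d :=
  Finset.mem_image_of_mem _ (Finset.mem_univ i)

theorem topFace_mem (d : ℕ) : topFace d ∈ (stdCpx d).faces :=
  mem_faces_stdCpx.2 ⟨⟨_, corner_mem_topFace 0⟩, Finset.Subset.refl _⟩

theorem dimEq_stdCpx (d : ℕ) : DimEq (stdCpx d) d := by
  refine ⟨⟨(topFace d).powerset.finite_toSet.subset fun s hs => ?_, fun s hs => ?_⟩,
    topFace d, topFace_mem d, card_topFace d⟩
  · exact Finset.mem_coe.2 (Finset.mem_powerset.2 (mem_faces_stdCpx.1 hs).2)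
  · exact (Finset.card_le_card (mem_faces_stdCpx.1 hs).2).trans (card_topFace d).le

theorem exists_corner {d : ℕ} {x : Pt (d + 1)} (hx : x ∈ (stdCpx d).vertices) :
    ∃ i, corner d i = x := by
  have := (mem_faces_stdCpx.1 hx).2 (Finset.mem_singleton_self x)
  obtain ⟨i, -, hi⟩ := Finset.mem_image.1 this
  exact ⟨i, hi⟩

theorem corner_apply {d : ℕ} (i j : Fin (d + 1)) : corner d i j = if j = i then 1 else 0 := by
  simp [corner, Pi.single_apply]

/-- The `j`-th coordinate. -/
noncomputable def coordMap {d : ℕ} (j : Fin (d + 1)) : Pt (d + 1) →ₗ[ℝ] ℝ := LinearMap.proj j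

theorem coordMap_apply {d : ℕ} (j : Fin (d + 1)) (x : Pt (d + 1)) : coordMap j x = x j := rfl

/-- The sum of all coordinates. -/
noncomputable def sumMap (d : ℕ) : Pt (d + 1) →ₗ[ℝ] ℝ := ∑ j, coordMap j

theorem sumMap_apply {d : ℕ} (x : Pt (d + 1)) : sumMap d x = ∑ j, x j := by
  simp [sumMap, coordMap_apply]

theorem sum_corner {d : ℕ} (x : Pt (d + 1)) : ∑ i, x i • corner d i = x := by
  funext j
  simp [corner_apply]

theorem mem_hull_topFace {d : ℕ} {x : Pt (d + 1)} :
    x ∈ convexHull ℝ (topFace d : Set (Pt (d + 1))) ↔ (∀ i, 0 ≤ x i) ∧ ∑ i, x i = 1 := by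
  constructor
  · intro hx
    obtain ⟨w, h0, h1, rfl⟩ := Finset.mem_convexHull'.1 hx
    have hc : ∀ v ∈ topFace d, (∀ i, 0 ≤ v i) ∧ sumMap d v = 1 := by
      intro v hv
      obtain ⟨i, -, rfl⟩ := Finset.mem_image.1 hv
      refine ⟨fun j => ?_, ?_⟩
      · rw [corner_apply]
        split_ifs <;> simp
      · rw [sumMap_apply]
        simp [corner_apply]
    refine ⟨fun i => ?_, ?_⟩
    · rw [Finset.sum_apply]
      exact Finset.sum_nonneg fun v hv => mul_nonneg (h0 v hv) ((hc v hv).1 i)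
    · rw [← sumMap_apply, map_sum, ← h1]
      refine Finset.sum_congr rfl fun v hv => ?_
      rw [map_smul, (hc v hv).2, smul_eq_mul, mul_one]
  · rintro ⟨h0, h1⟩
    rw [← sum_corner x]
    exact (convex_convexHull ℝ _).sum_mem (fun i _ => h0 i) h1
      fun i _ => subset_convexHull ℝ _ (Finset.mem_coe.2 (corner_mem_topFace i))

theorem oppFace_subset {d : ℕ} (j : Fin (d + 1)) : oppFace d j ⊆ topFace d :=
  Finset.image_subset_image (Finset.erase_subset _ _)

theorem corner_mem_oppFace {d : ℕ} {i j : Fin (d + 1)} : corner d i ∈ oppFace d j ↔ i ≠ j := by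
  rw [oppFace, (corner_injective d).mem_finset_image]
  simp

theorem card_oppFace {d : ℕ} (j : Fin (d + 1)) : (oppFace d j).card = d := by
  rw [oppFace, Finset.card_image_of_injective _ (corner_injective d)]
  simp

theorem oppFace_mem {d : ℕ} (hd : 1 ≤ d) (j : Fin (d + 1)) : oppFace d j ∈ (stdCpx d).faces :=
  mem_faces_stdCpx.2 ⟨Finset.card_pos.1 (by rw [card_oppFace]; omega), oppFace_subset j⟩

theorem mem_hull_oppFace {d : ℕ} {x : Pt (d + 1)} {j : Fin (d + 1)} :
    x ∈ convexHull ℝ (oppFace d j : Set (Pt (d + 1))) ↔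
      x ∈ convexHull ℝ (topFace d : Set (Pt (d + 1))) ∧ x j = 0 := by
  constructor
  · intro hx
    refine ⟨convexHull_mono (Finset.coe_subset.2 (oppFace_subset j)) hx, ?_⟩
    refine affine_zero_of_mem_hull (coordMap j).toAffineMap (fun v hv => ?_) hx
    obtain ⟨i, hi, rfl⟩ := Finset.mem_image.1 hv
    change corner d i j = 0
    rw [corner_apply, if_neg (Finset.ne_of_mem_erase hi).symm]
  · rintro ⟨hx, hj⟩
    obtain ⟨h0, h1⟩ := mem_hull_topFace.1 hx
    have e : ∑ i ∈ Finset.univ.erase j, x i • corner d i = x := by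
      rw [Finset.sum_erase _ (by rw [hj, zero_smul]), sum_corner]
    rw [← e]
    refine (convex_convexHull ℝ _).sum_mem (fun i _ => h0 i) ?_ fun i hi =>
      subset_convexHull ℝ _ (Finset.mem_coe.2 (Finset.mem_image_of_mem _ hi))
    rw [Finset.sum_erase _ hj, h1]

theorem exists_eq_erase {α : Type*} [DecidableEq α] {s t : Finset α} {d : ℕ} (hst : s ⊆ t)
    (hs : s.card = d) (ht : t.card = d + 1) : ∃ v ∈ t, s = t.erase v := by
  obtain ⟨v, hv⟩ := Finset.card_eq_one.1
    (show (t \ s).card = 1 by rw [Finset.card_sdiff_of_subset hst]; omega)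
  have hvt : v ∈ t \ s := by rw [hv]; exact Finset.mem_singleton_self v
  refine ⟨v, (Finset.mem_sdiff.1 hvt).1, ?_⟩
  rw [← Finset.sdiff_singleton_eq_erase, ← hv, Finset.sdiff_sdiff_eq_self hst]

/-! ### Facets, ridges and sides of a subdivided standard simplex. -/

namespace Subdivides

variable {d : ℕ} {K : Cpx (d + 1)} {s τ τ' τ'' : Finset (Pt (d + 1))} {v v' v'' : Pt (d + 1)}

theorem subset_hull_topFace (hK : Subdivides K (stdCpx d)) (hs : s ∈ K.faces) :
    (s : Set (Pt (d + 1))) ⊆ convexHull ℝ (topFace d : Set (Pt (d + 1))) := by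
  obtain ⟨t, ht, hst⟩ := hK.sub s hs
  exact hst.trans (convexHull_mono (Finset.coe_subset.2 (mem_faces_stdCpx.1 ht).2))

theorem coord_nonneg (hK : Subdivides K (stdCpx d)) (hs : s ∈ K.faces) (hv : v ∈ s)
    (j : Fin (d + 1)) : 0 ≤ v j :=
  (mem_hull_topFace.1 (hK.subset_hull_topFace hs hv)).1 j

theorem sumMap_eq_one (hK : Subdivides K (stdCpx d)) (hs : s ∈ K.faces) (hv : v ∈ s) :
    sumMap d v = 1 := by
  rw [sumMap_apply]
  exact (mem_hull_topFace.1 (hK.subset_hull_topFace hs hv)).2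

theorem subset_hull_oppFace_iff (hK : Subdivides K (stdCpx d)) (hs : s ∈ K.faces)
    {j : Fin (d + 1)} : (s : Set (Pt (d + 1))) ⊆ convexHull ℝ (oppFace d j : Set (Pt (d + 1))) ↔
      ∀ x ∈ s, x j = 0 :=
  ⟨fun h _ hx => (mem_hull_oppFace.1 (h hx)).2,
    fun h x hx => mem_hull_oppFace.2 ⟨hK.subset_hull_topFace hs hx, h x hx⟩⟩

/-- All vertices lie in the affine hyperplane of coordinate sum `1`, which misses the origin. Thus
facets are bases of the ambient space, and linear functionals can replace affine ones. -/
theorem linearIndependent (hK : Subdivides K (stdCpx d)) (hs : s ∈ K.faces) :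
    LinearIndependent ℝ ((↑) : s → Pt (d + 1)) := by
  rw [Fintype.linearIndependent_iff]
  intro w hw i
  have h1 : ∑ i, w i = 0 := by
    have := congrArg (sumMap d) hw
    rw [map_sum, map_zero] at this
    rw [← this]
    refine Finset.sum_congr rfl fun i _ => ?_
    rw [map_smul, hK.sumMap_eq_one hs i.2, smul_eq_mul, mul_one]
  exact affineIndependent_iff.1 (K.indep hs) Finset.univ w h1 hw i (Finset.mem_univ i)

theorem span_facet (hK : Subdivides K (stdCpx d)) (hτ : τ ∈ Faces K d) :
    Submodule.span ℝ (τ : Set (Pt (d + 1))) = ⊤ := by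
  have := (hK.linearIndependent hτ.1).span_eq_top_of_card_eq_finrank' (by
    rw [Fintype.card_coe, hτ.2]
    simp)
  simpa using this

theorem facet_ext (hK : Subdivides K (stdCpx d)) (hτ : τ ∈ Faces K d) {E : Type*}
    [AddCommGroup E] [Module ℝ E] {f g : Pt (d + 1) →ₗ[ℝ] E} (h : ∀ v ∈ τ, f v = g v) : f = g :=
  LinearMap.ext_on (hK.span_facet hτ) h

theorem exists_dual (hK : Subdivides K (stdCpx d)) (hτ : τ ∈ Faces K d) :
    ∃ l : Pt (d + 1) → (Pt (d + 1) →ₗ[ℝ] ℝ),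
      (∀ v ∈ τ, ∀ w ∈ τ, l v w = if w = v then 1 else 0) ∧
        ∀ x, ∑ v ∈ τ, l v x • v = x := by
  classical
  let b : Module.Basis τ ℝ (Pt (d + 1)) := Module.Basis.mk (hK.linearIndependent hτ.1) (by
    rw [Subtype.range_coe_subtype]
    exact (hK.span_facet hτ).ge)
  have hb : ∀ w : τ, b w = w := fun w => by simp [b]
  have h1 : ∀ v ∈ τ, ∀ w ∈ τ, (fun v => if h : v ∈ τ then b.coord ⟨v, h⟩ else 0) v w =
      if w = v then (1 : ℝ) else 0 := by
    intro v hv w hw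
    beta_reduce
    rw [dif_pos hv]
    have := b.repr_self_apply ⟨w, hw⟩ ⟨v, hv⟩
    rw [hb] at this
    simpa using this
  refine ⟨fun v => if h : v ∈ τ then b.coord ⟨v, h⟩ else 0, h1, fun x => ?_⟩
  set l : Pt (d + 1) → (Pt (d + 1) →ₗ[ℝ] ℝ) := fun v => if h : v ∈ τ then b.coord ⟨v, h⟩ else 0
  have : (∑ v ∈ τ, (l v).smulRight v) = LinearMap.id := by
    refine hK.facet_ext hτ fun w hw => ?_
    rw [LinearMap.sum_apply, LinearMap.id_apply]
    simp only [LinearMap.smulRight_apply]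
    rw [Finset.sum_congr rfl fun v hv => by rw [h1 v hv w hw]]
    simp [hw]
  have := LinearMap.congr_fun this x
  simpa using this

theorem facet_not_onSide (hK : Subdivides K (stdCpx d)) (hτ : τ ∈ Faces K d) (j : Fin (d + 1)) :
    ¬∀ x ∈ τ, x j = 0 := by
  intro h
  have := hK.facet_ext hτ (f := coordMap j) (g := 0) h
  have := LinearMap.congr_fun this (corner d j)
  rw [coordMap_apply, corner_apply] at this
  simp at this

/-- If `i ≠ j`, the functional `v j • x_i - v i • x_j` vanishes on the basis `τ`, hence at `e_i`.
Then `v j = 0` and all of `τ` would lie in the `j`-th side. -/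
theorem side_unique (hK : Subdivides K (stdCpx d)) (hτ : τ ∈ Faces K d) {i j : Fin (d + 1)}
    (hi : ∀ x ∈ τ.erase v, x i = 0) (hj : ∀ x ∈ τ.erase v, x j = 0) : i = j := by
  by_contra hij
  have h : v j • coordMap i = v i • coordMap j := by
    refine hK.facet_ext hτ fun x hx => ?_
    simp only [LinearMap.smul_apply, coordMap_apply, smul_eq_mul]
    by_cases hxv : x = v
    · rw [hxv, mul_comm]
    · rw [hi x (Finset.mem_erase.2 ⟨hxv, hx⟩), hj x (Finset.mem_erase.2 ⟨hxv, hx⟩)]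
      simp
  have := LinearMap.congr_fun h (corner d i)
  simp only [LinearMap.smul_apply, coordMap_apply, corner_apply, smul_eq_mul, if_true,
    if_neg (Ne.symm hij), mul_one, mul_zero] at this
  refine hK.facet_not_onSide hτ j fun x hx => ?_
  by_cases hxv : x = v
  · rw [hxv, this]
  · exact hj x (Finset.mem_erase.2 ⟨hxv, hx⟩)

theorem ridge_nonempty (hd : 1 ≤ d) (hτ : τ ∈ Faces K d) (hv : v ∈ τ) : (τ.erase v).Nonempty := by
  rw [← Finset.card_pos, Finset.card_erase_of_mem hv, hτ.2]
  omega

theorem ridge_mem (hd : 1 ≤ d) (hτ : τ ∈ Faces K d) (hv : v ∈ τ) : τ.erase v ∈ K.faces :=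
  K.down_closed hτ.1 (Finset.erase_subset _ _) (ridge_nonempty hd hτ hv)

/-- Two facets on the same side of the hyperplane of a common ridge overlap near the barycentre `c`
of the ridge. A point slightly off `c` towards `v'` lies in `τ'` and in the interior of `τ`, but
simplices of a complex meet only in common faces. -/
theorem facet_eq_of_same_side (hK : Subdivides K (stdCpx d)) (hd : 1 ≤ d) (hτ : τ ∈ Faces K d)
    (hτ' : τ' ∈ Faces K d) (hv : v ∈ τ) (hv' : v' ∈ τ') (he : τ.erase v = τ'.erase v')
    (φ : Pt (d + 1) →ₗ[ℝ] ℝ) (hφ : ∀ x ∈ τ.erase v, φ x = 0) (h1 : 0 < φ v) (h2 : 0 < φ v') :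
    τ = τ' := by
  obtain ⟨l, hl, hsum⟩ := hK.exists_dual hτ
  have hφl : φ = φ v • l v := by
    refine hK.facet_ext hτ fun x hx => ?_
    rw [LinearMap.smul_apply, hl v hv x hx, smul_eq_mul]
    by_cases hxv : x = v
    · rw [if_pos hxv, mul_one, hxv]
    · rw [hφ x (Finset.mem_erase.2 ⟨hxv, hx⟩), if_neg hxv, mul_zero]
  have hlv' : 0 < l v v' := by
    have := LinearMap.congr_fun hφl v'
    rw [LinearMap.smul_apply, smul_eq_mul] at this
    rw [this] at h2
    exact (pos_iff_pos_of_mul_pos h2).1 h1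
  set ν := τ.erase v with hν
  have hνne : ν.Nonempty := ridge_nonempty hd hτ hv
  set c := bary ν with hc
  have hcν : c ∈ convexHull ℝ (ν : Set (Pt (d + 1))) := bary_mem_hull hνne
  have hlc : ∀ w ∈ ν, 0 < l w c := by
    intro w hw
    have := affine_bary (l w).toAffineMap hνne
    rw [LinearMap.coe_toAffineMap] at this
    rw [hc, this, Finset.sum_congr rfl fun x hx => by
      rw [hl w (Finset.mem_of_mem_erase hw) x (Finset.mem_of_mem_erase hx)]]
    simp only [mul_ite, mul_one, mul_zero, Finset.sum_ite_eq', hw, if_true]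
    exact inv_pos.2 (Nat.cast_pos.2 (Finset.card_pos.2 hνne))
  have hlvc : l v c = 0 :=
    affine_zero_of_mem_hull (l v).toAffineMap (fun x hx => by
      rw [LinearMap.coe_toAffineMap, hl v hv x (Finset.mem_of_mem_erase hx),
        if_neg (Finset.ne_of_mem_erase hx)]) hcν
  -- The coordinates belonging to the ridge are positive at `c` and stay so nearby; the coordinate
  -- of `v` vanishes at `c` and becomes positive because `l v v' > 0`.
  have hev : ∀ᶠ t : ℝ in 𝓝[>] 0, ∀ w ∈ ν, 0 < l w (c + t • (v' - c)) := by
    refine (Finset.eventually_all ν).2 fun w hw => ?_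
    refine nhdsWithin_le_nhds ?_
    have hcont : Continuous fun t : ℝ => l w (c + t • (v' - c)) := by
      simp only [map_add, map_smul]
      fun_prop
    have := hcont.tendsto 0
    rw [zero_smul, add_zero] at this
    exact this.eventually (lt_mem_nhds (hlc w hw))
  obtain ⟨t, ht, ht0, ht1⟩ := (hev.and (Ioo_mem_nhdsGT (zero_lt_one' ℝ))).exists
  set x := c + t • (v' - c) with hx
  have hxτ' : x ∈ convexHull ℝ (τ' : Set (Pt (d + 1))) := by
    refine (convex_convexHull ℝ _).add_smul_sub_mem ?_
      (subset_convexHull ℝ _ (Finset.mem_coe.2 hv')) ⟨ht0.le, ht1.le⟩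
    rw [he] at hcν
    exact convexHull_mono (Finset.coe_subset.2 (Finset.erase_subset _ _)) hcν
  have hpos : ∀ w ∈ τ, 0 < l w x := by
    intro w hw
    by_cases hwv : w = v
    · rw [hwv, hx, map_add, map_smul, map_sub, hlvc]
      simpa using mul_pos ht0 hlv'
    · exact ht w (Finset.mem_erase.2 ⟨hwv, hw⟩)
  have hsx : sumMap d x = 1 := by
    have := hull_subset_hull.2 (hK.subset_hull_topFace hτ'.1) hxτ'
    rw [sumMap_apply]
    exact (mem_hull_topFace.1 this).2
  have hxτ : x ∈ convexHull ℝ (τ : Set (Pt (d + 1))) := by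
    refine Finset.mem_convexHull'.2 ⟨fun w => l w x, fun w hw => (hpos w hw).le, ?_, hsum x⟩
    rw [← hsx]
    conv_rhs => rw [← hsum x]
    rw [map_sum]
    refine Finset.sum_congr rfl fun w hw => ?_
    rw [map_smul, hK.sumMap_eq_one hτ.1 hw, smul_eq_mul, mul_one]
  have hxi := (mem_hull_inter hτ.1 hτ'.1 hxτ hxτ').1
  refine Finset.eq_of_subset_of_card_le (fun w hw => ?_) (by rw [hτ.2, hτ'.2])
  by_contra hwτ'
  refine (hpos w hw).ne' (affine_zero_of_mem_hull (l w).toAffineMap (fun y hy => ?_) hxi)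
  obtain ⟨hy1, hy2⟩ := Finset.mem_inter.1 hy
  rw [LinearMap.coe_toAffineMap, hl w hw y hy1, if_neg]
  rintro rfl
  exact hwτ' hy2

/-- A ridge lies in at most two facets. -/
theorem facet_eq_of_ne (hK : Subdivides K (stdCpx d)) (hd : 1 ≤ d) (hτ : τ ∈ Faces K d)
    (hτ' : τ' ∈ Faces K d) (hτ'' : τ'' ∈ Faces K d) (hv : v ∈ τ) (h1 : τ.erase v ⊆ τ')
    (h2 : τ.erase v ⊆ τ'') (hne' : τ' ≠ τ) (hne'' : τ'' ≠ τ) : τ' = τ'' := by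
  have hc : (τ.erase v).card = d := by
    rw [Finset.card_erase_of_mem hv, hτ.2]
    rfl
  obtain ⟨v', hv', he'⟩ := exists_eq_erase h1 hc hτ'.2
  obtain ⟨v'', hv'', he''⟩ := exists_eq_erase h2 hc hτ''.2
  obtain ⟨l, hl, -⟩ := hK.exists_dual hτ
  have h0 : ∀ x ∈ τ.erase v, l v x = 0 := fun x hx => by
    rw [hl v hv x (Finset.mem_of_mem_erase hx), if_neg (Finset.ne_of_mem_erase hx)]
  have hvv : l v v = 1 := by rw [hl v hv v hv, if_pos rfl]
  -- Any other facet through the ridge lies strictly on the side opposite to `τ`: on the same side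
  -- it would equal `τ`, and on the hyperplane it could not span.
  have key : ∀ {σ : Finset (Pt (d + 1))} {w : Pt (d + 1)}, σ ∈ Faces K d → w ∈ σ →
      τ.erase v = σ.erase w → σ ≠ τ → l v w < 0 := by
    intro σ w hσ hw he hne
    by_contra hcon
    rcases (not_lt.1 hcon).eq_or_lt with h | h
    · have : l v = 0 := hK.facet_ext hσ fun x hx => by
        by_cases hxw : x = w
        · rw [hxw, ← h]
          rfl
        · exact h0 x (he ▸ Finset.mem_erase.2 ⟨hxw, hx⟩)
      rw [this] at hvv
      simp at hvv
    · exact hne (hK.facet_eq_of_same_side hd hτ hσ hv hw he (l v) h0 (by rw [hvv]; simp) h).symm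
  refine hK.facet_eq_of_same_side hd hτ' hτ'' hv' hv'' (he'.symm.trans he'') (-l v)
    (fun x hx => ?_) ?_ ?_
  · rw [LinearMap.neg_apply, h0 x (he' ▸ hx), neg_zero]
  · simpa using key hτ' hv' he' hne'
  · simpa using key hτ'' hv'' he'' hne''

/-- A ridge in the boundary lies in at most one facet. -/
theorem facet_eq_of_onSide (hK : Subdivides K (stdCpx d)) (hd : 1 ≤ d) (hτ : τ ∈ Faces K d)
    (hτ' : τ' ∈ Faces K d) (h1 : s ⊆ τ) (h2 : s ⊆ τ') (hs : s.card = d) {j : Fin (d + 1)}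
    (hj : ∀ x ∈ s, x j = 0) : τ = τ' := by
  obtain ⟨v, hv, rfl⟩ := exists_eq_erase h1 hs hτ.2
  obtain ⟨v', hv', he'⟩ := exists_eq_erase h2 hs hτ'.2
  have key : ∀ {σ : Finset (Pt (d + 1))} {w : Pt (d + 1)}, σ ∈ Faces K d → w ∈ σ →
      τ.erase v = σ.erase w → 0 < coordMap j w := by
    intro σ w hσ hw he
    refine lt_of_le_of_ne (hK.coord_nonneg hσ.1 hw j) fun h => hK.facet_not_onSide hσ j fun x hx => ?_
    by_cases hxw : x = w
    · rw [hxw]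
      exact h.symm
    · exact hj x (he ▸ Finset.mem_erase.2 ⟨hxw, hx⟩)
  exact hK.facet_eq_of_same_side hd hτ hτ' hv hv' he' (coordMap j) hj (key hτ hv rfl)
    (key hτ' hv' he')

/-- Two distinct ridges of `τ` together contain all its vertices, and a whole facet cannot lie in a
side. -/
theorem ridge_eq_of_onSide (hK : Subdivides K (stdCpx d)) (hτ : τ ∈ Faces K d)
    {t : Finset (Pt (d + 1))} (h1 : s ⊆ τ) (h2 : t ⊆ τ) (hs : s.card = d) (ht : t.card = d)
    {j : Fin (d + 1)} (hsj : ∀ x ∈ s, x j = 0) (htj : ∀ x ∈ t, x j = 0) : s = t := by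
  by_contra hne
  have hlt : s.card < (s ∪ t).card := by
    refine Finset.card_lt_card (Finset.ssubset_iff_subset_ne.2 ⟨Finset.subset_union_left, ?_⟩)
    intro h
    have hts : t ⊆ s := by
      rw [h]
      exact Finset.subset_union_right
    exact hne (Finset.eq_of_subset_of_card_le hts (by omega)).symm
  have he : s ∪ t = τ :=
    Finset.eq_of_subset_of_card_le (Finset.union_subset h1 h2) (by rw [hτ.2]; omega)
  refine hK.facet_not_onSide hτ j fun x hx => ?_
  rw [← he] at hx
  exact (Finset.mem_union.1 hx).elim (hsj x) (htj x)

theorem exists_facet_superset (hK : Subdivides K (stdCpx d)) (hs : s ∈ K.faces) :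
    ∃ τ ∈ Faces K d, s ⊆ τ := by
  obtain ⟨t, ht, hst, -, hc⟩ := hK.exists_facet hs (topFace_mem d) (hK.subset_hull_topFace hs)
  exact ⟨t, ⟨ht, hc.trans (card_topFace d)⟩, hst⟩

/-- An interior ridge lies in a second facet. -/
theorem exists_other_facet (hK : Subdivides K (stdCpx d)) (hd : 1 ≤ d) (hτ : τ ∈ Faces K d)
    (hv : v ∈ τ) (hint : ∀ j, ¬∀ x ∈ τ.erase v, x j = 0) :
    ∃ τ' ∈ Faces K d, τ' ≠ τ ∧ τ.erase v ⊆ τ' := by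
  obtain ⟨l, hl, hsum⟩ := hK.exists_dual hτ
  have hνne := ridge_nonempty hd hτ hv
  have hνK := ridge_mem hd hτ hv
  set ν := τ.erase v with hν
  set c := bary ν with hc
  have hcν : c ∈ convexHull ℝ (ν : Set (Pt (d + 1))) := bary_mem_hull hνne
  have hctop := mem_hull_topFace.1 (hull_subset_hull.2 (hK.subset_hull_topFace hνK) hcν)
  have hcpos : ∀ j, 0 < c j := fun j => by
    refine lt_of_le_of_ne (hctop.1 j) fun h => hint j ?_
    exact eq_zero_of_affine_bary (coordMap j).toAffineMap
      (fun x hx => hK.coord_nonneg hνK hx j) h.symm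
  -- As the ridge is in no side, all coordinates of its barycentre are positive. One can therefore
  -- step across the ridge, away from `v`, without leaving `Δ_d`.
  have hev : ∀ᶠ t : ℝ in 𝓝[>] 0, ∀ j ∈ Finset.univ, 0 < (c + t • (c - v)) j := by
    refine (Finset.eventually_all _).2 fun j _ => nhdsWithin_le_nhds ?_
    have hcont : Continuous fun t : ℝ => (c + t • (c - v)) j := by
      simp only [Pi.add_apply, Pi.smul_apply]
      fun_prop
    have := hcont.tendsto 0
    rw [zero_smul, add_zero] at this
    exact this.eventually (lt_mem_nhds (hcpos j))
  obtain ⟨t, ht, ht0⟩ := (hev.and self_mem_nhdsWithin).exists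
  have ht0 : 0 < t := ht0
  have hy : c + t • (c - v) ∈ convexHull ℝ (topFace d : Set (Pt (d + 1))) := by
    refine mem_hull_topFace.2 ⟨fun j => (ht j (Finset.mem_univ j)).le, ?_⟩
    rw [← sumMap_apply, map_add, map_smul, map_sub, hK.sumMap_eq_one hτ.1 hv, sumMap_apply,
      hctop.2]
    simp
  obtain ⟨u, hu, -, hνu, ε, hε, hmem⟩ := hK.push hνK (topFace_mem d)
    (hK.subset_hull_topFace hνK) hy
  obtain ⟨τ', hτ', huτ'⟩ := hK.exists_facet_superset hu
  refine ⟨τ', hτ', ?_, hνu.trans huτ'⟩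
  -- If the facet found were `τ`, then `l v` would be nonnegative at the pushed point, where its
  -- value is `-(ε * t)`.
  rintro rfl
  have hmem' := convexHull_mono (Finset.coe_subset.2 huτ') hmem
  have hnn := affine_nonneg_of_mem_hull (l v).toAffineMap (fun w hw => by
    rw [LinearMap.coe_toAffineMap, hl v hv w hw]
    split_ifs <;> simp) hmem'
  have hlvc : l v c = 0 :=
    affine_zero_of_mem_hull (l v).toAffineMap (fun x hx => by
      rw [LinearMap.coe_toAffineMap, hl v hv x (Finset.mem_of_mem_erase hx),
        if_neg (Finset.ne_of_mem_erase hx)]) hcν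
  rw [LinearMap.coe_toAffineMap, ← hc, add_sub_cancel_left, map_add, map_smul, map_smul, map_sub,
    hlvc, hl v hv v hv, if_pos rfl] at hnn
  simp only [smul_eq_mul, zero_add, zero_sub, mul_neg, mul_one] at hnn
  linarith [mul_pos hε ht0]

end Subdivides

/-! ### Combinatorics of the dual graph and its boundary -/

section Combinatorics

variable {d : ℕ} {div : CpxOp}

/-- For `d ≥ 1` an intersection with `d` elements is nonempty and hence automatically a face. -/
theorem dualGraph_adj {m : ℕ} (hd : 1 ≤ d) {K : Cpx m} {s t : Faces K d} :
    (dualGraph K d).Adj s t ↔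
      s ≠ t ∧ ((s : Finset (Pt m)) ∩ (t : Finset (Pt m))).card = d := by
  refine and_congr Iff.rfl ⟨fun h => h.2.trans (Nat.sub_add_cancel hd), fun h => ⟨?_, ?_⟩⟩
  · exact K.down_closed s.2.1 Finset.inter_subset_left (Finset.card_pos.1 (by omega))
  · exact h.trans (Nat.sub_add_cancel hd).symm

theorem IsInclusionUniform.subdivides_std (hdiv : IsInclusionUniform d div) :
    Subdivides (div (d + 1) (stdCpx d)) (stdCpx d) :=
  hdiv.subdivides (dimEq_stdCpx d)

variable (hd : 1 ≤ d) (hdiv : IsInclusionUniform d div)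
include hd hdiv

theorem mem_sideFaces {ν : Finset (Pt (d + 1))} {j : Fin (d + 1)} :
    ν ∈ sideFaces d div j ↔
      ν ∈ (div (d + 1) (stdCpx d)).faces ∧ (∀ x ∈ ν, x j = 0) ∧ ν.card = d := by
  have e : d - 1 + 1 = d := Nat.sub_add_cancel hd
  constructor
  · rintro ⟨⟨h1, h2⟩, h3⟩
    exact ⟨h1, (hdiv.subdivides_std.subset_hull_oppFace_iff h1).1 h2, h3.trans e⟩
  · rintro ⟨h1, h2, h3⟩
    exact ⟨⟨h1, (hdiv.subdivides_std.subset_hull_oppFace_iff h1).2 h2⟩, h3.trans e.symm⟩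

theorem erase_mem_sideFaces {τ : Facet d div} {v : Pt (d + 1)} (hv : v ∈ τ.1) {j : Fin (d + 1)} :
    τ.1.erase v ∈ sideFaces d div j ↔ ∀ x ∈ τ.1.erase v, x j = 0 := by
  rw [mem_sideFaces hd hdiv]
  refine ⟨fun h => h.2.1, fun h => ⟨Subdivides.ridge_mem hd τ.2 hv, h, ?_⟩⟩
  rw [Finset.card_erase_of_mem hv, τ.2.2]
  rfl

theorem mem_divBdry {τ : Facet d div} {j : Fin (d + 1)} :
    τ ∈ divBdry d div j ↔ ∃ v ∈ τ.1, ∀ x ∈ τ.1.erase v, x j = 0 := by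
  constructor
  · rintro ⟨ν, hν, hντ⟩
    obtain ⟨-, h2, h3⟩ := (mem_sideFaces hd hdiv).1 hν
    obtain ⟨v, hv, rfl⟩ := exists_eq_erase hντ h3 τ.2.2
    exact ⟨v, hv, h2⟩
  · rintro ⟨v, hv, h⟩
    exact ⟨_, (erase_mem_sideFaces hd hdiv hv).2 h, Finset.erase_subset _ _⟩

omit hdiv in
theorem exists_inter_eq_erase {τ τ' : Facet d div} (h : (divGraph d div).Adj τ τ') :
    ∃ v ∈ τ.1, τ.1 ∩ τ'.1 = τ.1.erase v ∧ v ∉ τ'.1 := by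
  obtain ⟨v, hv, e⟩ := exists_eq_erase Finset.inter_subset_left ((dualGraph_adj hd).1 h).2 τ.2.2
  refine ⟨v, hv, e, fun hv' => ?_⟩
  have : v ∈ τ.1.erase v := e ▸ Finset.mem_inter.2 ⟨hv, hv'⟩
  simp at this

omit hdiv in
theorem adj_of_erase_subset {τ τ' : Facet d div} {v : Pt (d + 1)} (hv : v ∈ τ.1) (hne : τ ≠ τ')
    (h : τ.1.erase v ⊆ τ'.1) : (divGraph d div).Adj τ τ' ∧ τ.1 ∩ τ'.1 = τ.1.erase v := by
  have hc : (τ.1.erase v).card = d := by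
    rw [Finset.card_erase_of_mem hv, τ.2.2]
    rfl
  have e : τ.1.erase v = τ.1 ∩ τ'.1 := by
    refine Finset.eq_of_subset_of_card_le
      (Finset.subset_inter (Finset.erase_subset _ _) h) ?_
    rw [hc]
    refine Nat.lt_succ_iff.1 ((Finset.card_lt_card
      (Finset.ssubset_iff_subset_ne.2 ⟨Finset.inter_subset_left, ?_⟩)).trans_eq τ.2.2)
    intro he
    refine hne (Subtype.ext (Finset.eq_of_subset_of_card_le (Finset.inter_eq_left.1 he) ?_))
    rw [τ.2.2, τ'.2.2]
  exact ⟨(dualGraph_adj hd).2 ⟨hne, by rw [← e, hc]⟩, e.symm⟩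

/-- Interior ridges correspond to neighbours and boundary ridges to loops. -/
theorem divGraph_degree_add (τ : Facet d div) :
    ((divGraph d div).neighborSet τ).ncard + {i | τ ∈ divBdry d div i}.ncard = d + 1 := by
  classical
  have hK := hdiv.subdivides_std
  -- `R` consists of the `d + 1` ridges of `τ`, and `P` singles out those in some side. Ridges
  -- outside `P` are counted by neighbours, those in `P` by the index of their side, which
  -- `side_unique` shows to be well determined.
  let R := τ.1.powersetCard d
  let P : Finset (Pt (d + 1)) → Prop := fun ν => ∃ j, ∀ x ∈ ν, x j = 0
  have hR : R.card = d + 1 := by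
    rw [Finset.card_powersetCard, τ.2.2, Nat.choose_succ_self_right]
  have h1 : ((divGraph d div).neighborSet τ).ncard = (R.filter fun ν => ¬P ν).card := by
    rw [← Set.ncard_coe_finset]
    refine Set.ncard_congr (fun τ' _ => τ.1 ∩ τ'.1) (fun τ' h => ?_) (fun τ' τ'' h' h'' he => ?_)
      (fun ν hν => ?_)
    · have ha := (dualGraph_adj hd).1 h
      rw [Finset.mem_coe, Finset.mem_filter, Finset.mem_powersetCard]
      refine ⟨⟨Finset.inter_subset_left, ha.2⟩, fun ⟨j, hj⟩ => ha.1 (Subtype.ext ?_)⟩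
      exact hK.facet_eq_of_onSide hd τ.2 τ'.2 Finset.inter_subset_left Finset.inter_subset_right
        ha.2 hj
    · obtain ⟨v, hv, e, -⟩ := exists_inter_eq_erase hd h'
      refine Subtype.ext (hK.facet_eq_of_ne hd τ.2 τ'.2 τ''.2 hv ?_ ?_ ?_ ?_)
      · rw [← e]
        exact Finset.inter_subset_right
      · rw [← e, he]
        exact Finset.inter_subset_right
      · exact fun h => ((dualGraph_adj hd).1 h').1 (Subtype.ext h.symm)
      · exact fun h => ((dualGraph_adj hd).1 h'').1 (Subtype.ext h.symm)
    · rw [Finset.mem_coe, Finset.mem_filter, Finset.mem_powersetCard] at hν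
      obtain ⟨⟨hντ, hc⟩, hP⟩ := hν
      obtain ⟨v, hv, rfl⟩ := exists_eq_erase hντ hc τ.2.2
      obtain ⟨τ', hτ', hne, hsub⟩ :=
        hK.exists_other_facet hd τ.2 hv fun j hj => hP ⟨j, hj⟩
      have := adj_of_erase_subset hd (τ' := ⟨τ', hτ'⟩) hv
        (fun h => hne (congrArg Subtype.val h).symm) hsub
      exact ⟨⟨τ', hτ'⟩, this.1, this.2⟩
  have h2 : (R.filter P).card = {i | τ ∈ divBdry d div i}.ncard := by
    rw [← Set.ncard_coe_finset]
    have hP : ∀ ν ∈ (R.filter P : Set (Finset (Pt (d + 1)))),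
        (ν ⊆ τ.1 ∧ ν.card = d) ∧ P ν := fun ν hν => by
      rwa [Finset.mem_coe, Finset.mem_filter, Finset.mem_powersetCard] at hν
    refine Set.ncard_congr (fun ν hν => (hP ν hν).2.choose) (fun ν hν => ?_)
      (fun ν ν' hν hν' he => ?_) (fun i hi => ?_)
    · obtain ⟨v, hv, hνv⟩ := exists_eq_erase (hP ν hν).1.1 (hP ν hν).1.2 τ.2.2
      refine (mem_divBdry hd hdiv).2 ⟨v, hv, ?_⟩
      rw [← hνv]
      exact (hP ν hν).2.choose_spec
    · have e1 := (hP ν hν).2.choose_spec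
      have e2 := (hP ν' hν').2.choose_spec
      rw [← he] at e2
      exact hK.ridge_eq_of_onSide τ.2 (hP ν hν).1.1 (hP ν' hν').1.1 (hP ν hν).1.2
        (hP ν' hν').1.2 e1 e2
    · obtain ⟨v, hv, hi⟩ := (mem_divBdry hd hdiv).1 hi
      have hc : (τ.1.erase v).card = d := by
        rw [Finset.card_erase_of_mem hv, τ.2.2]
        rfl
      have hν : τ.1.erase v ∈ (R.filter P : Set (Finset (Pt (d + 1)))) := by
        rw [Finset.mem_coe, Finset.mem_filter, Finset.mem_powersetCard]
        exact ⟨⟨Finset.erase_subset _ _, hc⟩, i, hi⟩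
      exact ⟨_, hν, hK.side_unique τ.2 (hP _ hν).2.choose_spec hi⟩
  rw [h1, ← h2, add_comm]
  exact (Finset.card_filter_add_card_filter_not _).trans hR

theorem exists_isLabelling : ∃ kappa, IsLabelling (divGraph d div) (divBdry d div) kappa := by
  have hfin : Finite (Facet d div) :=
    (hdiv.subdivides_std.finite.subset fun s hs => hs.1 : (Faces _ d).Finite)
  have h : ∀ τ : Facet d div, ∃ f : Facet d div → Fin (d + 1),
      Set.BijOn f ((divGraph d div).neighborSet τ) {i | τ ∉ divBdry d div i} := by
    intro τ
    refine (Set.toFinite _).exists_bijOn_of_encard_eq ?_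
    rw [← (Set.toFinite _).cast_ncard_eq, ← (Set.toFinite _).cast_ncard_eq]
    congr 1
    have h1 := divGraph_degree_add hd hdiv τ
    have h2 := Set.ncard_add_ncard_compl {i | τ ∈ divBdry d div i}
    rw [Nat.card_eq_fintype_card, Fintype.card_fin] at h2
    change _ = ({i | τ ∈ divBdry d div i}ᶜ).ncard
    omega
  choose f hf using h
  exact ⟨f, hf⟩

end Combinatorics

/-! ### The size of the boundary sets. -/

theorem IsCornerIso.ncard_faces {ι : Type} {m n : ℕ} {A : Cpx m} {p : ι → Pt m} {B : Cpx n}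
    {q : ι → Pt n} {g : Pt m → Pt n} (h : IsCornerIso A p B q g) (i : ℕ) :
    (Faces A i).ncard = (Faces B i).ncard := by
  have hv : ∀ s ∈ A.faces, (s : Set (Pt m)) ⊆ A.vertices := fun s hs x hx =>
    mem_vertices_of_mem_face hs hx
  refine Set.ncard_congr (fun s _ => s.image g) (fun s hs => ?_) (fun s t hs ht e => ?_)
    (fun t ht => ?_)
  · refine ⟨(h.faces_iff s (hv s hs.1)).1 hs.1, ?_⟩
    rw [Finset.card_image_of_injOn (h.bijOn.injOn.mono (hv s hs.1)), hs.2]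
  · have e' : g '' (s : Set (Pt m)) = g '' (t : Set (Pt m)) := by
      rw [← Finset.coe_image, ← Finset.coe_image, e]
    exact Finset.coe_injective
      ((h.bijOn.injOn.image_eq_image_iff (hv s hs.1) (hv t ht.1)).1 e')
  · have : (t : Set (Pt n)) ⊆ g '' A.vertices := by
      rw [h.bijOn.image_eq]
      exact fun x hx => mem_vertices_of_mem_face ht.1 hx
    obtain ⟨s, hs, rfl⟩ := Finset.subset_set_image_iff.1 this
    refine ⟨s, ⟨(h.faces_iff s hs).2 ht.1, ?_⟩, rfl⟩
    rw [← ht.2, Finset.card_image_of_injOn (h.bijOn.injOn.mono hs)]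

/-- Sending a ridge of the `j`-th side to the unique facet containing it is a bijection, and
inclusion-uniformity identifies the subdivided side with `div Δ_{d-1}`. -/
theorem divBdry_ncard {d : ℕ} {div : CpxOp} (hd : 1 ≤ d) (hdiv : IsInclusionUniform d div)
    (j : Fin (d + 1)) : (divBdry d div j).ncard = fNum div (d - 1) := by
  have hK := hdiv.subdivides_std
  have e : d - 1 + 1 = d := Nat.sub_add_cancel hd
  have hopp : oppFace d j ∈ Faces (stdCpx d) (d - 1) :=
    ⟨oppFace_mem hd j, (card_oppFace j).trans e.symm⟩
  obtain ⟨g, hg, -⟩ := hdiv.2 _ _ (dimEq_stdCpx d) _ _ hopp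
    ((oppFace d j).equivFinOfCardEq hopp.2)
  rw [fNum, ← hg.ncard_faces (d - 1)]
  change _ = (sideFaces d div j).ncard
  refine (Set.ncard_congr (fun ν hν =>
    (⟨(hK.exists_facet_superset ((mem_sideFaces hd hdiv).1 hν).1).choose,
      (hK.exists_facet_superset ((mem_sideFaces hd hdiv).1 hν).1).choose_spec.1⟩ :
        Facet d div)) (fun ν hν => ?_) (fun ν ν' hν hν' he => ?_) (fun τ hτ => ?_)).symm
  · exact ⟨ν, hν, (hK.exists_facet_superset ((mem_sideFaces hd hdiv).1 hν).1).choose_spec.2⟩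
  · obtain ⟨h1, h2, h3⟩ := (mem_sideFaces hd hdiv).1 hν
    obtain ⟨h1', h2', h3'⟩ := (mem_sideFaces hd hdiv).1 hν'
    have h4 := (hK.exists_facet_superset h1).choose_spec
    have h4' := (hK.exists_facet_superset h1').choose_spec
    have he : (hK.exists_facet_superset h1).choose = (hK.exists_facet_superset h1').choose :=
      congrArg Subtype.val he
    rw [← he] at h4'
    exact hK.ridge_eq_of_onSide h4.1 h4.2 h4'.2 h3 h3' h2 h2'
  · obtain ⟨ν, hν, hντ⟩ := hτ
    obtain ⟨h1, h2, h3⟩ := (mem_sideFaces hd hdiv).1 hν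
    have h4 := (hK.exists_facet_superset h1).choose_spec
    exact ⟨ν, hν, Subtype.ext (hK.facet_eq_of_onSide hd h4.1 τ.2 h4.2 hντ h3 h2)⟩

/-! ### The action of the symmetric group -/

/-- Permutation of coordinates. -/
def permMap {d : ℕ} (σ : Equiv.Perm (Fin (d + 1))) (x : Pt (d + 1)) : Pt (d + 1) :=
  fun i => x (σ.symm i)

section Perm

variable {d : ℕ} {div : CpxOp} (σ : Equiv.Perm (Fin (d + 1)))

theorem permMap_corner (j : Fin (d + 1)) : permMap σ (corner d j) = corner d (σ j) := by
  funext i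
  rw [permMap, corner_apply, corner_apply]
  simp [Equiv.symm_apply_eq]

theorem permMap_injective : Function.Injective (permMap σ) := fun x y h => by
  funext i
  have := congrFun h (σ i)
  simpa [permMap] using this

theorem permMap_image_topFace : (topFace d).image (permMap σ) = topFace d := by
  refine Finset.eq_of_subset_of_card_le (fun x hx => ?_) ?_
  · obtain ⟨y, hy, rfl⟩ := Finset.mem_image.1 hx
    obtain ⟨i, -, rfl⟩ := Finset.mem_image.1 hy
    rw [permMap_corner]
    exact corner_mem_topFace _
  · rw [Finset.card_image_of_injective _ (permMap_injective σ)]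

theorem permMap_image_oppFace (j : Fin (d + 1)) :
    (oppFace d j).image (permMap σ) = oppFace d (σ j) := by
  refine Finset.eq_of_subset_of_card_le (fun x hx => ?_) ?_
  · obtain ⟨y, hy, rfl⟩ := Finset.mem_image.1 hx
    obtain ⟨i, -, rfl⟩ := Finset.mem_image.1 (oppFace_subset j hy)
    rw [permMap_corner, corner_mem_oppFace]
    exact fun h => corner_mem_oppFace.1 hy (σ.injective h)
  · rw [Finset.card_image_of_injective _ (permMap_injective σ), card_oppFace, card_oppFace]

theorem isEmb_permMap : IsEmb (stdCpx d) (stdCpx d) (permMap σ) where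
  inj := (permMap_injective σ).injOn
  map s hs := by
    obtain ⟨h1, h2⟩ := mem_faces_stdCpx.1 hs
    refine mem_faces_stdCpx.2 ⟨h1.image _, ?_⟩
    rw [← permMap_image_topFace σ]
    exact Finset.image_subset_image h2

theorem Subdivides.restrictTo_topFace {K : Cpx (d + 1)} (hK : Subdivides K (stdCpx d)) :
    restrictTo K (topFace d) = K := by
  refine Geometry.SimplicialComplex.ext (Set.ext fun s => ?_)
  exact ⟨fun h => h.1, fun h => ⟨h, hK.subset_hull_topFace h⟩⟩

/-- The automorphism of `div Δ_d` that extends `e_j ↦ e_{σ j}`. -/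
noncomputable def autMap (div : CpxOp) (σ : Equiv.Perm (Fin (d + 1))) : Pt (d + 1) → Pt (d + 1) :=
  subdivMap div (stdCpx d) (stdCpx d) (permMap σ)

variable (hdiv : IsInclusionUniform d div)
include hdiv

theorem isEmb_autMap :
    IsEmb (div (d + 1) (stdCpx d)) (div (d + 1) (stdCpx d)) (autMap div σ) :=
  hdiv.isEmb_subdivMap (dimEq_stdCpx d) (dimEq_stdCpx d) (isEmb_permMap σ)

theorem isCornerIso_autMap :
    IsCornerIso (div (d + 1) (stdCpx d)) (corner d) (div (d + 1) (stdCpx d))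
      (fun j => corner d (σ j)) (autMap div σ) := by
  have h := (hdiv.faceIso_subdivMap (dimEq_stdCpx d) (dimEq_stdCpx d) (isEmb_permMap σ)
    (topFace_mem d)).reindex (fun j => ⟨corner d j, corner_mem_topFace j⟩)
  rw [permMap_image_topFace, hdiv.subdivides_std.restrictTo_topFace] at h
  have e : (fun v : topFace d => permMap σ v) ∘ (fun j => ⟨corner d j, corner_mem_topFace j⟩) =
      fun j => corner d (σ j) := funext fun j => permMap_corner σ j
  rw [e] at h
  exact h

theorem eq_autMap_of_isCornerIso {g : Pt (d + 1) → Pt (d + 1)}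
    (hg : IsCornerIso (div (d + 1) (stdCpx d)) (corner d) (div (d + 1) (stdCpx d))
      (fun j => corner d (σ j)) g) {x : Pt (d + 1)}
    (hx : x ∈ (div (d + 1) (stdCpx d)).vertices) : autMap div σ x = g x := by
  choose e he using fun v : topFace d => exists_corner (mem_vertices_of_mem_face (topFace_mem d) v.2)
  have h := hg.reindex e
  have e1 : corner d ∘ e = fun v : topFace d => (v : Pt (d + 1)) := funext he
  have e2 : (fun j => corner d (σ j)) ∘ e = fun v : topFace d => permMap σ v := funext fun v => by
    rw [Function.comp_apply, ← permMap_corner, he]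
  rw [e1, e2] at h
  refine hdiv.subdivMap_eq (dimEq_stdCpx d) (dimEq_stdCpx d) (isEmb_permMap σ) (topFace_mem d) ?_ hx
    (by simpa using hdiv.subdivides_std.subset_hull_topFace hx)
  rw [FaceIso, permMap_image_topFace, hdiv.subdivides_std.restrictTo_topFace]
  exact h

/-- The geometric clause for the face opposite to `e_j`, which goes to the face opposite to `e_{σ
j}`. It makes the action permute the boundary sets. -/
theorem autMap_apply_eq_zero_iff {x : Pt (d + 1)}
    (hx : x ∈ (div (d + 1) (stdCpx d)).vertices) (j : Fin (d + 1)) :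
    autMap div σ x (σ j) = 0 ↔ x j = 0 := by
  have h1 := hdiv.faceIso_subdivMap (dimEq_stdCpx d) (dimEq_stdCpx d) (isEmb_permMap σ)
    (topFace_mem d)
  have h2 : x ∈ convexHull ℝ (topFace d : Set (Pt (d + 1))) :=
    hdiv.subdivides_std.subset_hull_topFace hx (by simp)
  have h3 := h1.mem_hull_iff (oppFace_subset j) hx h2
  have h4 := (h1.mapsTo hx h2).2
  rw [permMap_image_topFace] at h4
  rw [permMap_image_oppFace, mem_hull_oppFace, mem_hull_oppFace] at h3
  exact ⟨fun h => (h3.2 ⟨h4, h⟩).2, fun h => (h3.1 ⟨h2, h⟩).2⟩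

theorem image_autMap_mem {τ : Finset (Pt (d + 1))} (hτ : τ ∈ Faces (div (d + 1) (stdCpx d)) d) :
    τ.image (autMap div σ) ∈ Faces (div (d + 1) (stdCpx d)) d := by
  refine ⟨(isEmb_autMap σ hdiv).map τ hτ.1, ?_⟩
  rw [Finset.card_image_of_injOn ((isEmb_autMap σ hdiv).injOn hτ.1), hτ.2]

omit σ in
/-- The action of the symmetric group on the facets of `div Δ_d`. -/
noncomputable def facetAct : Equiv.Perm (Fin (d + 1)) →* Equiv.Perm (Facet d div) :=
  MonoidHom.toHomPerm
    { toFun := fun σ τ => ⟨τ.1.image (autMap div σ), image_autMap_mem σ hdiv τ.2⟩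
      map_one' := by
        funext τ
        refine Subtype.ext ?_
        change τ.1.image (autMap div 1) = τ.1
        conv_rhs => rw [← Finset.image_id (s := τ.1)]
        exact Finset.image_congr fun x hx =>
          hdiv.subdivMap_id (dimEq_stdCpx d) (mem_vertices_of_mem_face τ.2.1 hx)
      map_mul' := by
        intro σ σ'
        funext τ
        refine Subtype.ext ?_
        change τ.1.image (autMap div (σ * σ')) = (τ.1.image (autMap div σ')).image (autMap div σ)
        rw [Finset.image_image]
        exact Finset.image_congr fun x hx =>
          hdiv.subdivMap_comp (dimEq_stdCpx d) (dimEq_stdCpx d) (dimEq_stdCpx d)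
            (isEmb_permMap σ') (isEmb_permMap σ) (mem_vertices_of_mem_face τ.2.1 hx) }

theorem coe_facetAct (τ : Facet d div) :
    (facetAct hdiv σ τ).1 = τ.1.image (autMap div σ) := rfl

theorem image_autMap_erase {τ : Facet d div} {v : Pt (d + 1)} (hv : v ∈ τ.1) :
    (τ.1.erase v).image (autMap div σ) = (τ.1.image (autMap div σ)).erase (autMap div σ v) := by
  have hinj := (isEmb_autMap σ hdiv).injOn τ.2.1
  ext y
  simp only [Finset.mem_image, Finset.mem_erase]
  constructor
  · rintro ⟨x, ⟨h1, h2⟩, rfl⟩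
    exact ⟨fun h => h1 (hinj h2 hv h), x, h2, rfl⟩
  · rintro ⟨h1, x, h2, rfl⟩
    exact ⟨x, ⟨fun h => h1 (by rw [h]), h2⟩, rfl⟩

theorem image_autMap_inter (τ τ' : Facet d div) :
    (τ.1 ∩ τ'.1).image (autMap div σ) =
      τ.1.image (autMap div σ) ∩ τ'.1.image (autMap div σ) := by
  refine Finset.image_inter_of_injOn _ _ ((isEmb_autMap σ hdiv).inj.mono ?_)
  rintro x (hx | hx)
  exacts [mem_vertices_of_mem_face τ.2.1 hx, mem_vertices_of_mem_face τ'.2.1 hx]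

theorem facetAct_adj (hd : 1 ≤ d) {τ τ' : Facet d div} (h : (divGraph d div).Adj τ τ') :
    (divGraph d div).Adj (facetAct hdiv σ τ) (facetAct hdiv σ τ') := by
  obtain ⟨h1, h2⟩ := (dualGraph_adj hd).1 h
  refine (dualGraph_adj hd).2 ⟨fun he => h1 ((facetAct hdiv σ).injective he), ?_⟩
  rw [coe_facetAct, coe_facetAct, ← image_autMap_inter σ hdiv,
    Finset.card_image_of_injOn (((isEmb_autMap σ hdiv).injOn τ.2.1).mono ?_), h2]
  exact Finset.coe_subset.2 Finset.inter_subset_left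

theorem facetAct_mem_bdry (hd : 1 ≤ d) {τ : Facet d div} {j : Fin (d + 1)}
    (h : τ ∈ divBdry d div j) : facetAct hdiv σ τ ∈ divBdry d div (σ j) := by
  obtain ⟨v, hv, hj⟩ := (mem_divBdry hd hdiv).1 h
  refine (mem_divBdry hd hdiv).2 ⟨autMap div σ v, ?_, fun x hx => ?_⟩
  · rw [coe_facetAct]
    exact Finset.mem_image_of_mem _ hv
  · rw [coe_facetAct, ← image_autMap_erase σ hdiv hv] at hx
    obtain ⟨y, hy, rfl⟩ := Finset.mem_image.1 hx
    rw [autMap_apply_eq_zero_iff σ hdiv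
      (mem_vertices_of_mem_face τ.2.1 (Finset.mem_of_mem_erase hy))]
    exact hj y hy

theorem facetAct_image_bdry (hd : 1 ≤ d) (j : Fin (d + 1)) :
    facetAct hdiv σ '' divBdry d div j = divBdry d div (σ j) := by
  refine Set.Subset.antisymm ?_ fun τ hτ => ?_
  · rintro _ ⟨τ, hτ, rfl⟩
    exact facetAct_mem_bdry σ hdiv hd hτ
  · refine ⟨facetAct hdiv σ⁻¹ τ, ?_, ?_⟩
    · have := facetAct_mem_bdry σ⁻¹ hdiv hd hτ
      simpa using this
    · rw [map_inv]
      simp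

/-- The graph `Γ^{(d)}(div Δ_d)` with its action and a labelling. -/
noncomputable def divLabelledGraph (hd : 1 ≤ d)
    {kappa : Facet d div → Facet d div → Fin (d + 1)}
    (hk : IsLabelling (divGraph d div) (divBdry d div) kappa) :
    LabelledGraph d (fNum div (d - 1)) (Facet d div) where
  graph := divGraph d div
  act := facetAct hdiv
  act_adj σ _ _ h := facetAct_adj σ hdiv hd h
  bdry := divBdry d div
  bdry_card := divBdry_ncard hd hdiv
  degree_add := divGraph_degree_add hd hdiv
  bdry_swap i j := by rw [facetAct_image_bdry _ hdiv hd, Equiv.swap_apply_right]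
  bdry_stab i σ h := by rw [facetAct_image_bdry _ hdiv hd, h]
  kappa := kappa
  isLabelling := hk

end Perm

/-! ### Labelling the vertices of facets -/

/-- Bijectivity forces the one remaining value. So `ρ` is determined by what it does off the label
of the common ridge. -/
theorem perm_eq_of_eq_off {α : Type*} {r r' : Equiv.Perm α} {c : α}
    (h : ∀ i, i ≠ c → r i = r' i) : r = r' := by
  refine Equiv.ext fun i => ?_
  by_cases hi : i = c
  · subst hi
    by_contra hne
    have h1 : r'.symm (r i) ≠ i := fun h => hne ((Equiv.symm_apply_eq r').1 h)
    have h2 := h _ h1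
    rw [Equiv.apply_symm_apply] at h2
    exact h1 (r.injective h2)
  · exact h i hi

/-- `vt τ i` is the vertex of the facet `τ` opposite to the ridge with label `i`. -/
structure IsVertexLabelling {d : ℕ} {div : CpxOp}
    (kappa : Facet d div → Facet d div → Fin (d + 1))
    (vt : Facet d div → Fin (d + 1) → Pt (d + 1)) : Prop where
  mem : ∀ τ i, vt τ i ∈ τ.1
  inj : ∀ τ, Function.Injective (vt τ)
  hasLabel : ∀ τ i, HasLabel kappa τ (τ.1.erase (vt τ i)) i
  unique : ∀ τ, ∀ v ∈ τ.1, ∀ i, HasLabel kappa τ (τ.1.erase v) i → v = vt τ i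

section Labels

variable {d : ℕ} {div : CpxOp} {kappa : Facet d div → Facet d div → Fin (d + 1)}
  {vt : Facet d div → Fin (d + 1) → Pt (d + 1)}

theorem IsVertexLabelling.image_univ (hvt : IsVertexLabelling kappa vt) (τ : Facet d div) :
    Finset.univ.image (vt τ) = τ.1 := by
  refine Finset.eq_of_subset_of_card_le (fun x hx => ?_) ?_
  · obtain ⟨i, -, rfl⟩ := Finset.mem_image.1 hx
    exact hvt.mem τ i
  · rw [Finset.card_image_of_injective _ (hvt.inj τ), τ.2.2]
    simp

theorem IsVertexLabelling.surj (hvt : IsVertexLabelling kappa vt) {τ : Facet d div}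
    {v : Pt (d + 1)} (hv : v ∈ τ.1) : ∃ i, vt τ i = v := by
  rw [← hvt.image_univ τ] at hv
  obtain ⟨i, -, hi⟩ := Finset.mem_image.1 hv
  exact ⟨i, hi⟩

/-- Each ridge is either the intersection with exactly one neighbour or lies in exactly one side, so
labels of edges and loops are labels of ridges, hence of opposite vertices. -/
theorem exists_isVertexLabelling (hd : 1 ≤ d) (hdiv : IsInclusionUniform d div)
    (hk : IsLabelling (divGraph d div) (divBdry d div) kappa) :
    ∃ vt, IsVertexLabelling kappa vt := by
  have hK := hdiv.subdivides_std
  have hcard : ∀ {τ : Facet d div} {v}, v ∈ τ.1 → (τ.1.erase v).card = d := fun {τ v} hv => by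
    rw [Finset.card_erase_of_mem hv, τ.2.2]
    rfl
  have hex : ∀ (τ : Facet d div) (x : Fin (d + 1)),
      ∃ v ∈ τ.1, HasLabel kappa τ (τ.1.erase v) x := by
    intro τ x
    by_cases hx : τ ∈ divBdry d div x
    · obtain ⟨v, hv, h⟩ := (mem_divBdry hd hdiv).1 hx
      exact ⟨v, hv, Or.inr ⟨(erase_mem_sideFaces hd hdiv hv).2 h, Finset.erase_subset _ _⟩⟩
    · obtain ⟨τ', hτ', e⟩ := (hk τ).surjOn hx
      obtain ⟨v, hv, he, -⟩ := exists_inter_eq_erase hd hτ'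
      exact ⟨v, hv, Or.inl ⟨τ', hτ', he.symm, e⟩⟩
  choose vt hmem hlab using hex
  -- A ridge shared with a neighbour lies in no side, so the two clauses of `HasLabel` exclude each
  -- other.
  have hns : ∀ {τ τ' : Facet d div} {v} {j : Fin (d + 1)}, v ∈ τ.1 → (divGraph d div).Adj τ τ' →
      τ.1.erase v = τ.1 ∩ τ'.1 → ¬∀ x ∈ τ.1.erase v, x j = 0 := by
    intro τ τ' v j hv hadj he hj
    refine ((dualGraph_adj hd).1 hadj).1 (Subtype.ext ?_)
    refine hK.facet_eq_of_onSide hd τ.2 τ'.2 (Finset.erase_subset v _) ?_ (hcard hv) hj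
    rw [he]
    exact Finset.inter_subset_right
  refine ⟨vt, hmem, fun τ x y hxy => ?_, hlab, fun τ v hv x hx => ?_⟩
  · have h1 := hlab τ x
    have h2 := hlab τ y
    have hv := hmem τ x
    rw [← hxy] at h2
    rcases h1 with ⟨τ₁, ha₁, he₁, hx⟩ | ⟨hs₁, -⟩
    · rcases h2 with ⟨τ₂, ha₂, he₂, hy⟩ | ⟨hs₂, -⟩
      · have : τ₁ = τ₂ := by
          refine Subtype.ext (hK.facet_eq_of_ne hd τ.2 τ₁.2 τ₂.2 hv ?_ ?_ ?_ ?_)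
          · rw [he₁]
            exact Finset.inter_subset_right
          · rw [he₂]
            exact Finset.inter_subset_right
          · exact fun h => ((dualGraph_adj hd).1 ha₁).1 (Subtype.ext h.symm)
          · exact fun h => ((dualGraph_adj hd).1 ha₂).1 (Subtype.ext h.symm)
        rw [← hx, ← hy, this]
      · exact absurd ((mem_sideFaces hd hdiv).1 hs₂).2.1 (hns hv ha₁ he₁)
    · rcases h2 with ⟨τ₂, ha₂, he₂, hy⟩ | ⟨hs₂, -⟩
      · exact absurd ((mem_sideFaces hd hdiv).1 hs₁).2.1 (hns hv ha₂ he₂)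
      · exact hK.side_unique τ.2 ((mem_sideFaces hd hdiv).1 hs₁).2.1
          ((mem_sideFaces hd hdiv).1 hs₂).2.1
  · have hmx := hmem τ x
    suffices h : τ.1.erase v = τ.1.erase (vt τ x) from
      (Finset.erase_inj τ.1 hv).1 h
    have hbd : ∀ {w}, w ∈ τ.1 → τ.1.erase w ∈ sideFaces d div x → τ ∈ divBdry d div x :=
      fun hw h => ⟨_, h, Finset.erase_subset _ _⟩
    rcases hx with ⟨τ₁, ha₁, he₁, hx⟩ | ⟨hs₁, -⟩
    · rcases hlab τ x with ⟨τ₂, ha₂, he₂, hy⟩ | ⟨hs₂, -⟩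
      · rw [he₁, he₂, (hk τ).injOn ha₁ ha₂ (hx.trans hy.symm)]
      · have := (hk τ).mapsTo ha₁
        rw [hx] at this
        exact absurd (hbd hmx hs₂) this
    · rcases hlab τ x with ⟨τ₂, ha₂, he₂, hy⟩ | ⟨hs₂, -⟩
      · have := (hk τ).mapsTo ha₂
        rw [hy] at this
        exact absurd (hbd hv hs₁) this
      · exact hK.ridge_eq_of_onSide τ.2 (Finset.erase_subset _ _) (Finset.erase_subset _ _)
          (hcard hv) (hcard hmx) ((mem_sideFaces hd hdiv).1 hs₁).2.1
          ((mem_sideFaces hd hdiv).1 hs₂).2.1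

theorem IsVertexLabelling.inter_eq_erase (hvt : IsVertexLabelling kappa vt) (hd : 1 ≤ d)
    {τ τ' : Facet d div} (h : (divGraph d div).Adj τ τ') :
    τ.1 ∩ τ'.1 = τ.1.erase (vt τ (kappa τ τ')) ∧ vt τ (kappa τ τ') ∉ τ'.1 := by
  obtain ⟨v, hv, he, hv'⟩ := exists_inter_eq_erase hd h
  rw [← hvt.unique τ v hv _ (Or.inl ⟨τ', h, he.symm, rfl⟩)]
  exact ⟨he, hv'⟩

theorem IsVertexLabelling.mem_iff (hvt : IsVertexLabelling kappa vt) (hd : 1 ≤ d)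
    {τ τ' : Facet d div} (h : (divGraph d div).Adj τ τ') {i : Fin (d + 1)} :
    vt τ i ∈ τ'.1 ↔ i ≠ kappa τ τ' := by
  obtain ⟨h1, h2⟩ := hvt.inter_eq_erase hd h
  constructor
  · rintro hi rfl
    exact h2 hi
  · intro hi
    have : vt τ i ∈ τ.1 ∩ τ'.1 := by
      rw [h1]
      exact Finset.mem_erase.2 ⟨fun e => hi (hvt.inj τ e), hvt.mem τ i⟩
    exact (Finset.mem_inter.1 this).2

theorem HasLabel.exists_erase (hd : 1 ≤ d) (hdiv : IsInclusionUniform d div) {τ : Facet d div}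
    {ν : Finset (Pt (d + 1))} {x : Fin (d + 1)} (h : HasLabel kappa τ ν x) :
    ∃ v ∈ τ.1, ν = τ.1.erase v := by
  rcases h with ⟨τ', ha, he, -⟩ | ⟨hs, hsub⟩
  · obtain ⟨v, hv, he', -⟩ := exists_inter_eq_erase hd ha
    exact ⟨v, hv, he.trans he'⟩
  · exact exists_eq_erase hsub ((mem_sideFaces hd hdiv).1 hs).2.2 τ.2.2

/-! ### The permutations `ν` and `ρ` in terms of vertices -/

/-- The geometric meaning of `ν`: the automorphism carries edges to edges and ridges in sides to
ridges in sides just as `σ_*` does, so it transports labels of ridges and of opposite vertices by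
`ν`. -/
theorem IsVertexLabelling.nu_apply (hvt : IsVertexLabelling kappa vt)
    (hdiv : IsInclusionUniform d div) {n : ℕ} (D : LabelledGraph d n (Facet d div))
    (hg : D.graph = divGraph d div) (hb : D.bdry = divBdry d div) (hkap : D.kappa = kappa)
    (ha : ∀ σ (τ : Facet d div), (D.act σ τ).1 = τ.1.image (autMap div σ))
    (σ : Equiv.Perm (Fin (d + 1))) (τ : Facet d div) (i : Fin (d + 1)) :
    vt (D.act σ τ) (D.nu σ τ i) = autMap div σ (vt τ i) := by
  symm
  refine hvt.unique _ _ ?_ _ ?_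
  · rw [ha]
    exact Finset.mem_image_of_mem _ (hvt.mem τ i)
  rw [ha, ← image_autMap_erase σ hdiv (hvt.mem τ i)]
  change HasLabel kappa (D.act σ τ) _ (D.nuFun σ τ i)
  rcases hvt.hasLabel τ i with ⟨τ', hadj, he, hi⟩ | ⟨hs, hsub⟩
  · rw [← hg] at hadj
    refine Or.inl ⟨D.act σ τ', ?_, ?_, ?_⟩
    · rw [← hg]
      exact D.act_adj σ _ _ hadj
    · rw [he, ha, ha, image_autMap_inter σ hdiv]
    · rw [← hi, ← hkap, D.nuFun_kappa σ hadj]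
  · have hτ : τ ∈ D.bdry i := by
      rw [hb]
      exact ⟨_, hs, hsub⟩
    rw [D.nuFun_loop σ hτ]
    refine Or.inr ⟨?_, ?_⟩
    · have hE := isEmb_autMap σ hdiv
      obtain ⟨⟨h2, h3⟩, h4⟩ := hs
      refine ⟨⟨hE.map _ h2, ?_⟩, ?_⟩
      · refine (hdiv.subdivides_std.subset_hull_oppFace_iff (hE.map _ h2)).2 fun x hx => ?_
        obtain ⟨y, hy, rfl⟩ := Finset.mem_image.1 hx
        rw [autMap_apply_eq_zero_iff σ hdiv (mem_vertices_of_mem_face h2 hy)]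
        exact (hdiv.subdivides_std.subset_hull_oppFace_iff h2).1 h3 y hy
      · rw [Finset.card_image_of_injOn (hE.injOn h2), h4]
    · rw [ha]
      exact Finset.image_subset_image hsub

theorem IsVertexLabelling.rho_unique (hvt : IsVertexLabelling kappa vt) (hd : 1 ≤ d)
    {τ τ' : Facet d div} (h : (divGraph d div).Adj τ τ') {r r' : Equiv.Perm (Fin (d + 1))}
    (hr : ∀ i i', vt τ i = vt τ' i' → r i = i') (hr' : ∀ i i', vt τ i = vt τ' i' → r' i = i') :
    r = r' := by
  refine perm_eq_of_eq_off (c := kappa τ τ') fun i hi => ?_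
  obtain ⟨i', hi'⟩ := hvt.surj ((hvt.mem_iff hd h).2 hi)
  rw [hr i i' hi'.symm, hr' i i' hi'.symm]

/-- Adjacent facets share all vertices except the one opposite to the common ridge in each; `ρ`
matches the labels of shared vertices and the two remaining labels with each other. -/
theorem IsVertexLabelling.exists_rho (hvt : IsVertexLabelling kappa vt) (hd : 1 ≤ d)
    {τ τ' : Facet d div} (h : (divGraph d div).Adj τ τ') :
    ∃ r : Equiv.Perm (Fin (d + 1)), (∀ i i', vt τ i = vt τ' i' → r i = i') ∧
      r (kappa τ τ') = kappa τ' τ := by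
  have hex : ∀ i, ∃ i', (i = kappa τ τ' → i' = kappa τ' τ) ∧
      (i ≠ kappa τ τ' → vt τ' i' = vt τ i) := by
    intro i
    by_cases hi : i = kappa τ τ'
    · exact ⟨_, fun _ => rfl, fun h => absurd hi h⟩
    · obtain ⟨i', hi'⟩ := hvt.surj ((hvt.mem_iff hd h).2 hi)
      exact ⟨i', fun h => absurd h hi, fun _ => hi'⟩
  choose f hf1 hf2 using hex
  have hne : ∀ i, i ≠ kappa τ τ' → f i ≠ kappa τ' τ := fun i hi =>
    (hvt.mem_iff hd h.symm).1 (by rw [hf2 i hi]; exact hvt.mem τ i)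
  have hinj : Function.Injective f := by
    intro i j hij
    by_cases hi : i = kappa τ τ'
    · by_cases hj : j = kappa τ τ'
      · rw [hi, hj]
      · exact absurd (hij.symm.trans (hf1 i hi)) (hne j hj)
    · by_cases hj : j = kappa τ τ'
      · exact absurd (hij.trans (hf1 j hj)) (hne i hi)
      · refine hvt.inj τ ?_
        rw [← hf2 i hi, ← hf2 j hj, hij]
  refine ⟨Equiv.ofBijective f (Finite.injective_iff_bijective.1 hinj), fun i i' hii' => ?_,
    hf1 _ rfl⟩
  have hi : i ≠ kappa τ τ' := (hvt.mem_iff hd h).1 (by rw [hii']; exact hvt.mem τ' i')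
  refine hvt.inj τ' ?_
  rw [Equiv.ofBijective_apply, hf2 i hi, hii']

/-- The faces `τ.erase v` and `τ'.erase v'` match along `τ ∩ τ'` only if `v = v'`. -/
theorem vertex_eq_of_matching (hd : 1 ≤ d) {τ τ' : Facet d div} (h : (divGraph d div).Adj τ τ')
    {v v' : Pt (d + 1)} (hv : v ∈ τ.1) (hv' : v' ∈ τ'.1) (hne : τ.1.erase v ≠ τ.1 ∩ τ'.1)
    (hne' : τ'.1.erase v' ≠ τ.1 ∩ τ'.1) (hc : (τ.1.erase v ∩ τ'.1.erase v').card = d - 1) :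
    v = v' := by
  have hI := ((dualGraph_adj hd).1 h).2
  have key : ∀ {σ σ' : Facet d div} {w}, (divGraph d div).Adj σ σ' → w ∈ σ.1 →
      σ.1.erase w ≠ σ.1 ∩ σ'.1 → w ∈ σ'.1 := by
    intro σ σ' w hs hw hn
    obtain ⟨u, hu, he, -⟩ := exists_inter_eq_erase hd hs
    by_contra hw'
    have : w ∉ σ.1.erase u := fun hmem => hw' (Finset.mem_inter.1 (he ▸ hmem)).2
    have hwu : w = u := by
      by_contra hwu
      exact this (Finset.mem_erase.2 ⟨hwu, hw⟩)
    exact hn (by rw [he, hwu])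
  have hvτ' := key h hv hne
  have hvτ := key h.symm hv' (by rwa [Finset.inter_comm])
  by_contra hvv
  -- Distinct `v`, `v'` would both be missing from the `d`-element set `τ ∩ τ'`, leaving at most `d
  -- - 2` common vertices.
  have hsub : τ.1.erase v ∩ τ'.1.erase v' ⊆ ((τ.1 ∩ τ'.1).erase v).erase v' := by
    intro x hx
    simp only [Finset.mem_inter, Finset.mem_erase] at hx ⊢
    tauto
  have h1 := Finset.card_le_card hsub
  have h2 : v' ∈ (τ.1 ∩ τ'.1).erase v :=
    Finset.mem_erase.2 ⟨Ne.symm hvv, Finset.mem_inter.2 ⟨hvτ, hv'⟩⟩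
  have h3 := Finset.card_pos.2 ⟨v', h2⟩
  rw [Finset.card_erase_of_mem h2] at h1
  rw [Finset.card_erase_of_mem (Finset.mem_inter.2 ⟨hv, hvτ'⟩), hI] at h1 h3
  omega

/-- Both identities for `ρ` follow from `rho_unique`: inverses and conjugates by `ν` again match the
labels of shared vertices, the latter by `nu_apply`. -/
theorem exists_fractalData (hd : 1 ≤ d) (hdiv : IsInclusionUniform d div)
    (hk : IsLabelling (divGraph d div) (divBdry d div) kappa) :
    ∃ D : FractalData d (fNum div (d - 1)) (Facet d div), IsDivData D ∧ D.kappa = kappa := by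
  classical
  obtain ⟨vt, hvt⟩ := exists_isVertexLabelling hd hdiv hk
  have hex : ∀ τ τ' : Facet d div, ∃ r : Equiv.Perm (Fin (d + 1)), (divGraph d div).Adj τ τ' →
      (∀ i i', vt τ i = vt τ' i' → r i = i') ∧ r (kappa τ τ') = kappa τ' τ := by
    intro τ τ'
    by_cases h : (divGraph d div).Adj τ τ'
    · obtain ⟨r, hr⟩ := hvt.exists_rho hd h
      exact ⟨r, fun _ => hr⟩
    · exact ⟨1, fun h' => absurd h' h⟩
  choose rho hrho using hex
  let D₀ := divLabelledGraph hdiv hd hk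
  have hnu := hvt.nu_apply hdiv D₀ rfl rfl rfl fun σ τ => coe_facetAct σ hdiv τ
  refine ⟨{ D₀ with
    rho := rho
    rho_kappa := fun τ τ' h => (hrho τ τ' h).2
    rho_symm := fun τ τ' h => ?_
    rho_act := fun σ τ τ' h => ?_ }, ⟨rfl, rfl, fun σ g hg τ => ?_, ?_⟩, rfl⟩
  · have h : (divGraph d div).Adj τ τ' := h
    refine hvt.rho_unique hd h.symm (hrho τ' τ h.symm).1 fun i i' hi => ?_
    rw [Equiv.Perm.inv_eq_iff_eq, (hrho τ τ' h).1 i' i hi.symm]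
  · have h : (divGraph d div).Adj τ τ' := h
    refine hvt.rho_unique hd (facetAct_adj σ hdiv hd h)
      (hrho _ _ (facetAct_adj σ hdiv hd h)).1 fun a b hab => ?_
    obtain ⟨i, rfl⟩ := (D₀.nu σ τ).surjective a
    obtain ⟨i', rfl⟩ := (D₀.nu σ τ').surjective b
    have hab : vt (D₀.act σ τ) (D₀.nu σ τ i) = vt (D₀.act σ τ') (D₀.nu σ τ' i') := hab
    rw [hnu, hnu] at hab
    have hii := (isEmb_autMap σ hdiv).inj (mem_vertices_of_mem_face τ.2.1 (hvt.mem τ i))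
      (mem_vertices_of_mem_face τ'.2.1 (hvt.mem τ' i')) hab
    change D₀.nu σ τ' (rho τ τ' ((D₀.nu σ τ)⁻¹ (D₀.nu σ τ i))) = D₀.nu σ τ' i'
    rw [show (D₀.nu σ τ)⁻¹ (D₀.nu σ τ i) = i from Equiv.Perm.inv_eq_iff_eq.2 rfl, (hrho τ τ' h).1 i i' hii]
  · change τ.1.image (autMap div σ) = τ.1.image g
    exact Finset.image_congr fun x hx =>
      eq_autMap_of_isCornerIso σ hdiv hg (mem_vertices_of_mem_face τ.2.1 hx)
  · intro τ τ' h ν ν' x y hx hy hne hne' hc hsub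
    obtain ⟨v, hv, rfl⟩ := hx.exists_erase hd hdiv
    obtain ⟨v', hv', rfl⟩ := hy.exists_erase hd hdiv
    have hvv := vertex_eq_of_matching hd h hv hv' hne hne' hc
    refine (hrho τ τ' h).1 x y ?_
    rw [← hvt.unique τ v hv x hx, ← hvt.unique τ' v' hv' y hy, hvv]

/-- The ridges opposite to a shared vertex `v` meet in `(τ ∩ τ')` without `v`, so they are matched
by the defining condition on `ρ`. This holds for arbitrary data, not only for those constructed
above. -/
theorem IsDivData.rho_vertex (hd : 1 ≤ d)
    {D : FractalData d (fNum div (d - 1)) (Facet d div)} (hD : IsDivData D)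
    (hvt : IsVertexLabelling D.kappa vt) {τ τ' : Facet d div} (h : (divGraph d div).Adj τ τ')
    {i i' : Fin (d + 1)} (hi : vt τ i = vt τ' i') : D.rho τ τ' i = i' := by
  have h1 : vt τ i ∈ τ'.1 := by
    rw [hi]
    exact hvt.mem τ' i'
  have h2 : vt τ i ∈ τ.1 ∩ τ'.1 := Finset.mem_inter.2 ⟨hvt.mem τ i, h1⟩
  have hlab' := hvt.hasLabel τ' i'
  rw [← hi] at hlab'
  have e : τ.1.erase (vt τ i) ∩ τ'.1.erase (vt τ i) = (τ.1 ∩ τ'.1).erase (vt τ i) := by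
    ext x
    simp only [Finset.mem_inter, Finset.mem_erase]
    tauto
  refine hD.rho_eq τ τ' h _ _ i i' (hvt.hasLabel τ i) hlab' (fun he => ?_) (fun he => ?_) ?_ ?_
  · rw [← he] at h2
    simp at h2
  · rw [← he] at h2
    simp at h2
  · rw [e, Finset.card_erase_of_mem h2, ((dualGraph_adj hd).1 h).2]
  · rw [e]
    exact Finset.erase_subset _ _

end Labels

/-! ### Cells of an iterated subdivision -/

/-- The linear map with `e_i ↦ p i`. -/
noncomputable def cornerMap {d : ℕ} (p : Fin (d + 1) → Pt (d + 1)) (x : Pt (d + 1)) :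
    Pt (d + 1) := ∑ i, x i • p i

theorem cornerMap_corner {d : ℕ} (p : Fin (d + 1) → Pt (d + 1)) (i : Fin (d + 1)) :
    cornerMap p (corner d i) = p i := by
  simp [cornerMap, corner_apply]

section Cells

variable {d : ℕ} {div : CpxOp} {kappa : Facet d div → Facet d div → Fin (d + 1)}
  {vt : Facet d div → Fin (d + 1) → Pt (d + 1)}

/-- The map from `div^k Δ_d` onto the part of `div^{k+1} Δ_d` inside the facet of `div Δ_d` with
vertices `p i`. -/
noncomputable def cellMap (div : CpxOp) (k : ℕ) (p : Fin (d + 1) → Pt (d + 1)) :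
    Pt (d + 1) → Pt (d + 1) :=
  iterMap div k (stdCpx d) (div (d + 1) (stdCpx d)) (cornerMap p)

/-- The automorphism of `div^k Δ_d` that extends `e_j ↦ e_{σ j}`. -/
noncomputable def iterAut (div : CpxOp) (k : ℕ) (σ : Equiv.Perm (Fin (d + 1))) :
    Pt (d + 1) → Pt (d + 1) :=
  iterMap div k (stdCpx d) (stdCpx d) (permMap σ)

namespace IsVertexLabelling

variable (hvt : IsVertexLabelling kappa vt)
include hvt

theorem image_topFace (τ : Facet d div) : (topFace d).image (cornerMap (vt τ)) = τ.1 := by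
  rw [topFace, Finset.image_image, ← hvt.image_univ τ]
  exact Finset.image_congr fun i _ => cornerMap_corner _ i

theorem image_oppFace (τ : Facet d div) (j : Fin (d + 1)) :
    (oppFace d j).image (cornerMap (vt τ)) = τ.1.erase (vt τ j) := by
  have h : (oppFace d j).image (cornerMap (vt τ)) = (Finset.univ.erase j).image (vt τ) := by
    rw [oppFace, Finset.image_image]
    exact Finset.image_congr fun i _ => cornerMap_corner _ i
  rw [h, Finset.image_erase (hvt.inj τ), hvt.image_univ τ]

theorem isEmb_cornerMap (τ : Facet d div) :
    IsEmb (stdCpx d) (div (d + 1) (stdCpx d)) (cornerMap (vt τ)) where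
  inj x hx y hy h := by
    obtain ⟨i, rfl⟩ := exists_corner hx
    obtain ⟨j, rfl⟩ := exists_corner hy
    rw [cornerMap_corner, cornerMap_corner] at h
    rw [hvt.inj τ h]
  map s hs := by
    obtain ⟨h1, h2⟩ := mem_faces_stdCpx.1 hs
    refine (div (d + 1) (stdCpx d)).down_closed τ.2.1 ?_ (h1.image _)
    rw [← hvt.image_topFace τ]
    exact Finset.image_subset_image h2

variable (hdiv : IsInclusionUniform d div) (k : ℕ)
include hdiv

theorem isEmb_cellMap (τ : Facet d div) :
    IsEmb ((div (d + 1))^[k] (stdCpx d)) ((div (d + 1))^[k + 1] (stdCpx d))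
      (cellMap div k (vt τ)) :=
  hdiv.isEmb_iterMap (dimEq_stdCpx d) (hdiv.dimEq (dimEq_stdCpx d)) (hvt.isEmb_cornerMap τ) k

theorem cellMap_subset_hull (τ : Facet d div) {s : Finset (Pt (d + 1))}
    (hs : s ∈ ((div (d + 1))^[k] (stdCpx d)).faces) :
    ((s.image (cellMap div k (vt τ)) : Finset (Pt (d + 1))) : Set (Pt (d + 1))) ⊆
      convexHull ℝ (τ.1 : Set (Pt (d + 1))) := by
  have h := hdiv.subset_hull_iterMap_iff (dimEq_stdCpx d) (hdiv.dimEq (dimEq_stdCpx d))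
    (hvt.isEmb_cornerMap τ) (topFace_mem d) k hs
  rw [hvt.image_topFace] at h
  exact h.1 ((hdiv.iter_subdivides (dimEq_stdCpx d) k).subset_hull_topFace hs)

theorem cellMap_surj (τ : Facet d div) {t : Finset (Pt (d + 1))}
    (ht : t ∈ ((div (d + 1))^[k + 1] (stdCpx d)).faces)
    (htτ : (t : Set (Pt (d + 1))) ⊆ convexHull ℝ (τ.1 : Set (Pt (d + 1)))) :
    ∃ s ∈ ((div (d + 1))^[k] (stdCpx d)).faces, s.image (cellMap div k (vt τ)) = t := by
  have h := hdiv.iterMap_surj (dimEq_stdCpx d) (hdiv.dimEq (dimEq_stdCpx d))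
    (hvt.isEmb_cornerMap τ) (topFace_mem d) k ht (by rwa [hvt.image_topFace])
  obtain ⟨s, hs, -, e⟩ := h
  exact ⟨s, hs, e⟩

theorem cellMap_onSide_iff (hd : 1 ≤ d) (τ : Facet d div) {s : Finset (Pt (d + 1))}
    (hs : s ∈ ((div (d + 1))^[k] (stdCpx d)).faces) (j : Fin (d + 1)) :
    (∀ x ∈ s, x j = 0) ↔
      ((s.image (cellMap div k (vt τ)) : Finset (Pt (d + 1))) : Set (Pt (d + 1))) ⊆
        convexHull ℝ (τ.1.erase (vt τ j) : Set (Pt (d + 1))) := by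
  have h := hdiv.subset_hull_iterMap_iff (dimEq_stdCpx d) (hdiv.dimEq (dimEq_stdCpx d))
    (hvt.isEmb_cornerMap τ) (oppFace_mem hd j) k hs
  rw [hvt.image_oppFace,
    (hdiv.iter_subdivides (dimEq_stdCpx d) k).subset_hull_oppFace_iff hs] at h
  exact h

theorem cellMap_image_card (τ : Facet d div) {s : Finset (Pt (d + 1))}
    (hs : s ∈ ((div (d + 1))^[k] (stdCpx d)).faces) :
    (s.image (cellMap div k (vt τ))).card = s.card :=
  Finset.card_image_of_injOn ((hvt.isEmb_cellMap hdiv k τ).injOn hs)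

/-- The two parametrizations of the common side of adjacent cells differ by the permutation that
identifies the common vertices. -/
theorem cellMap_eq_of_adj (hd : 1 ≤ d) {τ τ' : Facet d div} (h : (divGraph d div).Adj τ τ')
    {r : Equiv.Perm (Fin (d + 1))} (hr : ∀ i i', vt τ i = vt τ' i' → r i = i')
    {x : Pt (d + 1)} (hx : x ∈ ((div (d + 1))^[k] (stdCpx d)).vertices)
    (hx0 : x (kappa τ τ') = 0) :
    cellMap div k (vt τ) x = cellMap div k (vt τ') (iterAut div k r x) := by
  have hΔ := dimEq_stdCpx d
  refine Eq.trans ?_ (hdiv.iterMap_comp hΔ hΔ (hdiv.dimEq hΔ) (isEmb_permMap r)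
    (hvt.isEmb_cornerMap τ') k hx)
  -- The embeddings of `Δ_d` onto `τ` and, after permuting corners by `r`, onto `τ'` agree on the
  -- side opposite to the corner `κ_τ(τ')`; locality transfers this to the iterated subdivision of
  -- that side.
  refine hdiv.iterMap_congr hΔ (hdiv.dimEq hΔ) (hvt.isEmb_cornerMap τ)
    ((isEmb_permMap r).comp (hvt.isEmb_cornerMap τ')) (oppFace_mem hd (kappa τ τ'))
    (fun y hy => ?_) k hx (mem_hull_oppFace.2 ⟨?_, hx0⟩)
  · obtain ⟨i, hi, rfl⟩ := Finset.mem_image.1 (Finset.mem_coe.1 hy)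
    obtain ⟨i', hi'⟩ := hvt.surj ((hvt.mem_iff hd h).2 (Finset.ne_of_mem_erase hi))
    rw [Function.comp_apply, permMap_corner, cornerMap_corner, cornerMap_corner,
      hr i i' hi'.symm, hi']
  · exact (hdiv.iter_subdivides hΔ k).subset_hull_topFace hx (by simp)

/-- Both composites are induced by simplicial maps from `Δ_d` to `div Δ_d` that agree on the
corners. -/
theorem iterAut_cellMap {τ τ' : Facet d div} {σ r : Equiv.Perm (Fin (d + 1))}
    (h : ∀ i, vt τ' (r i) = autMap div σ (vt τ i)) {x : Pt (d + 1)}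
    (hx : x ∈ ((div (d + 1))^[k] (stdCpx d)).vertices) :
    iterAut div (k + 1) σ (cellMap div k (vt τ) x) =
      cellMap div k (vt τ') (iterAut div k r x) := by
  have hΔ := dimEq_stdCpx d
  have hK := hdiv.dimEq hΔ
  refine (hdiv.iterMap_comp hΔ hK hK (hvt.isEmb_cornerMap τ) (isEmb_autMap σ hdiv) k hx).symm.trans
    (Eq.trans ?_ (hdiv.iterMap_comp hΔ hΔ hK (isEmb_permMap r) (hvt.isEmb_cornerMap τ') k hx))
  refine hdiv.iterMap_congr hΔ hK ((hvt.isEmb_cornerMap τ).comp (isEmb_autMap σ hdiv))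
    ((isEmb_permMap r).comp (hvt.isEmb_cornerMap τ')) (topFace_mem d) (fun y hy => ?_) k hx
    ((hdiv.iter_subdivides hΔ k).subset_hull_topFace hx (by simp))
  obtain ⟨i, -, rfl⟩ := Finset.mem_image.1 (Finset.mem_coe.1 hy)
  rw [Function.comp_apply, Function.comp_apply, permMap_corner, cornerMap_corner, cornerMap_corner,
    h]

end IsVertexLabelling

variable (hdiv : IsInclusionUniform d div) (k : ℕ)
include hdiv

theorem isEmb_iterAut (σ : Equiv.Perm (Fin (d + 1))) :
    IsEmb ((div (d + 1))^[k] (stdCpx d)) ((div (d + 1))^[k] (stdCpx d)) (iterAut div k σ) :=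
  hdiv.isEmb_iterMap (dimEq_stdCpx d) (dimEq_stdCpx d) (isEmb_permMap σ) k

theorem exists_cell {t : Finset (Pt (d + 1))}
    (ht : t ∈ Faces ((div (d + 1))^[k + 1] (stdCpx d)) d) :
    ∃ τ : Facet d div, (t : Set (Pt (d + 1))) ⊆ convexHull ℝ (τ.1 : Set (Pt (d + 1))) := by
  have hK := hdiv.dimEq (dimEq_stdCpx d)
  obtain ⟨u, hu, htu⟩ := (hdiv.iter_subdivides hK k).sub t ht.1
  have h1 := card_le_of_subset_hull ht.1 htu
  have h2 := hK.1.2 u hu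
  rw [ht.2] at h1
  exact ⟨⟨u, hu, le_antisymm h2 h1⟩, htu⟩

omit hdiv in
theorem subset_hull_inter {τ τ' : Facet d div} {s : Finset (Pt (d + 1))}
    (hs : s ∈ ((div (d + 1))^[k + 1] (stdCpx d)).faces)
    (h1 : (s : Set (Pt (d + 1))) ⊆ convexHull ℝ (τ.1 : Set (Pt (d + 1))))
    (h2 : (s : Set (Pt (d + 1))) ⊆ convexHull ℝ (τ'.1 : Set (Pt (d + 1)))) :
    (s : Set (Pt (d + 1))) ⊆ convexHull ℝ ((τ.1 ∩ τ'.1 : Finset (Pt (d + 1))) : Set (Pt (d + 1))) ∧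
      s.card ≤ (τ.1 ∩ τ'.1).card := by
  have h3 : (s : Set (Pt (d + 1))) ⊆
      convexHull ℝ ((τ.1 ∩ τ'.1 : Finset (Pt (d + 1))) : Set (Pt (d + 1))) := fun x hx =>
    (mem_hull_inter τ.2.1 τ'.2.1 (h1 hx) (h2 hx)).1
  exact ⟨h3, card_le_of_subset_hull hs h3⟩

omit hdiv in
theorem card_inter_lt {τ τ' : Facet d div} (hne : τ ≠ τ') : (τ.1 ∩ τ'.1).card < d + 1 := by
  refine (Finset.card_lt_card (Finset.ssubset_iff_subset_ne.2
    ⟨Finset.inter_subset_left, fun he => hne (Subtype.ext ?_)⟩)).trans_eq τ.2.2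
  refine Finset.eq_of_subset_of_card_le (Finset.inter_eq_left.1 he) ?_
  rw [τ.2.2, τ'.2.2]

omit hdiv in
theorem cell_unique {τ τ' : Facet d div} {s : Finset (Pt (d + 1))}
    (hs : s ∈ Faces ((div (d + 1))^[k + 1] (stdCpx d)) d)
    (h1 : (s : Set (Pt (d + 1))) ⊆ convexHull ℝ (τ.1 : Set (Pt (d + 1))))
    (h2 : (s : Set (Pt (d + 1))) ⊆ convexHull ℝ (τ'.1 : Set (Pt (d + 1)))) : τ = τ' := by
  by_contra hne
  have := (subset_hull_inter k hs.1 h1 h2).2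
  have := card_inter_lt hne
  rw [hs.2] at *
  omega

omit hdiv in
theorem adj_of_common_ridge (hd : 1 ≤ d) {τ τ' : Facet d div} {s : Finset (Pt (d + 1))}
    (hs : s ∈ ((div (d + 1))^[k + 1] (stdCpx d)).faces) (hc : s.card = d) (hne : τ ≠ τ')
    (h1 : (s : Set (Pt (d + 1))) ⊆ convexHull ℝ (τ.1 : Set (Pt (d + 1))))
    (h2 : (s : Set (Pt (d + 1))) ⊆ convexHull ℝ (τ'.1 : Set (Pt (d + 1)))) :
    (divGraph d div).Adj τ τ' := by
  have h3 := (subset_hull_inter k hs h1 h2).2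
  have h4 := card_inter_lt hne
  refine (dualGraph_adj hd).2 ⟨hne, ?_⟩
  omega

/-- A ridge in the `j`-th side of `Δ_d` and in the cell `τ` lies in a boundary ridge of `τ`. -/
theorem exists_side_of_cell {τ : Facet d div} {s : Finset (Pt (d + 1))}
    (hs : s ∈ ((div (d + 1))^[k + 1] (stdCpx d)).faces) (hc : s.card = d) {j : Fin (d + 1)}
    (hj : ∀ x ∈ s, x j = 0)
    (h1 : (s : Set (Pt (d + 1))) ⊆ convexHull ℝ (τ.1 : Set (Pt (d + 1)))) :
    ∃ v ∈ τ.1, (∀ x ∈ τ.1.erase v, x j = 0) ∧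
      (s : Set (Pt (d + 1))) ⊆ convexHull ℝ (τ.1.erase v : Set (Pt (d + 1))) := by
  have hK := hdiv.subdivides_std
  have h2 : (s : Set (Pt (d + 1))) ⊆
      convexHull ℝ ((τ.1.filter fun v => v j = 0 : Finset (Pt (d + 1))) : Set (Pt (d + 1))) := by
    intro x hx
    obtain ⟨w, h0, hsum, hwx⟩ := Finset.mem_convexHull'.1 (h1 hx)
    have hz : ∑ v ∈ τ.1, w v * v j = 0 := by
      rw [← hj x hx, ← hwx, Finset.sum_apply]
      rfl
    -- The `j`-th coordinates of the vertices of `τ` are nonnegative and average to zero, so only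
    -- vertices in the `j`-th side carry weight. As `s` has `d` points, at least `d` such vertices
    -- exist.
    have hz' := (Finset.sum_eq_zero_iff_of_nonneg fun v hv =>
      mul_nonneg (h0 v hv) (hK.coord_nonneg τ.2.1 hv j)).1 hz
    have hw : ∀ v ∈ τ.1, v ∉ τ.1.filter (fun v => v j = 0) → w v = 0 := fun v hv hv' =>
      (mul_eq_zero.1 (hz' v hv)).resolve_right fun h => hv' (Finset.mem_filter.2 ⟨hv, h⟩)
    refine Finset.mem_convexHull'.2 ⟨w, fun v hv => h0 v (Finset.mem_filter.1 hv).1, ?_, ?_⟩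
    · rw [Finset.sum_subset (Finset.filter_subset _ _) hw, hsum]
    · rw [Finset.sum_subset (Finset.filter_subset _ _) fun v hv hv' => by
        rw [hw v hv hv', zero_smul], hwx]
  have h3 := card_le_of_subset_hull hs h2
  obtain ⟨v, hv, hvj⟩ : ∃ v ∈ τ.1, v j ≠ 0 := by
    by_contra! hcon
    exact hK.facet_not_onSide τ.2 j hcon
  have h4 : (τ.1.filter fun v => v j = 0) ⊆ τ.1.erase v := fun x hx => by
    obtain ⟨h5, h6⟩ := Finset.mem_filter.1 hx
    exact Finset.mem_erase.2 ⟨fun e => hvj (e ▸ h6), h5⟩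
  have h5 : (τ.1.filter fun v => v j = 0) = τ.1.erase v := by
    refine Finset.eq_of_subset_of_card_le h4 ?_
    rw [Finset.card_erase_of_mem hv, τ.2.2]
    omega
  rw [h5] at h2
  refine ⟨v, hv, fun x hx => ?_, h2⟩
  rw [← h5] at hx
  exact (Finset.mem_filter.1 hx).2

end Cells

/-! ### Words and facets of iterated subdivisions -/

section Words

variable {d : ℕ} {div : CpxOp} {vt : Facet d div → Fin (d + 1) → Pt (d + 1)}
  {D : FractalData d (fNum div (d - 1)) (Facet d div)}

/-- The facet of `div^{k+1} Δ_d` addressed by a word. -/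
noncomputable def wordFace (vt : Facet d div → Fin (d + 1) → Pt (d + 1)) :
    (k : ℕ) → Word (Facet d div) k → Finset (Pt (d + 1))
  | 0, τ => Subtype.val (τ : Facet d div)
  | k + 1, x =>
    (wordFace vt k (x : Facet d div × Word (Facet d div) k).2).image
      (cellMap div (k + 1) (vt (x : Facet d div × Word (Facet d div) k).1))

theorem IsDivData.coe_act (hdiv : IsInclusionUniform d div) (hD : IsDivData D)
    (σ : Equiv.Perm (Fin (d + 1))) (τ : Facet d div) :
    (D.act σ τ).1 = τ.1.image (autMap div σ) :=
  hD.act_eq σ _ (isCornerIso_autMap σ hdiv) τ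

theorem IsDivData.isLabelling (hD : IsDivData D) :
    IsLabelling (divGraph d div) (divBdry d div) D.kappa := by
  rw [← hD.graph_eq, ← hD.bdry_eq]
  exact D.isLabelling

variable (hd : 1 ≤ d) (hdiv : IsInclusionUniform d div) (hD : IsDivData D)
  (hvt : IsVertexLabelling D.kappa vt)
include hdiv hvt

theorem wordFace_mem (k : ℕ) (w : Word (Facet d div) k) :
    wordFace vt k w ∈ Faces ((div (d + 1))^[k + 1] (stdCpx d)) d := by
  induction k with
  | zero => exact Subtype.prop (w : Facet d div)
  | succ k ih =>
    obtain ⟨τ, w⟩ := (w : Facet d div × Word (Facet d div) k)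
    exact ⟨(hvt.isEmb_cellMap hdiv (k + 1) τ).map _ (ih w).1,
      (hvt.cellMap_image_card hdiv (k + 1) τ (ih w).1).trans (ih w).2⟩

theorem wordFace_subset_hull (k : ℕ) (τ : Facet d div) (w : Word (Facet d div) k) :
    (((wordFace vt k w).image (cellMap div (k + 1) (vt τ)) : Finset (Pt (d + 1))) :
      Set (Pt (d + 1))) ⊆ convexHull ℝ (τ.1 : Set (Pt (d + 1))) :=
  hvt.cellMap_subset_hull hdiv (k + 1) τ (wordFace_mem hdiv hvt k w).1

theorem cellMap_image_inj (k : ℕ) (τ : Facet d div) {s t : Finset (Pt (d + 1))}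
    (hs : s ∈ ((div (d + 1))^[k] (stdCpx d)).faces) (ht : t ∈ ((div (d + 1))^[k] (stdCpx d)).faces)
    (h : s.image (cellMap div k (vt τ)) = t.image (cellMap div k (vt τ))) : s = t := by
  have e : cellMap div k (vt τ) '' (s : Set (Pt (d + 1))) = cellMap div k (vt τ) '' t := by
    rw [← Finset.coe_image, ← Finset.coe_image, h]
  exact Finset.coe_injective (((hvt.isEmb_cellMap hdiv k τ).inj.image_eq_image_iff
    (fun x hx => mem_vertices_of_mem_face hs hx)
    (fun x hx => mem_vertices_of_mem_face ht hx)).1 e)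

/-- The first letter is recovered as the unique cell containing the facet, the rest from injectivity
of the parametrization of that cell. -/
theorem wordFace_injective (k : ℕ) : Function.Injective (wordFace vt k) := by
  induction k with
  | zero => exact Subtype.val_injective
  | succ k ih =>
    rintro ⟨τ, w⟩ ⟨τ', w'⟩ h
    have hττ' : τ = τ' := by
      refine cell_unique (k + 1) (wordFace_mem hdiv hvt (k + 1) (τ, w))
        (wordFace_subset_hull hdiv hvt k τ w) ?_
      rw [h]
      exact wordFace_subset_hull hdiv hvt k τ' w'
    subst hττ'
    have := ih (cellMap_image_inj hdiv hvt (k + 1) τ (wordFace_mem hdiv hvt k w).1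
      (wordFace_mem hdiv hvt k w').1 h)
    rw [this]

theorem wordFace_surjective (k : ℕ) {t : Finset (Pt (d + 1))}
    (ht : t ∈ Faces ((div (d + 1))^[k + 1] (stdCpx d)) d) : ∃ w, wordFace vt k w = t := by
  induction k generalizing t with
  | zero => exact ⟨(⟨t, ht⟩ : Facet d div), rfl⟩
  | succ k ih =>
    obtain ⟨τ, htτ⟩ := exists_cell hdiv (k + 1) ht
    obtain ⟨s, hs, rfl⟩ := hvt.cellMap_surj hdiv (k + 1) τ ht.1 htτ
    obtain ⟨w, rfl⟩ := ih ⟨hs, (hvt.cellMap_image_card hdiv (k + 1) τ hs).symm.trans ht.2⟩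
    exact ⟨(τ, w), rfl⟩

include hD

/-- This explains the twist `σ (i, v) = (σ i, ν_{σ,i} v)`: an automorphism maps cell to cell, and by
`nu_apply` it acts on the parameters through `ν`. -/
theorem wordFace_act (k : ℕ) (σ : Equiv.Perm (Fin (d + 1))) (w : Word (Facet d div) k) :
    wordFace vt k ((D.level k).act σ w) = (wordFace vt k w).image (iterAut div (k + 1) σ) := by
  induction k generalizing σ with
  | zero => exact hD.coe_act hdiv σ w
  | succ k ih =>
    obtain ⟨τ, w⟩ := (w : Facet d div × Word (Facet d div) k)
    change (wordFace vt k ((D.level k).act (D.nu σ τ) w)).image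
      (cellMap div (k + 1) (vt (D.act σ τ))) = ((wordFace vt k w).image
        (cellMap div (k + 1) (vt τ))).image (iterAut div (k + 1 + 1) σ)
    rw [ih, Finset.image_image, Finset.image_image]
    refine Finset.image_congr fun x hx => ?_
    have hnu := hvt.nu_apply hdiv D.toLabelledGraph hD.graph_eq hD.bdry_eq rfl
      (hD.coe_act hdiv) σ τ
    exact (hvt.iterAut_cellMap hdiv (k + 1) hnu
      (mem_vertices_of_mem_face (wordFace_mem hdiv hvt k w).1 hx)).symm

include hd

/-- The product formula for the boundary holds because loops carry the index of their side: the
ridge of a cell lying in side `l` has label `l`, so it is parametrized by side `l` of `Δ_d`. -/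
theorem mem_level_bdry (k : ℕ) (w : Word (Facet d div) k) (l : Fin (d + 1)) :
    w ∈ (D.level k).bdry l ↔
      ∃ ν ⊆ wordFace vt k w, ν.card = d ∧ ∀ x ∈ ν, x l = 0 := by
  induction k with
  | zero =>
    have key : ∀ τ : Facet d div, τ ∈ D.bdry l ↔ ∃ ν ⊆ τ.1, ν.card = d ∧ ∀ x ∈ ν, x l = 0 := by
      intro τ
      rw [hD.bdry_eq, mem_divBdry hd hdiv]
      constructor
      · rintro ⟨v, hv, h⟩
        refine ⟨_, Finset.erase_subset v _, ?_, h⟩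
        rw [Finset.card_erase_of_mem hv, τ.2.2]
        rfl
      · rintro ⟨ν, hν, hc, h⟩
        obtain ⟨v, hv, rfl⟩ := exists_eq_erase hν hc τ.2.2
        exact ⟨v, hv, h⟩
    exact key w
  | succ k ih =>
    obtain ⟨τ, w⟩ := (w : Facet d div × Word (Facet d div) k)
    have hw := wordFace_mem hdiv hvt k w
    have hw' := wordFace_mem hdiv hvt (k + 1) (τ, w)
    have hne : ∀ {ν : Finset (Pt (d + 1))}, ν.card = d → ν.Nonempty := fun h =>
      Finset.card_pos.1 (by omega)
    change (τ ∈ D.bdry l ∧ w ∈ (D.level k).bdry l) ↔ ∃ ν ⊆ (wordFace vt k w).image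
      (cellMap div (k + 1) (vt τ)), ν.card = d ∧ ∀ x ∈ ν, x l = 0
    rw [ih, hD.bdry_eq, mem_divBdry hd hdiv]
    constructor
    · rintro ⟨⟨v, hv, hvl⟩, ν, hν, hc, h⟩
      have hνf := Geometry.SimplicialComplex.down_closed hw.1 hν (hne hc)
      have hv' := hvt.unique τ v hv l
        (Or.inr ⟨(erase_mem_sideFaces hd hdiv hv).2 hvl, Finset.erase_subset _ _⟩)
      refine ⟨ν.image (cellMap div (k + 1) (vt τ)), Finset.image_subset_image hν,
        (hvt.cellMap_image_card hdiv (k + 1) τ hνf).trans hc, fun x hx => ?_⟩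
      have := (hvt.cellMap_onSide_iff hdiv (k + 1) hd τ hνf l).1 h hx
      rw [← hv'] at this
      exact affine_zero_of_mem_hull (coordMap l).toAffineMap hvl this
    · rintro ⟨ν, hν, hc, h⟩
      have hνf := Geometry.SimplicialComplex.down_closed hw'.1 hν (hne hc)
      obtain ⟨v, hv, hvl, hνv⟩ := exists_side_of_cell hdiv (k + 1) hνf hc h
        ((Finset.coe_subset.2 hν).trans (wordFace_subset_hull hdiv hvt k τ w))
      have hv' := hvt.unique τ v hv l
        (Or.inr ⟨(erase_mem_sideFaces hd hdiv hv).2 hvl, Finset.erase_subset _ _⟩)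
      obtain ⟨ν', hν', rfl⟩ := Finset.subset_image_iff.1 hν
      have hν'f := Geometry.SimplicialComplex.down_closed hw.1 hν'
        (Finset.image_nonempty.1 (hne hc))
      rw [hv'] at hνv
      exact ⟨⟨v, hv, hvl⟩, ν', hν', (hvt.cellMap_image_card hdiv (k + 1) τ hν'f).symm.trans hc,
        (hvt.cellMap_onSide_iff hdiv (k + 1) hd τ hν'f l).2 hνv⟩

/-- The heart of the proof. Within one cell, parametrization preserves intersections; across two
cells, shared ridges lie in the wall, where `ρ` compares the two parametrizations. -/
theorem level_adj_iff (k : ℕ) (w w' : Word (Facet d div) k) :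
    (D.level k).graph.Adj w w' ↔ w ≠ w' ∧ (wordFace vt k w ∩ wordFace vt k w').card = d := by
  induction k with
  | zero =>
    change D.graph.Adj w w' ↔ _
    rw [hD.graph_eq]
    exact dualGraph_adj hd
  | succ k ih =>
    obtain ⟨τ, w⟩ := (w : Facet d div × Word (Facet d div) k)
    obtain ⟨τ', w'⟩ := (w' : Facet d div × Word (Facet d div) k)
    have hw := wordFace_mem hdiv hvt k w
    have hw' := wordFace_mem hdiv hvt k w'
    have hne : ∀ {ν : Finset (Pt (d + 1))}, ν.card = d → ν.Nonempty := fun h =>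
      Finset.card_pos.1 (by omega)
    have hN := hdiv.iter_subdivides (dimEq_stdCpx d) (k + 1)
    change ((τ = τ' ∧ (D.level k).graph.Adj w w') ∨ (D.graph.Adj τ τ' ∧
      w ∈ (D.level k).bdry (D.kappa τ τ') ∧ w' ∈ (D.level k).bdry (D.kappa τ' τ) ∧
        (D.level k).act (D.rho τ τ') w = w')) ↔
      ((τ, w) : Facet d div × Word (Facet d div) k) ≠ (τ', w') ∧
      ((wordFace vt k w).image (cellMap div (k + 1) (vt τ)) ∩
        (wordFace vt k w').image (cellMap div (k + 1) (vt τ'))).card = d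
    by_cases hττ' : τ = τ'
    · subst hττ'
      have hE := hvt.isEmb_cellMap hdiv (k + 1) τ
      have h1 : ((wordFace vt k w).image (cellMap div (k + 1) (vt τ)) ∩
          (wordFace vt k w').image (cellMap div (k + 1) (vt τ))).card =
          (wordFace vt k w ∩ wordFace vt k w').card := by
        rw [← Finset.image_inter_of_injOn _ _ (hE.inj.mono ?_),
          Finset.card_image_of_injOn ((hE.injOn hw.1).mono
            (Finset.coe_subset.2 Finset.inter_subset_left))]
        rintro x (hx | hx)
        exacts [mem_vertices_of_mem_face hw.1 hx, mem_vertices_of_mem_face hw'.1 hx]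
      rw [h1, ih]
      constructor
      · rintro (⟨-, h2, h3⟩ | ⟨h2, -⟩)
        · exact ⟨fun e => h2 (congrArg Prod.snd e), h3⟩
        · exact absurd h2 (D.graph.loopless.irrefl τ)
      · rintro ⟨h2, h3⟩
        exact Or.inl ⟨rfl, fun e => h2 (by rw [e]), h3⟩
    · have hneq : ((τ, w) : Facet d div × Word (Facet d div) k) ≠ (τ', w') :=
        fun e => hττ' (congrArg Prod.fst e)
      simp only [hττ', false_and, false_or, hneq, ne_eq, not_false_eq_true, true_and]
      rw [hD.graph_eq, mem_level_bdry hd hdiv hD hvt, mem_level_bdry hd hdiv hD hvt]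
      have hact := wordFace_act hdiv hD hvt k (D.rho τ τ') w
      -- A face `F` in the side glued to `τ'` has the same image through `τ` as its translate by `ρ`
      -- has through `τ'`.
      have hglue : ∀ {F}, (divGraph d div).Adj τ τ' → F ⊆ wordFace vt k w →
          (∀ x ∈ F, x (D.kappa τ τ') = 0) →
          F.image (cellMap div (k + 1) (vt τ)) =
            (F.image (iterAut div (k + 1) (D.rho τ τ'))).image (cellMap div (k + 1) (vt τ')) := by
        intro F hadj hF h0
        rw [Finset.image_image]
        refine Finset.image_congr fun x hx => ?_
        exact hvt.cellMap_eq_of_adj hdiv (k + 1) hd hadj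
          (fun i i' hi => hD.rho_vertex hd hvt hadj hi)
          (mem_vertices_of_mem_face hw.1 (hF hx)) (h0 x hx)
      constructor
      · rintro ⟨hadj, ⟨F, hF, hFc, hF0⟩, -, rfl⟩
        have hFf := Geometry.SimplicialComplex.down_closed hw.1 hF (hne hFc)
        have hG := hglue hadj hF hF0
        have hGsub : F.image (iterAut div (k + 1) (D.rho τ τ')) ⊆
            wordFace vt k ((D.level k).act (D.rho τ τ') w) := by
          rw [hact]
          exact Finset.image_subset_image hF
        have hsub : F.image (cellMap div (k + 1) (vt τ)) ⊆
            (wordFace vt k w).image (cellMap div (k + 1) (vt τ)) ∩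
              (wordFace vt k ((D.level k).act (D.rho τ τ') w)).image
                (cellMap div (k + 1) (vt τ')) := by
          refine Finset.subset_inter (Finset.image_subset_image hF) ?_
          rw [hG]
          exact Finset.image_subset_image hGsub
        -- Distinct facets share at most `d` vertices, and the glued ridge supplies `d` of them.
        refine le_antisymm ?_ ?_
        · have hX := wordFace_mem hdiv hvt (k + 1) (τ, w)
          have hX' := wordFace_mem hdiv hvt (k + 1) (τ', (D.level k).act (D.rho τ τ') w)
          refine Nat.lt_succ_iff.1 ((Finset.card_lt_card (Finset.ssubset_iff_subset_ne.2
            ⟨Finset.inter_subset_left, fun he => hneq ?_⟩)).trans_eq hX.2)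
          refine wordFace_injective hdiv hvt (k + 1)
            (Finset.eq_of_subset_of_card_le (Finset.inter_eq_left.1 he) ?_)
          rw [hX.2, hX'.2]
        · exact (hFc.symm.trans (hvt.cellMap_image_card hdiv (k + 1) τ hFf).symm).trans_le
            (Finset.card_le_card hsub)
      · intro hc
        set F := (wordFace vt k w).image (cellMap div (k + 1) (vt τ)) ∩
          (wordFace vt k w').image (cellMap div (k + 1) (vt τ')) with hFdef
        have hFl : F ⊆ (wordFace vt k w).image (cellMap div (k + 1) (vt τ)) :=
          Finset.inter_subset_left
        have hFr : F ⊆ (wordFace vt k w').image (cellMap div (k + 1) (vt τ')) :=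
          Finset.inter_subset_right
        have hFf := Geometry.SimplicialComplex.down_closed
          (wordFace_mem hdiv hvt (k + 1) (τ, w)).1 hFl (hne hc)
        have hFτ := (Finset.coe_subset.2 hFl).trans (wordFace_subset_hull hdiv hvt k τ w)
        have hFτ' := (Finset.coe_subset.2 hFr).trans (wordFace_subset_hull hdiv hvt k τ' w')
        have hadj := adj_of_common_ridge (k + 1) hd hFf hc hττ' hFτ hFτ'
        have hFi := (subset_hull_inter (k + 1) hFf hFτ hFτ').1
        obtain ⟨F₁, hF₁, e₁⟩ := Finset.subset_image_iff.1 hFl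
        obtain ⟨F₂, hF₂, e₂⟩ := Finset.subset_image_iff.1 hFr
        have hF₁f := Geometry.SimplicialComplex.down_closed hw.1 hF₁
          (Finset.image_nonempty.1 (e₁ ▸ hne hc))
        have hF₂f := Geometry.SimplicialComplex.down_closed hw'.1 hF₂
          (Finset.image_nonempty.1 (e₂ ▸ hne hc))
        have hF₁0 : ∀ x ∈ F₁, x (D.kappa τ τ') = 0 := by
          refine (hvt.cellMap_onSide_iff hdiv (k + 1) hd τ hF₁f _).2 ?_
          rw [e₁, ← (hvt.inter_eq_erase hd hadj).1]
          exact hFi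
        have hF₂0 : ∀ x ∈ F₂, x (D.kappa τ' τ) = 0 := by
          refine (hvt.cellMap_onSide_iff hdiv (k + 1) hd τ' hF₂f _).2 ?_
          rw [e₂, ← (hvt.inter_eq_erase hd hadj.symm).1, Finset.inter_comm]
          exact hFi
        have hF₁c : F₁.card = d := by
          rw [← hvt.cellMap_image_card hdiv (k + 1) τ hF₁f, e₁, hc]
        have hF₂c : F₂.card = d := by
          rw [← hvt.cellMap_image_card hdiv (k + 1) τ' hF₂f, e₂, hc]
        have hAut := isEmb_iterAut hdiv (k + 1) (D.rho τ τ')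
        -- `F₁` and `F₂` parametrize the same ridge from the two sides of the wall, so gluing and
        -- injectivity show that `ρ` carries one to the other.
        have hG : F₁.image (iterAut div (k + 1) (D.rho τ τ')) = F₂ := by
          refine cellMap_image_inj hdiv hvt (k + 1) τ' (hAut.map _ hF₁f) hF₂f ?_
          rw [← hglue hadj hF₁ hF₁0, e₁, e₂]
        refine ⟨hadj, ⟨F₁, hF₁, hF₁c, hF₁0⟩, ⟨F₂, hF₂, hF₂c, hF₂0⟩, ?_⟩
        -- The facets of `ρ w` and of `w'` both contain `F₂`, which lies in a side of `Δ_d`; such a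
        -- ridge lies in only one facet.
        refine wordFace_injective hdiv hvt k (hN.facet_eq_of_onSide hd
          (wordFace_mem hdiv hvt k _) hw' (s := F₂) ?_ hF₂ hF₂c hF₂0)
        rw [hact, ← hG]
        exact Finset.image_subset_image hF₁

theorem nonempty_iso (k : ℕ) :
    Nonempty (removeLoops (D.gamma k) ≃g dualGraph (iterDiv div d (k + 1)) d) := by
  let f : (D.gamma k).vertexSet → Faces (iterDiv div d (k + 1)) d :=
    fun w => ⟨wordFace vt k w.1, wordFace_mem hdiv hvt k w.1⟩
  have hf : Function.Bijective f := by
    refine ⟨fun w w' h => Subtype.ext (wordFace_injective hdiv hvt k (congrArg Subtype.val h)),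
      fun t => ?_⟩
    obtain ⟨w, hw⟩ := wordFace_surjective hdiv hvt k t.2
    exact ⟨⟨w, Set.mem_univ _⟩, Subtype.ext hw⟩
  refine ⟨⟨Equiv.ofBijective f hf, fun {w w'} => ?_⟩⟩
  rw [Equiv.ofBijective_apply, Equiv.ofBijective_apply, dualGraph_adj hd]
  have h1 := level_adj_iff hd hdiv hD hvt k w.1 w'.1
  have h2 : (removeLoops (D.gamma k)).Adj w w' ↔ (D.level k).graph.Adj w.1 w'.1 := by
    constructor
    · rintro ⟨hne, e, ⟨-, h⟩ | ⟨h, -⟩⟩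
      · exact h
      · exact absurd (Subtype.ext h) hne
    · intro h
      exact ⟨fun e => (D.level k).graph.loopless.irrefl w.1 (by rw [← e] at h; exact h),
        _, Or.inl ⟨rfl, h⟩⟩
  rw [h2, h1]
  exact and_congr (not_congr ⟨fun h => wordFace_injective hdiv hvt k
    (congrArg Subtype.val h), fun h => congrArg f (Subtype.ext h)⟩) Iff.rfl

end Words

/-! ### Counting loops and vertices -/

section Counting

variable {d : ℕ} {div : CpxOp}

instance Word.instFinite {V : Type*} [Finite V] (k : ℕ) : Finite (Word V k) := by
  induction k with
  | zero => exact (inferInstance : Finite V)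
  | succ k ih => exact (inferInstance : Finite (V × Word V k))

theorem card_word (V : Type*) (k : ℕ) : Nat.card (Word V k) = Nat.card V ^ (k + 1) := by
  induction k with
  | zero => exact (pow_one _).symm
  | succ k ih =>
    rw [pow_succ', ← ih]
    exact Nat.card_prod V (Word V k)

theorem level_bdry_ncard {n : ℕ} {V : Type*} (D : FractalData d n V) (k : ℕ) (l : Fin (d + 1)) :
    ((D.level k).bdry l).ncard = n ^ (k + 1) := by
  induction k with
  | zero => exact (D.bdry_card l).trans (pow_one _).symm
  | succ k ih =>
    refine Eq.trans (Set.ncard_prod (s := D.bdry l) (t := (D.level k).bdry l)) ?_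
    rw [D.bdry_card, ih, ← pow_succ']

theorem numLoops_gamma {n : ℕ} {V : Type*} [Finite V] (D : FractalData d n V) (k : ℕ) :
    numLoops (D.gamma k) = (d + 1) * n ^ (k + 1) := by
  let f : (Σ i : Fin (d + 1), (D.level k).bdry i) → Sym2 (Word V k) ⊕ Word V k × Fin (d + 1) :=
    fun p => Sum.inr (p.2.1, p.1)
  have hf : Function.Injective f := by
    rintro ⟨i, x, hx⟩ ⟨j, y, hy⟩ h
    obtain ⟨h1, h2⟩ := Prod.mk.inj (Sum.inr_injective h)
    subst h2
    cases h1
    rfl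
  have hr : {e | ∃ x, (D.gamma k).IsLoopAt e x} = Set.range f := by
    ext e
    constructor
    · rintro ⟨x, ⟨-, h⟩ | ⟨-, i, hi, he⟩⟩
      · exact absurd h ((D.level k).graph.loopless.irrefl x)
      · exact ⟨⟨i, x, hi⟩, he.symm⟩
    · rintro ⟨⟨i, x, hx⟩, rfl⟩
      exact ⟨x, Or.inr ⟨rfl, i, hx, rfl⟩⟩
  rw [numLoops, hr, ← Set.image_univ, Set.ncard_image_of_injective _ hf, Set.ncard_univ,
    Nat.card_sigma]
  simp [Nat.card_coe_set_eq, level_bdry_ncard]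

theorem ncard_vertexSet_gamma {n : ℕ} {V : Type*} (D : FractalData d n V) (k : ℕ) :
    (D.gamma k).vertexSet.ncard = Nat.card V ^ (k + 1) := by
  rw [← card_word V k]
  exact Set.ncard_univ _

theorem finite_facet (hdiv : IsInclusionUniform d div) : Finite (Facet d div) :=
  (hdiv.subdivides_std.finite.subset fun _ hs => hs.1 : (Faces _ d).Finite)

/-- A facet of `div Δ_d` with a ridge in every side is `Δ_d` itself. -/
theorem facet_eq_topFace (hd : 1 ≤ d) (hdiv : IsInclusionUniform d div) {τ : Facet d div}
    (h : ∀ j, τ ∈ divBdry d div j) : τ.1 = topFace d := by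
  obtain ⟨kappa, hk⟩ := exists_isLabelling hd hdiv
  obtain ⟨vt, hvt⟩ := exists_isVertexLabelling hd hdiv hk
  rw [← hvt.image_univ τ, topFace]
  refine Finset.image_congr fun i _ => ?_
  have h0 : ∀ j, j ≠ i → vt τ i j = 0 := by
    intro j hj
    obtain ⟨v, hv, hvj⟩ := (mem_divBdry hd hdiv).1 (h j)
    have := hvt.unique τ v hv j
      (Or.inr ⟨(erase_mem_sideFaces hd hdiv hv).2 hvj, Finset.erase_subset _ _⟩)
    refine hvj _ (Finset.mem_erase.2 ⟨fun e => hj ?_, hvt.mem τ i⟩)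
    exact hvt.inj τ (this.symm.trans e.symm)
  have hs := hdiv.subdivides_std.sumMap_eq_one τ.2.1 (hvt.mem τ i)
  rw [sumMap_apply, Finset.sum_eq_single i (fun j _ hj => h0 j hj) (by simp)] at hs
  funext j
  rw [corner_apply]
  by_cases hj : j = i
  · rw [if_pos hj, hj, hs]
  · rw [if_neg hj, h0 j hj]

theorem card_facet (d : ℕ) (div : CpxOp) : Nat.card (Facet d div) = fNum div d :=
  Nat.card_coe_set_eq _

/-- If one boundary set were everything, symmetry would give the same for all of them, and every
facet would equal `Δ_d`, contradicting the existence of two facets. -/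
theorem fNum_lt (hd : 1 ≤ d) (hdiv : IsInclusionUniform d div) (h : 1 < fNum div d) :
    fNum div (d - 1) < fNum div d := by
  have := finite_facet hdiv
  rw [← card_facet d, ← divBdry_ncard hd hdiv 0, ← Set.ncard_univ]
  refine Set.ncard_lt_ncard ((Set.subset_univ _).ssubset_of_ne fun he => ?_)
  have hall : ∀ j, divBdry d div j = Set.univ := fun j => by
    have h1 := facetAct_image_bdry (Equiv.swap 0 j) hdiv hd 0
    rw [he, Equiv.swap_apply_left] at h1
    rw [← h1, Set.image_univ]
    exact (facetAct hdiv (Equiv.swap 0 j)).surjective.range_eq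
  rw [← card_facet, Finite.one_lt_card_iff_nontrivial] at h
  obtain ⟨τ, τ', hne⟩ := h
  refine hne (Subtype.ext ?_)
  rw [facet_eq_topFace hd hdiv fun j => hall j ▸ Set.mem_univ τ,
    facet_eq_topFace hd hdiv fun j => hall j ▸ Set.mem_univ τ']

end Counting

/-! ### The main theorem. -/

theorem mainTheorem6 (d : ℕ) (hd : 1 ≤ d) (div : CpxOp) (hdiv : IsInclusionUniform d div) :
    -- labels exist, and every choice of labels gives rise to data of the required kind
    (∃ kappa, IsLabelling (divGraph d div) (divBdry d div) kappa) ∧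
    (∀ kappa, IsLabelling (divGraph d div) (divBdry d div) kappa →
      ∃ D : FractalData d (fNum div (d - 1)) (Facet d div), IsDivData D ∧ D.kappa = kappa) ∧
    -- the sequence built from any such data
    (∀ D : FractalData d (fNum div (d - 1)) (Facet d div), IsDivData D →
      (∀ k : ℕ, Nonempty (removeLoops (D.gamma k) ≃g dualGraph (iterDiv div d (k + 1)) d)) ∧
      (1 < fNum div d →
        (∀ k : ℕ, numLoops (D.gamma k) = (d + 1) * fNum div (d - 1) ^ (k + 1)) ∧
        Approximates D.gamma (fun k => dualGraph (iterDiv div d (k + 1)) d))) := by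
  refine ⟨exists_isLabelling hd hdiv, fun kappa hk => exists_fractalData hd hdiv hk,
    fun D hD => ?_⟩
  obtain ⟨vt, hvt⟩ := exists_isVertexLabelling hd hdiv hD.isLabelling
  have hiso := nonempty_iso hd hdiv hD hvt
  have := finite_facet hdiv
  refine ⟨hiso, fun h => ⟨numLoops_gamma D, hiso, ?_⟩⟩
  have hlt := fNum_lt hd hdiv h
  have hpos : (0 : ℝ) < fNum div d := by exact_mod_cast (Nat.zero_lt_one.trans h)
  set q : ℝ := (fNum div (d - 1) : ℝ) / fNum div d with hq
  have hq1 : q < 1 := (div_lt_one hpos).2 (by exact_mod_cast hlt)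
  have hq0 : 0 ≤ q := by positivity
  -- The proportion of loops is a geometric sequence with ratio `q = f_{d-1} / f_d < 1`.
  have e : (fun k => (numLoops (D.gamma k) : ℝ) / ((D.gamma k).vertexSet.ncard : ℝ)) =
      fun k => ((d : ℝ) + 1) * (q ^ (k + 1)) := by
    funext k
    rw [numLoops_gamma, ncard_vertexSet_gamma, card_facet, hq, div_pow]
    push_cast
    ring
  rw [e]
  have h1 := ((tendsto_pow_atTop_nhds_zero_of_lt_one hq0 hq1).comp (tendsto_add_atTop_nat 1))
  simpa using h1.const_mul ((d : ℝ) + 1)
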